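/- Let $N\ge 2$ and let $A=(a_{ij})$ be an $N\times N$ matrix with entries in $\{0,1\}$ and no zero row or column. Let $\mathcal O_A$ be the Cuntz–Krieger algebra, the universal $C^*$-algebra generated by partial isometries $s_1,\dots,s_N$ with $s_i^*s_i=\sum_j a_{ij}s_js_j^*$ and $\sum_i s_is_i^*=1$. A representation $(\mathcal H,\pi)$ of $\mathcal O_A$ (unital $*$-representation on a complex Hilbert space) is *permutative* if there are an orthonormal basis $(e_n)_{n\in\Lambda}$ of $\mathcal H$, subsets $\Lambda_i\subset\Lambda$ and indices $m_{i,n}\in\Lambda$ with $\pi(s_i)e_n=e_{m_{i,n}}$ for $n\in\Lambda_i$ and $\pi(s_i)e_n=0$ for $n\notin\Lambda_i$. Notation. Let $[1,\dots,N]_A^*$ be the set of finite words $J=(j_1,\dots,j_k)$, $k\ge1$, in $\{1,\dots,N\}$ with $a_{j_1j_2}=\dots=a_{j_{k-1}j_k}=a_{j_kj_1}=1$ that are lexicographically minimal among their cyclic rotations and are not of the form $J_0^m$ with $m\ge 2$. Let $[1,\dots,N]_A^\infty$ be the set of infinite words $K=(j_n)_{n\ge1}$ with $a_{j_nj_{n+1}}=1$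 for all $n$ that are not eventually periodic, modulo the equivalence relation of having a common tail. A representation is $P(J;z)$, for $z\in U(1)$, if it has a cyclic unit vector $\Omega$ with $\pi(s_{j_1}\cdots s_{j_k})\Omega=z\Omega$ such that $\{\pi(s_{j_l}\cdots s_{j_k})\Omega\}_{l=1}^k$ is orthonormal. It is $P(K)$ if it has a cyclic unit vector $\Omega$ such that $\{\pi(s_{j_n}^*\cdots s_{j_1}^*)\Omega\}_{n\ge1}$ is orthonormal; it is $P(\kappa)$, for $\kappa\in[1,\dots,N]_A^\infty$, if it is $P(K)$ for some $K$ in the class $\kappa$. Statement. Let $(\mathcal H,\pi)$ be a permutative representation of $\mathcal O_A$. Then: (1) There are cardinals $\nu_{J,p},\nu_{J,\infty}$ ($J\in[1,\dots,N]_A^*$, $p\ge1$) and $\nu_\kappa$ ($\kappa\in[1,\dots,N]_A^\infty$) and a decomposition $$\mathcal H\cong\bigoplus_{J}\Bigl[\bigoplus_{p\ge1}\Bigl\{\bigoplus_{j=1}^p\mathcal H_{J,p,j}\Bigr\}^{\oplus\nu_{J,p}}\oplus\Bigl\{\int_{U(1)}^{\oplus}\mathcal H_{J,\infty,z}\,dm(z)\Bigr\}^{\oplus\nu_{J,\infty}}\Bigr]\oplus\bigoplus_{\kappa}\mathcal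 H_{\kappa,0}^{\oplus\nu_\kappa}\qquad(*)$$ of representations, where $m$ is the Haar probability measure and $\mathcal H_{J,p,j}$, $\mathcal H_{J,\infty,z}$, $\mathcal H_{\kappa,0}$ are $P(J;e^{2\pi\sqrt{-1}\,j/p})$, $P(J;z)$, $P(\kappa)$, respectively. (2) In every decomposition $(*)$ of $\pi$, all the representations $\mathcal H_{J,p,j}$, $\mathcal H_{J,\infty,z}$ and $\mathcal H_{\kappa,0}$ are irreducible. In this sense $\pi$ is completely reducible. (3) Any two decompositions $(*)$ of $\pi$ coincide up to unitary equivalence: there are bijections between their summands $\mathcal H_{J,p,j}$ (all copies), between their direct integral summands, and between their summands $\mathcal H_{\kappa,0}$, such that corresponding summands are unitarily equivalent and have the same labels, namely $(J,e^{2\pi\sqrt{-1}\,j/p})$, $J$ and $\kappa$, respectively, and such that for corresponding direct integrals the representations $\mathcal H_{J,\infty,z}$ are unitarily equivalent for every $z$. In particular $\nu_{J,\infty}$, $\nu_\kappa$ and the multiplicity of each $P(J;z)$ as a direct summand are determined by $\pi$. Moreover, for each $J$ with $\sum_p\nu_{J,p}$ finite, the numbers $\nu_{J,p}$ are determined by $\pi$.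 -/

import Mathlib

open scoped ENNReal InnerProductSpace
open MeasureTheory

universe u

noncomputable section

namespace CuntzKrieger

/-! ## Matrices and multiindices -/

/-- `A ∈ M_N({0,1})`: all entries are `0` or `1`, and no row and no column is identically zero. -/
structure IsAdmissible {N : ℕ} (A : Matrix (Fin N) (Fin N) ℕ) : Prop where
  zero_or_one : ∀ i j, A i j = 0 ∨ A i j = 1
  row_ne_zero : ∀ i, ∃ j, A i j ≠ 0
  col_ne_zero : ∀ j, ∃ i, A i j ≠ 0

/-- Finite words `(j₁, …, j_k)`, `k ≥ 1`, with `a_{j_{l-1} j_l} = 1` for `2 ≤ l ≤ k` and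
`a_{j_k j₁} = 1` (for `k = 1` this says `a_{j₁ j₁} = 1`). -/
def IsCyclicWord {N : ℕ} (A : Matrix (Fin N) (Fin N) ℕ) (J : List (Fin N)) : Prop :=
  J.IsChain (fun i j => A i j = 1) ∧ ∃ h : J ≠ [], A (J.getLast h) (J.head h) = 1

/-- `J = J₀^m` for some `m ≥ 2` and some nonempty word `J₀`. -/
def IsPeriodicWord {N : ℕ} (J : List (Fin N)) : Prop :=
  ∃ (m : ℕ) (J₀ : List (Fin N)), 2 ≤ m ∧ J₀ ≠ [] ∧ J = (List.replicate m J₀).flatten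

/-- The number `∑ l, j_l N^(k-l)` attached to `J = (j₁, …, j_k)`, which orders the words of
length `k`; letters are numbered from `0`, which does not affect the order. -/
def wordValue {N : ℕ} (J : List (Fin N)) : ℕ :=
  Nat.ofDigits N (J.map Fin.val).reverse

/-- `J` comes first among its cyclic rotations. -/
def IsMinimalWord {N : ℕ} (J : List (Fin N)) : Prop :=
  ∀ J' : List (Fin N), J ~r J' → wordValue J ≤ wordValue J'

/-- `[1, …, N]_A^*`: the minimal non periodic cyclic words. -/
def PrimWord {N : ℕ} (A : Matrix (Fin N) (Fin N) ℕ) : Type :=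
  {J : List (Fin N) // IsCyclicWord A J ∧ IsMinimalWord J ∧ ¬ IsPeriodicWord J}

/-- Infinite words `(j_n)` with `a_{j_n j_{n+1}} = 1` for all `n`. -/
def IsInfWord {N : ℕ} (A : Matrix (Fin N) (Fin N) ℕ) (K : ℕ → Fin N) : Prop :=
  ∀ n, A (K n) (K (n + 1)) = 1

/-- `K = J₀ ∪ J₁^∞` for finite words `J₀` and `J₁`, where `q` is the length of `J₁`. -/
def IsEventuallyPeriodic {N : ℕ} (K : ℕ → Fin N) : Prop :=
  ∃ n₀ q : ℕ, 1 ≤ q ∧ ∀ n, n₀ ≤ n → K (n + q) = K n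

/-- The elements of `{1, …, N}_A^∞` which are not eventually periodic. -/
def AperiodicInfWord {N : ℕ} (A : Matrix (Fin N) (Fin N) ℕ) : Type :=
  {K : ℕ → Fin N // IsInfWord A K ∧ ¬ IsEventuallyPeriodic K}

/-- Tail equivalence: `K = J₃ ∪ J₅` and `K' = J₄ ∪ J₅` with finite words `J₃`, `J₄` (of
lengths `p`, `q`) and an infinite word `J₅`. -/
def tailSetoid {N : ℕ} (A : Matrix (Fin N) (Fin N) ℕ) : Setoid (AperiodicInfWord A) where
  r K K' := ∃ p q : ℕ, ∀ n, K.1 (n + p) = K'.1 (n + q)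
  iseqv :=
    { refl := fun _ => ⟨0, 0, fun _ => rfl⟩
      symm := fun ⟨p, q, h⟩ => ⟨q, p, fun n => (h n).symm⟩
      trans := by
        rintro K K' K'' ⟨p, q, h⟩ ⟨p', q', h'⟩
        refine ⟨p + p', q + q', fun n => ?_⟩
        have h1 := h (n + p')
        have h2 := h' (n + q)
        rw [show n + (p + p') = n + p' + p by omega, h1,
          show n + p' + q = n + q + p' by omega, h2,
          show n + q + q' = n + (q + q') by omega] }

/-- `[1, …, N]_A^∞`: the tail equivalence classes of the infinite words which are not eventually
periodic. -/
def TailClass {N : ℕ} (A : Matrix (Fin N) (Fin N) ℕ) : Type :=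
  Quotient (tailSetoid A)

/-! ## The algebra `O_A` -/

/-- Partial isometries `s₁, …, s_N` with `s_i^* s_i = ∑ j, a_{ij} s_j s_j^*` and
`∑ i, s_i s_i^* = 1`. -/
structure IsCKFamily {N : ℕ} (A : Matrix (Fin N) (Fin N) ℕ) {B : Type*} [Ring B] [StarRing B]
    (s : Fin N → B) : Prop where
  partialIsometry : ∀ i, s i * star (s i) * s i = s i
  star_mul_self : ∀ i, star (s i) * s i = ∑ j, A i j • (s j * star (s j))
  sum_mul_star : ∑ i, s i * star (s i) = 1

/-- A nonzero unital C⋆-algebra with a Cuntz-Krieger family in it. -/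
structure CKModel {N : ℕ} (A : Matrix (Fin N) (Fin N) ℕ) : Type (u + 1) where
  carrier : Type u
  [cstar : CStarAlgebra carrier]
  [nontrivial : Nontrivial carrier]
  gen : Fin N → carrier
  isCKFamily : IsCKFamily A gen

attribute [instance] CKModel.cstar CKModel.nontrivial

/-- The C⋆-algebra of bounded families indexed by all Cuntz-Krieger families. -/
abbrev CKProduct {N : ℕ} (A : Matrix (Fin N) (Fin N) ℕ) : Type (u + 1) :=
  lp (fun M : CKModel.{u} A => M.carrier) ∞

theorem norm_le_one_of_partialIsometry {B : Type*} [CStarAlgebra B] {x : B}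
    (hx : x * star x * x = x) : ‖x‖ ≤ 1 := by
  have h1 : ‖star x * x‖ = ‖x‖ * ‖x‖ := CStarRing.norm_star_mul_self
  have h2 : ‖star (star x * x) * (star x * x)‖ = ‖star x * x‖ * ‖star x * x‖ :=
    CStarRing.norm_star_mul_self
  have h3 : star (star x * x) * (star x * x) = star x * x := by
    rw [star_mul, star_star, mul_assoc, ← mul_assoc x, hx]
  rw [h3, h1] at h2
  by_contra hlt
  push Not at hlt
  have : 1 < ‖x‖ * ‖x‖ := by nlinarith
  nlinarith

instance instCStarAlgebraCKProduct {N : ℕ} (A : Matrix (Fin N) (Fin N) ℕ) :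
    CStarAlgebra (CKProduct.{u} A) where

/-- The generators `s_i`, as elements of the product of all Cuntz-Krieger families. -/
def prodGen {N : ℕ} (A : Matrix (Fin N) (Fin N) ℕ) (i : Fin N) : CKProduct.{u} A :=
  ⟨fun M => M.gen i, memℓp_infty ⟨1, by
    rintro _ ⟨M, rfl⟩
    exact norm_le_one_of_partialIsometry (M.isCKFamily.partialIsometry i)⟩⟩

/-- The Cuntz-Krieger algebra `O_A`: the C⋆-algebra generated by the universal Cuntz-Krieger
family. Its universal property is `CuntzKrieger.universal` below. -/
def OA {N : ℕ} (A : Matrix (Fin N) (Fin N) ℕ) : Type (u + 1) :=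
  (StarAlgebra.adjoin ℂ (Set.range (prodGen.{u} A))).topologicalClosure

instance instCStarAlgebraOA {N : ℕ} (A : Matrix (Fin N) (Fin N) ℕ) : CStarAlgebra (OA.{u} A) :=
  StarSubalgebra.cstarAlgebra (StarAlgebra.adjoin ℂ (Set.range (prodGen.{u} A))).topologicalClosure
    (h_closed := StarSubalgebra.isClosed_topologicalClosure _)

/-- The canonical generators of `O_A`. -/
def gen {N : ℕ} (A : Matrix (Fin N) (Fin N) ℕ) (i : Fin N) : OA.{u} A :=
  ⟨prodGen A i, StarSubalgebra.le_topologicalClosure _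
    (StarAlgebra.subset_adjoin ℂ _ (Set.mem_range_self i))⟩

/-- The coordinate maps of the product. -/
def evalHom {N : ℕ} (A : Matrix (Fin N) (Fin N) ℕ) (M : CKModel.{u} A) :
    CKProduct.{u} A →⋆ₐ[ℂ] M.carrier where
  toFun x := x M
  map_one' := rfl
  map_mul' _ _ := rfl
  map_zero' := rfl
  map_add' _ _ := rfl
  commutes' _ := rfl
  map_star' _ := rfl

/-- The coordinate maps of `O_A`. -/
def evalOA {N : ℕ} (A : Matrix (Fin N) (Fin N) ℕ) (M : CKModel.{u} A) :
    OA.{u} A →⋆ₐ[ℂ] M.carrier where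
  toFun x := evalHom A M x.1
  map_one' := rfl
  map_mul' _ _ := rfl
  map_zero' := rfl
  map_add' _ _ := rfl
  commutes' _ := rfl
  map_star' _ := rfl

theorem isCKFamily_gen {N : ℕ} (A : Matrix (Fin N) (Fin N) ℕ) : IsCKFamily A (gen.{u} A) := by
  have key : ∀ x y : OA.{u} A, (∀ M, evalOA A M x = evalOA A M y) → x = y := by
    intro x y h
    exact Subtype.ext (lp.ext (funext h))
  have hg : ∀ M i, evalOA A M (gen.{u} A i) = M.gen i := fun _ _ => rfl
  refine ⟨fun i => key _ _ fun M => ?_, fun i => key _ _ fun M => ?_, key _ _ fun M => ?_⟩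
  · exact M.isCKFamily.partialIsometry i
  · have h := M.isCKFamily.star_mul_self i
    simp only [map_mul, map_star, map_sum, map_nsmul, hg]
    exact h
  · have h := M.isCKFamily.sum_mul_star
    simp only [map_mul, map_star, map_sum, map_one, hg]
    exact h

theorem dense_of_closure {X : Type*} [TopologicalSpace X] (S T : Set X) (hT : T = closure S) :
    Dense {x : T | x.1 ∈ S} := by
  intro x
  rw [closure_subtype]
  refine closure_mono ?_ (hT.le x.2)
  intro y hy
  exact ⟨⟨y, hT.ge (subset_closure hy)⟩, hy, rfl⟩

theorem dense_adjoin {N : ℕ} (A : Matrix (Fin N) (Fin N) ℕ) :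
    Dense {x : OA.{u} A | x.1 ∈ StarAlgebra.adjoin ℂ (Set.range (prodGen.{u} A))} :=
  dense_of_closure _ _ (StarSubalgebra.topologicalClosure_coe _)

/-- The universal property of `O_A`. -/
theorem universal {N : ℕ} (A : Matrix (Fin N) (Fin N) ℕ) {B : Type u} [CStarAlgebra B]
    (t : Fin N → B) (ht : IsCKFamily A t) :
    ∃! φ : OA.{u} A →⋆ₐ[ℂ] B, ∀ i, φ (gen A i) = t i := by
  cases subsingleton_or_nontrivial B with
  | inl hB =>
    refine ⟨{ toFun := fun _ => 0, map_one' := Subsingleton.elim _ _,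
              map_mul' := fun _ _ => Subsingleton.elim _ _, map_zero' := Subsingleton.elim _ _,
              map_add' := fun _ _ => Subsingleton.elim _ _,
              commutes' := fun _ => Subsingleton.elim _ _,
              map_star' := fun _ => Subsingleton.elim _ _ },
      fun i => Subsingleton.elim _ _, fun φ _ => StarAlgHom.ext fun _ => Subsingleton.elim _ _⟩
  | inr hB =>
    refine ⟨evalOA A ⟨B, t, ht⟩, fun i => rfl, ?_⟩
    intro φ hφ
    have hc : ∀ ψ : OA.{u} A →⋆ₐ[ℂ] B, Continuous ψ := fun ψ =>
      AddMonoidHomClass.continuous_of_bound ψ 1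
        (by simpa only [one_mul] using NonUnitalStarAlgHom.norm_apply_le ψ)
    refine DFunLike.coe_injective (Continuous.ext_on (dense_adjoin A) (hc _) (hc _) ?_)
    rintro ⟨x, hx'⟩ (hx : x ∈ StarAlgebra.adjoin ℂ (Set.range (prodGen.{u} A)))
    induction hx using StarAlgebra.adjoin_induction with
    | mem x h =>
      obtain ⟨i, rfl⟩ := h
      exact hφ i
    | algebraMap r =>
      exact (AlgHomClass.commutes φ r).trans
        (AlgHomClass.commutes (evalOA A ⟨B, t, ht⟩) r).symm
    | add x y hx hy h1 h2 =>
      have e1 := h1 (StarSubalgebra.le_topologicalClosure _ hx)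
      have e2 := h2 (StarSubalgebra.le_topologicalClosure _ hy)
      exact (map_add φ (⟨x, StarSubalgebra.le_topologicalClosure _ hx⟩ : OA.{u} A)
        ⟨y, StarSubalgebra.le_topologicalClosure _ hy⟩).trans (congrArg₂ (· + ·) e1 e2)
    | mul x y hx hy h1 h2 =>
      have e1 := h1 (StarSubalgebra.le_topologicalClosure _ hx)
      have e2 := h2 (StarSubalgebra.le_topologicalClosure _ hy)
      exact (map_mul φ (⟨x, StarSubalgebra.le_topologicalClosure _ hx⟩ : OA.{u} A)
        ⟨y, StarSubalgebra.le_topologicalClosure _ hy⟩).trans (congrArg₂ (· * ·) e1 e2)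
    | star x hx h1 =>
      have e1 := h1 (StarSubalgebra.le_topologicalClosure _ hx)
      exact (map_star φ (⟨x, StarSubalgebra.le_topologicalClosure _ hx⟩ : OA.{u} A)).trans
        (congrArg star e1)

/-- `s_J = s_{j₁} ⋯ s_{j_k}` for `J = (j₁, …, j_k)`. -/
def sWord {N : ℕ} (A : Matrix (Fin N) (Fin N) ℕ) (J : List (Fin N)) : OA.{u} A :=
  (J.map (gen A)).prod

/-! ## Representations -/

/-- A unital ⋆-representation of `O_A` on a complex Hilbert space. -/
structure Rep {N : ℕ} (A : Matrix (Fin N) (Fin N) ℕ) : Type (u + 1) where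
  H : Type u
  [normed : NormedAddCommGroup H]
  [inner : InnerProductSpace ℂ H]
  [complete : CompleteSpace H]
  hom : OA.{u} A →⋆ₐ[ℂ] (H →L[ℂ] H)

attribute [instance] Rep.normed Rep.inner Rep.complete

namespace Rep

variable {N : ℕ} {A : Matrix (Fin N) (Fin N) ℕ}

/-- Unitary equivalence `π ∼ ρ`. -/
def Equivalent (π ρ : Rep.{u} A) : Prop :=
  ∃ U : π.H ≃ₗᵢ[ℂ] ρ.H, ∀ (a : OA.{u} A) (v : π.H), U (π.hom a v) = ρ.hom a (U v)

/-- There is no closed invariant subspace except for `0` and the whole space, which are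
different. -/
def IsIrreducible (π : Rep.{u} A) : Prop :=
  Nontrivial π.H ∧ ∀ V : Submodule ℂ π.H, IsClosed (V : Set π.H) →
    (∀ (a : OA.{u} A), ∀ v ∈ V, π.hom a v ∈ V) → V = ⊥ ∨ V = ⊤

/-- A unit vector `Ω` for which `π(O_A)Ω` is dense. -/
def IsCyclicUnit (π : Rep.{u} A) (Ω : π.H) : Prop :=
  ‖Ω‖ = 1 ∧ Dense (Set.range fun a : OA.{u} A => π.hom a Ω)

/-- `π` is a permutative representation: for an orthonormal basis `(e_n)`, sets `Λ_i` of indices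
and indices `m_{i,n}`, `π(s_i) e_n = e_{m_{i,n}}` if `n ∈ Λ_i` and `π(s_i) e_n = 0` otherwise. -/
def IsPermutative (π : Rep.{u} A) : Prop :=
  ∃ (Λ : Type u) (e : HilbertBasis Λ ℂ π.H) (D : Fin N → Set Λ) (m : Fin N → Λ → Λ),
    ∀ i n, (n ∈ D i → π.hom (gen A i) (e n) = e (m i n)) ∧
      (n ∉ D i → π.hom (gen A i) (e n) = 0)

/-- `π` is `P(J; z)` for the finite word `J = (j₁, …, j_p)` and `z ∈ U(1)`: there is a cyclic unit
vector `Ω` with `π(s_J) Ω = z Ω` for which the vectors `π(s_{j_l} ⋯ s_{j_p}) Ω`, `1 ≤ l ≤ p`, are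
orthonormal. -/
def IsP (π : Rep.{u} A) (J : List (Fin N)) (z : Circle) : Prop :=
  ∃ Ω : π.H, π.IsCyclicUnit Ω ∧ π.hom (sWord A J) Ω = (z : ℂ) • Ω ∧
    Orthonormal ℂ fun l : Fin J.length => π.hom (sWord A (J.drop l)) Ω

/-- `π` is `P(K)` for the infinite word `K = (j₁, j₂, …)`: there is a cyclic unit vector `Ω` for
which the vectors `π(s_{j_n}^* ⋯ s_{j₁}^*) Ω`, `n ≥ 1`, are orthonormal. -/
def IsPInf (π : Rep.{u} A) (K : ℕ → Fin N) : Prop :=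
  ∃ Ω : π.H, π.IsCyclicUnit Ω ∧
    Orthonormal ℂ fun n : ℕ => π.hom (star (sWord A ((List.range (n + 1)).map K))) Ω

/-- `π` is `P(K)` for a representative `K` of the class `κ`. -/
def IsPClass (π : Rep.{u} A) (κ : TailClass A) : Prop :=
  ∃ K : AperiodicInfWord A, Quotient.mk (tailSetoid A) K = κ ∧ π.IsPInf K.1

/-- `π ∼ ⨁ i, ρ i`, through isometric intertwiners whose ranges are orthogonal and total. -/
def IsDirectSum (π : Rep.{u} A) {ι : Type u} (ρ : ι → Rep.{u} A) : Prop :=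
  ∃ V : ∀ i, (ρ i).H →ₗᵢ[ℂ] π.H, IsHilbertSum ℂ (fun i => (ρ i).H) V ∧
    ∀ (i : ι) (a : OA.{u} A) (v : (ρ i).H), V i ((ρ i).hom a v) = π.hom a (V i v)

end Rep

/-! ## Direct integrals -/

/-- A measurable field structure on a family of Hilbert spaces over a measure space: a space
of measurable vector fields that is maximal and contains a fundamental sequence. -/
structure MeasurableField {X : Type*} [MeasurableSpace X] (μ : Measure X) (H : X → Type u)
    [∀ x, NormedAddCommGroup (H x)] [∀ x, InnerProductSpace ℂ (H x)] where
  sections : Submodule ℂ (∀ x, H x)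
  norm_measurable : ∀ s ∈ sections, AEStronglyMeasurable (fun x => ‖s x‖) μ
  maximal : ∀ t : ∀ x, H x,
    (∀ s ∈ sections, AEStronglyMeasurable (fun x => ⟪s x, t x⟫_ℂ) μ) → t ∈ sections
  exists_fundamental : ∃ s : ℕ → ∀ x, H x, (∀ n, s n ∈ sections) ∧
    ∀ x, Dense (Submodule.span ℂ (Set.range fun n => s n x) : Set (H x))

/-- The square integrable measurable vector fields. -/
def MeasurableField.sqIntegrable {X : Type*} [MeasurableSpace X] {μ : Measure X} {H : X → Type u}
    [∀ x, NormedAddCommGroup (H x)] [∀ x, InnerProductSpace ℂ (H x)]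
    (F : MeasurableField μ H) : Submodule ℂ (∀ x, H x) where
  carrier := {s | s ∈ F.sections ∧ MemLp (fun x => ‖s x‖) 2 μ}
  zero_mem' := ⟨F.sections.zero_mem, by simp⟩
  add_mem' := by
    rintro s t ⟨hs, hs2⟩ ⟨ht, ht2⟩
    have hst := F.sections.add_mem hs ht
    refine ⟨hst, (hs2.add ht2).mono (F.norm_measurable _ hst) (Filter.Eventually.of_forall ?_)⟩
    intro x
    simp only [Pi.add_apply, norm_norm]
    exact (norm_add_le _ _).trans (le_abs_self _)
  smul_mem' := by
    rintro c s ⟨hs, hs2⟩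
    refine ⟨F.sections.smul_mem c hs, ?_⟩
    simpa [norm_smul] using hs2.const_mul ‖c‖

/-- `π ∼ ∫^⊕ ρ_x dμ(x)`: for a measurable field structure on the spaces of the `ρ_x` that makes
`x ↦ ρ_x(a)` a measurable field of operators for every `a`, the space of `π` is the space of
square integrable vector fields (modulo those that vanish almost everywhere) with inner product
`∫ ⟪s(x), t(x)⟫ dμ(x)`, and `π(a)` acts as the decomposable operator `(ρ_x(a))_x`. -/
def Rep.IsDirectIntegral {N : ℕ} {A : Matrix (Fin N) (Fin N) ℕ} {X : Type*} [MeasurableSpace X]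
    (π : Rep.{u} A) (μ : Measure X) (ρ : X → Rep.{u} A) : Prop :=
  ∃ (F : MeasurableField μ fun x => (ρ x).H) (Ψ : F.sqIntegrable →ₗ[ℂ] π.H),
    (∀ (a : OA.{u} A), ∀ s ∈ F.sections, (fun x => (ρ x).hom a (s x)) ∈ F.sections) ∧
    Function.Surjective Ψ ∧
    (∀ s t : F.sqIntegrable, ⟪Ψ s, Ψ t⟫_ℂ = ∫ x, ⟪s.1 x, t.1 x⟫_ℂ ∂μ) ∧
    ∀ (a : OA.{u} A) (s : F.sqIntegrable),
      ∃ h : (fun x => (ρ x).hom a (s.1 x)) ∈ F.sqIntegrable, π.hom a (Ψ s) = Ψ ⟨_, h⟩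

/-! ## The decomposition -/

/-- A decomposition of `π` of the form `⨁_J H_J ⊕ ⨁_κ H_κ`, where `J` runs over `[1, …, N]_A^*`
and `κ` over `[1, …, N]_A^∞`,
`H_J = ⨁_{p ≥ 1} (⨁_{j=1}^p P(J; e^{2πij/p}))^{⊕ ν_{J,p}} ⊕ (∫^⊕_{U(1)} P(J; z) dz)^{⊕ ν_{J,∞}}`
and `H_κ = P(κ)^{⊕ ν_κ}`. The circle group `U(1)` is parametrized by `t ∈ ℝ/ℤ`,
`z = e^{2πit}`, with normalized Haar measure. -/
structure Decomposition {N : ℕ} {A : Matrix (Fin N) (Fin N) ℕ} (π : Rep.{u} A) :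
    Type (u + 1) where
  /-- the multiplicities `ν_{J,p}` -/
  multCyc : PrimWord A → ℕ+ → Cardinal.{u}
  /-- the multiplicities `ν_{J,∞}` -/
  multInt : PrimWord A → Cardinal.{u}
  /-- the multiplicities `ν_κ` -/
  multInf : TailClass A → Cardinal.{u}
  /-- the summands `H_{J,p,j}`, in all copies; `j` is numbered from `0` to `p - 1` -/
  cyc : (Σ (J : PrimWord A) (p : ℕ+), (multCyc J p).out × Fin p) → Rep.{u} A
  /-- the summands `∫^⊕ H_{J,∞,z} dz`, in all copies -/
  int : (Σ J : PrimWord A, (multInt J).out) → Rep.{u} A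
  /-- the representations `H_{J,∞,z}` under the integrals -/
  fiber : (Σ J : PrimWord A, (multInt J).out) → UnitAddCircle → Rep.{u} A
  /-- the summands `H_{κ,0}`, in all copies -/
  inf : (Σ κ : TailClass A, (multInf κ).out) → Rep.{u} A
  isP_cyc : ∀ i, (cyc i).IsP i.1.1
    (AddCircle.toCircle (((((i.2.2.2 : ℕ) + 1 : ℝ) / (i.2.1 : ℕ) : ℝ) : UnitAddCircle)))
  isP_fiber : ∀ i t, (fiber i t).IsP i.1.1 (AddCircle.toCircle t)
  isDirectIntegral : ∀ i, (int i).IsDirectIntegral AddCircle.haarAddCircle (fiber i)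
  isP_inf : ∀ i, (inf i).IsPClass i.1
  isDirectSum : π.IsDirectSum (Sum.elim cyc (Sum.elim int inf))

namespace Decomposition

variable {N : ℕ} {A : Matrix (Fin N) (Fin N) ℕ} {π : Rep.{u} A}

/-- The index set of the summands `H_{J,p,j}`. -/
abbrev CycIndex (D : Decomposition π) : Type u :=
  Σ (J : PrimWord A) (p : ℕ+), (D.multCyc J p).out × Fin p

/-- The index set of the direct integral summands. -/
abbrev IntIndex (D : Decomposition π) : Type u :=
  Σ J : PrimWord A, (D.multInt J).out

/-- The index set of the summands `H_{κ,0}`. -/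
abbrev InfIndex (D : Decomposition π) : Type u :=
  Σ κ : TailClass A, (D.multInf κ).out

/-- The number `e^{2πij/p}` in `H_{J,p,j} = P(J; e^{2πij/p})`. -/
def phase (D : Decomposition π) (i : D.CycIndex) : Circle :=
  AddCircle.toCircle (((((i.2.2.2 : ℕ) + 1 : ℝ) / (i.2.1 : ℕ) : ℝ) : UnitAddCircle))

/-- All summands `H_{J,p,j}` and `H_{κ,0}`, and all `H_{J,∞,z}` under the integrals, are
irreducible. -/
def IsIrreducible (D : Decomposition π) : Prop :=
  (∀ i, (D.cyc i).IsIrreducible) ∧ (∀ i t, (D.fiber i t).IsIrreducible) ∧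
    ∀ i, (D.inf i).IsIrreducible

/-- `D` and `D'` coincide up to unitary equivalence: their summands correspond to one another
bijectively, with the same labels `(J, z)`, `J` or `κ`, and corresponding summands (as well as the
representations under corresponding integrals) are unitarily equivalent. -/
def Equivalent (D D' : Decomposition π) : Prop :=
  (∃ e : D.CycIndex ≃ D'.CycIndex, ∀ i, (e i).1 = i.1 ∧ D'.phase (e i) = D.phase i ∧
    (D.cyc i).Equivalent (D'.cyc (e i))) ∧
  (∃ e : D.IntIndex ≃ D'.IntIndex, ∀ i, (e i).1 = i.1 ∧ (D.int i).Equivalent (D'.int (e i)) ∧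
    ∀ t, (D.fiber i t).Equivalent (D'.fiber (e i) t)) ∧
  (∃ e : D.InfIndex ≃ D'.InfIndex, ∀ i, (e i).1 = i.1 ∧ (D.inf i).Equivalent (D'.inf (e i)))

/-- The multiplicities `ν_{J,p}` coincide whenever `ν_{J,1} + ν_{J,2} + ⋯` is finite. (In general
only the multiplicities of the irreducible summands are determined: for instance
`⨁_k P(J^{2^k})` and `⨁_k P(J^{4^k})` are unitarily equivalent.) -/
def SameFiniteMult (D D' : Decomposition π) : Prop :=
  ∀ J : PrimWord A, Cardinal.sum (D.multCyc J) < Cardinal.aleph0 → D.multCyc J = D'.multCyc J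

end Decomposition

end CuntzKrieger

end

namespace CuntzKrieger

variable {N : ℕ} {A : Matrix (Fin N) (Fin N) ℕ}

/-! ## Words in the Cuntz-Krieger algebra -/

/-! For an infinite word x, let the atom of x (`Rep.atom`) be the space of vectors fixed by s_I
s_I^* for every prefix I of x. Atoms of different words are orthogonal, and the generators and their
adjoints either kill an atom or move it to the atom of a word with a common tail. Because the
elements s_I s_L^* span a dense subspace (`dense_wordSpan`), a matrix coefficient ⟪v, π(a) w⟫
between two atoms depends only on the inner products of s_I^* v and s_L^* w at coincidences of tails
(`Rep.inner_hom_eq_of_tails`). For a word that is not eventually periodic only ⟪v, w⟫ matters; for J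
J J ⋯ the data reduce to the unitary s_J on the atom. Thus P(κ) amounts to a unit vector in an atom,
P(J; z) to an eigenvector of s_J, and the direct integral to a bilateral shift; equal coefficients
give unitary equivalence (`Rep.equivalent_of_total`). In P(J; z) and P(κ) the atom is a line, which
forces irreducibility (`Rep.isIrreducible_of_atom`).

Existence: in a permutative representation every basis vector is s_i applied to exactly one chosen
basis vector, which defines a map F on indices, and e_n lies in the atom of its itinerary under F.
Distinct grand orbits of F generate orthogonal subspaces. Each grand orbit contains a point whose
itinerary is J J J ⋯ or is not eventually periodic. In the first case s_J^* acts on that point as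
F^|J|: a cycle of length p is diagonalized by the discrete Fourier transform into the P(J;
e^{2πij/p}), and an infinite orbit is a bilateral shift. To recognize the latter as a direct
integral, P(J; 1) is realized on square summable functions on words and twisted by the gauge action
(`exists_isDirectIntegral`).

Uniqueness: in an arbitrary decomposition each direct integral is again a bilateral shift
(`Rep.IsDirectIntegral.exists_isShift`), a measurable choice of eigenvectors coming from the mean
ergodic theorem. Hence the number of copies of P(J; z) is the dimension of an eigenspace of s_J, the
number of integrals is a rank of wandering vectors in the complement of all eigenvectors, and ν_κ is
the dimension of an atom; `mk_le_of_orthonormal` compares these cardinals. Finally, P(J; e^{2πi/d})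
occurs once for every copy whose p is divisible by d, and for finitely many copies these counts
determine the ν_{J,p}. -/

theorem IsCKFamily.star_mul_of_ne {B : Type*} [CStarAlgebra B] {s : Fin N → B}
    (hs : IsCKFamily A s) {i j : Fin N} (h : i ≠ j) : star (s i) * s j = 0 := by
  let _ := CStarAlgebra.spectralOrder B
  let _ := CStarAlgebra.spectralOrderedRing B
  have hp : ∀ k, (s k * star (s k)) * (s k * star (s k)) = s k * star (s k) := fun k => by
    rw [← mul_assoc, hs.partialIsometry]
  have hq : ∀ k, star ((s k * star (s k)) * (s j * star (s j))) *
      ((s k * star (s k)) * (s j * star (s j))) =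
      (s j * star (s j)) * (s k * star (s k)) * (s j * star (s j)) := fun k => by
    have := hp k
    simp only [star_mul, star_star] at this ⊢
    calc _ = s j * star (s j) * ((s k * star (s k)) * (s k * star (s k))) *
          (s j * star (s j)) := by simp only [mul_assoc]
      _ = _ := by rw [this]
  -- With p_k = s_k s_k^*, compressing ∑ p_k = 1 by p_j gives ∑ p_j p_k p_j = p_j. The term k = j is
  -- already p_j, so the other terms, being positive, all vanish.
  have hsum : ∑ k, star ((s k * star (s k)) * (s j * star (s j))) *
      ((s k * star (s k)) * (s j * star (s j))) = s j * star (s j) := by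
    simp only [hq]
    rw [← Finset.sum_mul, ← Finset.mul_sum, hs.sum_mul_star, mul_one, hp]
  have hj : star ((s j * star (s j)) * (s j * star (s j))) *
      ((s j * star (s j)) * (s j * star (s j))) = s j * star (s j) := by
    rw [hq, hp, hp]
  rw [← Finset.add_sum_erase _ _ (Finset.mem_univ j), hj, add_eq_left,
    Finset.sum_eq_zero_iff_of_nonneg (fun k _ => star_mul_self_nonneg _)] at hsum
  have h0 := hsum i (by simp [h])
  rw [CStarRing.star_mul_self_eq_zero_iff] at h0
  calc star (s i) * s j = (star (s i) * s i * star (s i)) * (s j * star (s j) * s j) := by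
        rw [hs.partialIsometry]
        congr 1
        have := congrArg star (hs.partialIsometry i)
        simpa [mul_assoc] using this.symm
    _ = star (s i) * ((s i * star (s i)) * (s j * star (s j))) * s j := by simp only [mul_assoc]
    _ = 0 := by rw [h0, mul_zero, zero_mul]

theorem IsCKFamily.star_mul_mul {B : Type*} [CStarAlgebra B] {s : Fin N → B}
    (hs : IsCKFamily A s) (i k : Fin N) : star (s i) * s i * s k = (A i k : ℂ) • s k := by
  rw [hs.star_mul_self, Finset.sum_mul, Finset.sum_eq_single k]
  · rw [smul_mul_assoc, hs.partialIsometry, Nat.cast_smul_eq_nsmul]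
  · intro b _ hb
    rw [smul_mul_assoc, mul_assoc, hs.star_mul_of_ne hb, mul_zero, smul_zero]
  · simp

theorem IsCKFamily.star_mul_self_mul {B : Type*} [CStarAlgebra B] {s : Fin N → B}
    (hs : IsCKFamily A s) (i : Fin N) (b : B) :
    star (s i) * s i * b = ∑ k, (A i k : ℂ) • (s k * star (s k) * b) := by
  rw [hs.star_mul_self, Finset.sum_mul]
  simp only [smul_mul_assoc, Nat.cast_smul_eq_nsmul]

theorem star_gen_mul_gen_of_ne {i j : Fin N} (h : i ≠ j) :
    star (gen.{u} A i) * gen A j = 0 :=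
  (isCKFamily_gen A).star_mul_of_ne h

theorem star_gen_mul_gen_mul_gen (i k : Fin N) :
    star (gen.{u} A i) * gen A i * gen A k = (A i k : ℂ) • gen A k :=
  (isCKFamily_gen A).star_mul_mul i k

@[simp] theorem sWord_nil : sWord.{u} A [] = 1 := rfl

theorem sWord_cons (i : Fin N) (I : List (Fin N)) :
    sWord.{u} A (i :: I) = gen A i * sWord A I := by
  simp [sWord]

theorem sWord_append (I L : List (Fin N)) :
    sWord.{u} A (I ++ L) = sWord A I * sWord A L := by
  simp [sWord]

theorem sWord_singleton (i : Fin N) : sWord.{u} A [i] = gen A i := by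
  simp [sWord]

/-- The span of the elements `s_I s_L^*`. -/
noncomputable def wordSpan (A : Matrix (Fin N) (Fin N) ℕ) : Submodule ℂ (OA.{u} A) :=
  Submodule.span ℂ (Set.range fun p : List (Fin N) × List (Fin N) =>
    sWord A p.1 * star (sWord A p.2))

theorem mem_wordSpan (I L : List (Fin N)) :
    sWord.{u} A I * star (sWord A L) ∈ wordSpan A :=
  Submodule.subset_span ⟨(I, L), rfl⟩

theorem mul_mem_wordSpan_of_forall {a : OA.{u} A}
    (h : ∀ I L, a * (sWord A I * star (sWord A L)) ∈ wordSpan A) {b : OA.{u} A}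
    (hb : b ∈ wordSpan A) : a * b ∈ wordSpan A := by
  induction hb using Submodule.span_induction with
  | mem x hx => obtain ⟨p, rfl⟩ := hx; exact h _ _
  | zero => simp
  | add x y _ _ hx hy => rw [mul_add]; exact add_mem hx hy
  | smul c x _ hx => rw [mul_smul_comm]; exact Submodule.smul_mem _ _ hx

theorem gen_mul_mem_wordSpan (i : Fin N) {b : OA.{u} A} (hb : b ∈ wordSpan A) :
    gen A i * b ∈ wordSpan A := by
  refine mul_mem_wordSpan_of_forall (fun I L => ?_) hb
  rw [← mul_assoc, ← sWord_cons]
  exact mem_wordSpan _ _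

/-- On words of length at least two, s_i^* cancels the first letter up to a scalar. The one-letter
word is the exception: there s_i^* s_i becomes a sum of range projections s_k s_k^*. -/
theorem star_gen_mul_mem_wordSpan (i : Fin N) {b : OA.{u} A} (hb : b ∈ wordSpan A) :
    star (gen A i) * b ∈ wordSpan A := by
  refine mul_mem_wordSpan_of_forall (fun I L => ?_) hb
  cases I with
  | nil =>
    rw [sWord_nil, one_mul, ← star_mul, ← sWord_singleton, ← sWord_append]
    simpa using mem_wordSpan (A := A) [] (L ++ [i])
  | cons j I =>
    rw [sWord_cons, ← mul_assoc, ← mul_assoc]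
    by_cases hij : i = j
    swap
    · rw [star_gen_mul_gen_of_ne hij, zero_mul, zero_mul]
      exact zero_mem _
    subst hij
    cases I with
    | nil =>
      rw [sWord_nil, mul_one, (isCKFamily_gen A).star_mul_self_mul]
      refine Submodule.sum_mem _ fun k _ => Submodule.smul_mem _ _ ?_
      rw [mul_assoc, ← star_mul, ← sWord_singleton, ← sWord_append]
      exact mem_wordSpan _ _
    | cons k I =>
      rw [sWord_cons, ← mul_assoc, star_gen_mul_gen_mul_gen, smul_mul_assoc, smul_mul_assoc,
        ← sWord_cons]
      exact Submodule.smul_mem _ _ (mem_wordSpan _ _)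

/-- An element of the product that lies in the closed subalgebra, as an element of `O_A`. -/
noncomputable def OA.mk (x : CKProduct.{u} A)
    (hx : x ∈ StarAlgebra.adjoin ℂ (Set.range (prodGen.{u} A))) : OA.{u} A :=
  ⟨x, StarSubalgebra.le_topologicalClosure _ hx⟩

/-- Multiplication by x and by x^* are treated together so that the induction passes through the
star operation. -/
theorem mk_mul_mem_wordSpan {x : CKProduct.{u} A}
    (hx : x ∈ StarAlgebra.adjoin ℂ (Set.range (prodGen.{u} A))) :
    ∀ b ∈ wordSpan A, OA.mk x hx * b ∈ wordSpan A ∧ star (OA.mk x hx) * b ∈ wordSpan A := by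
  induction hx using StarAlgebra.adjoin_induction with
  | mem x h =>
    obtain ⟨i, rfl⟩ := h
    exact fun b hb => ⟨gen_mul_mem_wordSpan i hb, star_gen_mul_mem_wordSpan i hb⟩
  | algebraMap r =>
    intro b hb
    have h1 : OA.mk (algebraMap ℂ _ r) (algebraMap_mem _ r) = algebraMap ℂ (OA.{u} A) r := rfl
    rw [h1, ← algebraMap_star_comm, ← Algebra.smul_def, ← Algebra.smul_def]
    exact ⟨Submodule.smul_mem _ _ hb, Submodule.smul_mem _ _ hb⟩
  | add x y hx hy h1 h2 =>
    intro b hb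
    have h : OA.mk (x + y) (add_mem hx hy) = OA.mk x hx + OA.mk y hy := rfl
    rw [h, star_add, add_mul, add_mul]
    exact ⟨add_mem (h1 b hb).1 (h2 b hb).1, add_mem (h1 b hb).2 (h2 b hb).2⟩
  | mul x y hx hy h1 h2 =>
    intro b hb
    have h : OA.mk (x * y) (mul_mem hx hy) = OA.mk x hx * OA.mk y hy := rfl
    rw [h, star_mul, mul_assoc, mul_assoc]
    exact ⟨(h1 _ (h2 _ hb).1).1, (h2 _ (h1 _ hb).2).2⟩
  | star x hx h1 =>
    intro b hb
    have h : OA.mk (star x) (star_mem hx) = star (OA.mk x hx) := rfl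
    rw [h, star_star]
    exact ⟨(h1 b hb).2, (h1 b hb).1⟩

theorem dense_wordSpan : Dense (wordSpan.{u} A : Set (OA.{u} A)) := by
  refine (dense_adjoin A).mono ?_
  rintro ⟨x, hx'⟩ (hx : x ∈ StarAlgebra.adjoin ℂ (Set.range (prodGen.{u} A)))
  have h1 := (mk_mul_mem_wordSpan hx 1 (by simpa using mem_wordSpan (A := A) [] [])).1
  rwa [mul_one] at h1

theorem eq_of_eq_on_words {E : Type*} [AddCommGroup E] [Module ℂ E] [TopologicalSpace E]
    [T2Space E] {f g : OA.{u} A →ₗ[ℂ] E} (hf : Continuous f) (hg : Continuous g)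
    (h : ∀ I L, f (sWord A I * star (sWord A L)) = g (sWord A I * star (sWord A L))) : f = g := by
  refine DFunLike.coe_injective (Continuous.ext_on dense_wordSpan hf hg ?_)
  intro x hx
  induction hx using Submodule.span_induction with
  | mem x hx => obtain ⟨p, rfl⟩ := hx; exact h _ _
  | zero => simp
  | add x y _ _ hx hy => rw [map_add, map_add, hx, hy]
  | smul c x _ hx => rw [map_smul, map_smul, hx]

/-! ## Basic facts on representations -/

namespace Rep

variable (π : Rep.{u} A)

theorem norm_hom_apply_le (a : OA.{u} A) (v : π.H) : ‖π.hom a v‖ ≤ ‖a‖ * ‖v‖ :=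
  ((π.hom a).le_opNorm v).trans
    (mul_le_mul_of_nonneg_right (NonUnitalStarAlgHom.norm_apply_le π.hom a) (norm_nonneg v))

/-- The linear map `a ↦ π(a) v`. -/
noncomputable def orbitMap (v : π.H) : OA.{u} A →ₗ[ℂ] π.H where
  toFun a := π.hom a v
  map_add' a b := by simp
  map_smul' c a := by simp

theorem continuous_orbitMap (v : π.H) : Continuous (π.orbitMap v) :=
  AddMonoidHomClass.continuous_of_bound _ ‖v‖ fun a => by
    rw [mul_comm]; exact π.norm_hom_apply_le a v

theorem continuous_hom_apply (v : π.H) : Continuous fun a => π.hom a v :=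
  π.continuous_orbitMap v

theorem inner_hom_left (a : OA.{u} A) (v w : π.H) :
    ⟪π.hom a v, w⟫_ℂ = ⟪v, π.hom (star a) w⟫_ℂ := by
  rw [map_star, ContinuousLinearMap.star_eq_adjoint, ContinuousLinearMap.adjoint_inner_right]

theorem inner_hom_right (a : OA.{u} A) (v w : π.H) :
    ⟪v, π.hom a w⟫_ℂ = ⟪π.hom (star a) v, w⟫_ℂ := by
  rw [inner_hom_left, star_star]

theorem hom_mul_apply (a b : OA.{u} A) (v : π.H) : π.hom (a * b) v = π.hom a (π.hom b v) := by
  rw [map_mul]; rfl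

theorem hom_one_apply (v : π.H) : π.hom 1 v = v := by
  rw [map_one]; rfl

end Rep

theorem norm_sWord_le (I : List (Fin N)) : ‖sWord.{u} A I‖ ≤ 1 := by
  induction I with
  | nil =>
    rw [sWord_nil]
    exact norm_le_one_of_partialIsometry (by simp)
  | cons i I ih =>
    rw [sWord_cons]
    refine (norm_mul_le _ _).trans ?_
    have := norm_le_one_of_partialIsometry ((isCKFamily_gen.{u} A).partialIsometry i)
    nlinarith [norm_nonneg (sWord.{u} A I)]

namespace Rep

variable (π : Rep.{u} A)

theorem norm_hom_sWord_le (I : List (Fin N)) (v : π.H) : ‖π.hom (sWord A I) v‖ ≤ ‖v‖ := by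
  refine (π.norm_hom_apply_le _ v).trans ?_
  nlinarith [norm_sWord_le.{u} (A := A) I, norm_nonneg v]

theorem norm_hom_star_sWord_le (I : List (Fin N)) (v : π.H) :
    ‖π.hom (star (sWord A I)) v‖ ≤ ‖v‖ := by
  refine (π.norm_hom_apply_le _ v).trans ?_
  rw [norm_star]
  nlinarith [norm_sWord_le.{u} (A := A) I, norm_nonneg v]

end Rep

end CuntzKrieger

namespace CuntzKrieger

variable {N : ℕ} {A : Matrix (Fin N) (Fin N) ℕ}

/-! ## Infinite words -/

/-- The shift on infinite words. -/
def shift (x : ℕ → Fin N) : ℕ → Fin N := fun n => x (n + 1)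

/-- Prepending a letter to an infinite word. -/
def prepend (i : Fin N) (x : ℕ → Fin N) : ℕ → Fin N
  | 0 => i
  | n + 1 => x n

/-- The prefix of length `n` of an infinite word. -/
def pre (x : ℕ → Fin N) (n : ℕ) : List (Fin N) := (List.range n).map x

theorem shift_iterate_apply (x : ℕ → Fin N) (m n : ℕ) : (shift^[m] x) n = x (n + m) := by
  induction m generalizing x with
  | zero => rfl
  | succ m ih => rw [Function.iterate_succ_apply, ih, shift, add_assoc]

@[simp] theorem shift_prepend (i : Fin N) (x : ℕ → Fin N) : shift (prepend i x) = x := rfl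

@[simp] theorem prepend_zero (i : Fin N) (x : ℕ → Fin N) : prepend i x 0 = i := rfl

theorem prepend_shift (x : ℕ → Fin N) : prepend (x 0) (shift x) = x := by
  funext n; cases n <;> rfl

@[simp] theorem pre_zero (x : ℕ → Fin N) : pre x 0 = [] := rfl

@[simp] theorem length_pre (x : ℕ → Fin N) (n : ℕ) : (pre x n).length = n := by simp [pre]

theorem pre_succ (x : ℕ → Fin N) (n : ℕ) : pre x (n + 1) = x 0 :: pre (shift x) n := by
  simp [pre, List.range_succ_eq_map, List.map_map, Function.comp_def, shift]

theorem pre_add (x : ℕ → Fin N) (m n : ℕ) : pre x (m + n) = pre x m ++ pre (shift^[m] x) n := by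
  induction m generalizing x with
  | zero => simp
  | succ m ih => rw [add_right_comm, pre_succ, pre_succ, ih, Function.iterate_succ_apply]; rfl

theorem pre_one (x : ℕ → Fin N) : pre x 1 = [x 0] := rfl

theorem getElem_pre (x : ℕ → Fin N) (n k : ℕ) (h : k < (pre x n).length) : (pre x n)[k] = x k := by
  simp [pre]

theorem IsInfWord.shift {x : ℕ → Fin N} (h : IsInfWord A x) : IsInfWord A (shift x) :=
  fun n => h (n + 1)

theorem IsInfWord.shift_iterate {x : ℕ → Fin N} (h : IsInfWord A x) (m : ℕ) :
    IsInfWord A (CuntzKrieger.shift^[m] x) := by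
  intro n
  rw [shift_iterate_apply, shift_iterate_apply, add_right_comm]
  exact h _

/-- Expand ‖T S v - v‖²: the cross term is -2‖S v‖² = -2‖v‖², and ‖T S v‖ ≤ ‖S v‖ = ‖v‖, so the
result is at most 0. -/
theorem norm_apply_apply_eq {H K : Type*} [NormedAddCommGroup H] [InnerProductSpace ℂ H]
    [NormedAddCommGroup K] [InnerProductSpace ℂ K] {T : K → H} {S : H → K} {v : H}
    (hT : ∀ w, ‖T w‖ ≤ ‖w‖) (hST : ∀ w, ⟪T w, v⟫_ℂ = ⟪w, S v⟫_ℂ) (h : ‖S v‖ = ‖v‖) :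
    T (S v) = v := by
  rw [← sub_eq_zero, ← norm_eq_zero, ← sq_eq_zero_iff]
  refine le_antisymm ?_ (sq_nonneg _)
  rw [@norm_sub_sq ℂ, hST, inner_self_eq_norm_sq, h]
  nlinarith [hT (S v), norm_nonneg (T (S v)), norm_nonneg v]

/-! ## The spectral subspaces of infinite words -/

namespace Rep

variable (π ρ : Rep.{u} A)

/-- This lets membership in an atom be tested by norms alone. -/
theorem hom_sWord_hom_star_eq_iff (I : List (Fin N)) (v : π.H) :
    π.hom (sWord A I) (π.hom (star (sWord A I)) v) = v ↔
      ‖π.hom (star (sWord A I)) v‖ = ‖v‖ := by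
  refine ⟨fun h => le_antisymm (π.norm_hom_star_sWord_le I v) ?_,
    fun h => norm_apply_apply_eq (π.norm_hom_sWord_le I) (fun w => π.inner_hom_left _ _ _) h⟩
  conv_lhs => rw [← h]
  exact π.norm_hom_sWord_le I _

/-- The space of vectors which lie in the range of `π(s_I)` for every prefix `I` of `x`. -/
def atom (x : ℕ → Fin N) : Submodule ℂ π.H where
  carrier := {v | ∀ n, π.hom (sWord A (pre x n)) (π.hom (star (sWord A (pre x n))) v) = v}
  add_mem' := fun {v w} hv hw n => by rw [map_add, map_add, hv, hw]
  zero_mem' := fun n => by rw [map_zero, map_zero]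
  smul_mem' := fun c v hv n => by rw [map_smul, map_smul, hv]

variable {π ρ} {x y : ℕ → Fin N} {v w : π.H}

theorem mem_atom_iff :
    v ∈ π.atom x ↔ ∀ n, π.hom (sWord A (pre x n)) (π.hom (star (sWord A (pre x n))) v) = v :=
  Iff.rfl

theorem mem_atom_iff_norm :
    v ∈ π.atom x ↔ ∀ n, ‖π.hom (star (sWord A (pre x n))) v‖ = ‖v‖ :=
  forall_congr' fun _ => π.hom_sWord_hom_star_eq_iff _ _

theorem hom_star_sWord_cons (i : Fin N) (I : List (Fin N)) (v : π.H) :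
    π.hom (star (sWord A (i :: I))) v =
      π.hom (star (sWord A I)) (π.hom (star (gen A i)) v) := by
  rw [sWord_cons, star_mul, hom_mul_apply]

theorem hom_sWord_cons (i : Fin N) (I : List (Fin N)) (v : π.H) :
    π.hom (sWord A (i :: I)) v = π.hom (gen A i) (π.hom (sWord A I) v) := by
  rw [sWord_cons, hom_mul_apply]

theorem hom_star_sWord_append (I L : List (Fin N)) (v : π.H) :
    π.hom (star (sWord A (I ++ L))) v =
      π.hom (star (sWord A L)) (π.hom (star (sWord A I)) v) := by
  rw [sWord_append, star_mul, hom_mul_apply]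

theorem norm_star_gen_of_mem (hv : v ∈ π.atom x) : ‖π.hom (star (gen A (x 0))) v‖ = ‖v‖ := by
  simpa [pre_one, sWord_singleton] using mem_atom_iff_norm.1 hv 1

theorem gen_star_gen_of_mem (hv : v ∈ π.atom x) :
    π.hom (gen A (x 0)) (π.hom (star (gen A (x 0))) v) = v := by
  simpa [pre_one, sWord_singleton] using hv 1

theorem star_gen_mem_atom (hv : v ∈ π.atom x) :
    π.hom (star (gen A (x 0))) v ∈ π.atom (shift x) := by
  rw [mem_atom_iff_norm] at hv ⊢
  intro n
  rw [← hom_star_sWord_cons, ← pre_succ, hv, norm_star_gen_of_mem (mem_atom_iff_norm.2 hv)]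

theorem mem_atom_prepend {i : Fin N} (h1 : ‖π.hom (star (gen A i)) v‖ = ‖v‖)
    (h2 : π.hom (star (gen A i)) v ∈ π.atom x) : v ∈ π.atom (prepend i x) := by
  rw [mem_atom_iff_norm] at h2 ⊢
  intro n
  cases n with
  | zero => simp
  | succ n => rw [pre_succ, hom_star_sWord_cons, prepend_zero, shift_prepend, h2, h1]

/-- Here v = s_{x_0} s_{x_0}^* v, and s_i^* s_i acts on the range of s_{x_0} as the scalar a_{i
x_0}. -/
theorem star_gen_mul_gen_of_mem (i : Fin N) (hv : v ∈ π.atom x) :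
    π.hom (star (gen A i)) (π.hom (gen A i) v) = (A i (x 0) : ℂ) • v := by
  have h := star_gen_mul_gen_mul_gen.{u} (A := A) i (x 0)
  rw [← gen_star_gen_of_mem hv, ← hom_mul_apply, ← hom_mul_apply, h, map_smul,
    smul_apply]

theorem norm_gen_of_mem {i : Fin N} (h : A i (x 0) = 1) (hv : v ∈ π.atom x) :
    ‖π.hom (gen A i) v‖ = ‖v‖ := by
  have h1 : ⟪π.hom (gen A i) v, π.hom (gen A i) v⟫_ℂ = ⟪v, v⟫_ℂ := by
    rw [inner_hom_left, star_gen_mul_gen_of_mem i hv, h]; simp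
  rw [@norm_eq_sqrt_re_inner ℂ, h1, ← @norm_eq_sqrt_re_inner ℂ]

theorem gen_mem_atom {i : Fin N} (h : A i (x 0) = 1) (hv : v ∈ π.atom x) :
    π.hom (gen A i) v ∈ π.atom (prepend i x) := by
  have h1 : π.hom (star (gen A i)) (π.hom (gen A i) v) = v := by
    rw [star_gen_mul_gen_of_mem i hv, h]; simp
  exact mem_atom_prepend (by rw [h1, norm_gen_of_mem h hv]) (by rwa [h1])

theorem star_gen_eq_zero {i : Fin N} (h : i ≠ x 0) (hv : v ∈ π.atom x) :
    π.hom (star (gen A i)) v = 0 := by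
  rw [← gen_star_gen_of_mem hv, ← hom_mul_apply, star_gen_mul_gen_of_ne h]
  simp

/-- If the entry were 0, then s_{x_0}^* s_{x_0} would kill s_{x_0}^* v, whereas it fixes that
vector, whose norm is ‖v‖. -/
theorem adj_of_mem_atom (hv : v ∈ π.atom x) (h0 : v ≠ 0) : A (x 0) (x 1) ≠ 0 := by
  intro h
  have h1 := star_gen_mul_gen_of_mem (x 0) (star_gen_mem_atom hv)
  rw [gen_star_gen_of_mem hv, show shift x 0 = x 1 from rfl, h] at h1
  have h2 := norm_star_gen_of_mem hv
  rw [h1] at h2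
  simp only [Nat.cast_zero, zero_smul, norm_zero] at h2
  exact h0 (norm_eq_zero.1 h2.symm)

theorem star_pre_mem_atom (hv : v ∈ π.atom x) (n : ℕ) :
    π.hom (star (sWord A (pre x n))) v ∈ π.atom (shift^[n] x) := by
  induction n generalizing x v with
  | zero => simpa [hom_one_apply] using hv
  | succ n ih =>
    rw [pre_succ, hom_star_sWord_cons, Function.iterate_succ_apply]
    exact ih (star_gen_mem_atom hv)

theorem isInfWord_of_mem_atom (hA : IsAdmissible A) (hv : v ∈ π.atom x) (h0 : v ≠ 0) :
    IsInfWord A x := by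
  intro n
  have h1 := star_pre_mem_atom hv n
  have h2 : π.hom (star (sWord A (pre x n))) v ≠ 0 := by
    rw [← norm_ne_zero_iff, mem_atom_iff_norm.1 hv]; simpa using h0
  have := adj_of_mem_atom h1 h2
  rw [shift_iterate_apply, shift_iterate_apply, zero_add, add_comm 1] at this
  exact (hA.zero_or_one _ _).resolve_left this

theorem inner_star_gen_of_mem (hv : v ∈ π.atom x) (w : π.H) :
    ⟪π.hom (star (gen A (x 0))) v, π.hom (star (gen A (x 0))) w⟫_ℂ = ⟪v, w⟫_ℂ := by
  rw [inner_hom_right, star_star, gen_star_gen_of_mem hv]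

theorem inner_star_pre_of_mem (hv : v ∈ π.atom x) (n : ℕ) (w : π.H) :
    ⟪π.hom (star (sWord A (pre x n))) v, π.hom (star (sWord A (pre x n))) w⟫_ℂ = ⟪v, w⟫_ℂ := by
  rw [inner_hom_right, star_star, hv n]

/-- Removing a common first letter preserves the inner product; at the first letter where the words
differ, the adjoint of the generator kills the second vector. -/
theorem inner_eq_zero_of_ne (hxy : x ≠ y) (hv : v ∈ π.atom x) (hw : w ∈ π.atom y) :
    ⟪v, w⟫_ℂ = 0 := by
  obtain ⟨n, hn⟩ := Function.ne_iff.1 hxy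
  induction n generalizing x y v w with
  | zero =>
    rw [← inner_star_gen_of_mem hv, star_gen_eq_zero hn hw, inner_zero_right]
  | succ n ih =>
    by_cases h : x 0 = y 0
    · rw [← inner_star_gen_of_mem hv]
      refine ih (x := shift x) (y := shift y) (fun h => hn (congrFun h n))
        (star_gen_mem_atom hv) ?_ hn
      rw [h]
      exact star_gen_mem_atom hw
    · rw [← inner_star_gen_of_mem hv, star_gen_eq_zero h hw, inner_zero_right]

theorem star_sWord_of_mem (L : List (Fin N)) (hv : v ∈ π.atom x) (hL : L ≠ pre x L.length) :
    π.hom (star (sWord A L)) v = 0 := by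
  induction L generalizing x v with
  | nil => exact absurd rfl hL
  | cons i L ih =>
    rw [hom_star_sWord_cons]
    by_cases h : i = x 0
    · subst h
      refine ih (star_gen_mem_atom hv) fun h => hL ?_
      rw [List.length_cons, pre_succ, ← h]
    · rw [star_gen_eq_zero h hv, map_zero]

theorem norm_pre_of_mem (hx : IsInfWord A x) (n : ℕ) (hv : v ∈ π.atom (shift^[n] x)) :
    ‖π.hom (sWord A (pre x n)) v‖ = ‖v‖ ∧ π.hom (sWord A (pre x n)) v ∈ π.atom x ∧
      π.hom (star (sWord A (pre x n))) (π.hom (sWord A (pre x n)) v) = v := by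
  induction n generalizing x v with
  | zero => simpa [hom_one_apply] using hv
  | succ n ih =>
    rw [Function.iterate_succ_apply] at hv
    obtain ⟨h1, h2, h3⟩ := ih hx.shift hv
    rw [pre_succ, hom_sWord_cons, hom_star_sWord_cons]
    refine ⟨(norm_gen_of_mem (hx 0) h2).trans h1, ?_, ?_⟩
    · rw [← prepend_shift x]
      exact gen_mem_atom (hx 0) h2
    · have := star_gen_mul_gen_of_mem (x 0) h2
      rw [this, show shift x 0 = x 1 from rfl, hx 0]
      simpa using h3

/-- The matrix coefficients of `π` on the spectral subspaces of `x` and `y` are determined by the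
inner products along the coincidences of the tails of `x` and `y`. -/
theorem inner_hom_eq_of_tails {v w : π.H} {v' w' : ρ.H} (hv : v ∈ π.atom x) (hw : w ∈ π.atom y)
    (hv' : v' ∈ ρ.atom x) (hw' : w' ∈ ρ.atom y)
    (h : ∀ m n, shift^[m] x = shift^[n] y →
      ⟪π.hom (star (sWord A (pre x m))) v, π.hom (star (sWord A (pre y n))) w⟫_ℂ =
      ⟪ρ.hom (star (sWord A (pre x m))) v', ρ.hom (star (sWord A (pre y n))) w'⟫_ℂ)
    (a : OA.{u} A) : ⟪v, π.hom a w⟫_ℂ = ⟪v', ρ.hom a w'⟫_ℂ := by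
  have key : (innerSL ℂ v).toLinearMap ∘ₗ π.orbitMap w =
      (innerSL ℂ v').toLinearMap ∘ₗ ρ.orbitMap w' := by
    refine eq_of_eq_on_words ((innerSL ℂ v).continuous.comp (π.continuous_orbitMap w))
      ((innerSL ℂ v').continuous.comp (ρ.continuous_orbitMap w')) fun I L => ?_
    change ⟪v, π.hom _ w⟫_ℂ = ⟪v', ρ.hom _ w'⟫_ℂ
    rw [hom_mul_apply, hom_mul_apply, inner_hom_right _ (sWord A I),
      inner_hom_right _ (sWord A I)]
    -- Words that are not prefixes contribute nothing on either side, and prefixes with different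
    -- remaining tails lead into orthogonal atoms. Only coincidences of tails are left.
    by_cases hI : I = pre x I.length
    swap
    · rw [star_sWord_of_mem I hv hI, star_sWord_of_mem I hv' hI, inner_zero_left, inner_zero_left]
    by_cases hL : L = pre y L.length
    swap
    · rw [star_sWord_of_mem L hw hL, star_sWord_of_mem L hw' hL, inner_zero_right,
        inner_zero_right]
    rw [hI, hL]
    by_cases ht : shift^[I.length] x = shift^[L.length] y
    · exact h _ _ ht
    · rw [inner_eq_zero_of_ne ht (star_pre_mem_atom hv _) (star_pre_mem_atom hw _),
        inner_eq_zero_of_ne ht (star_pre_mem_atom hv' _) (star_pre_mem_atom hw' _)]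
  exact LinearMap.congr_fun key a

theorem inner_hom_eq_zero_of_tails {v w : π.H} (hv : v ∈ π.atom x) (hw : w ∈ π.atom y)
    (h : ∀ m n, shift^[m] x = shift^[n] y →
      ⟪π.hom (star (sWord A (pre x m))) v, π.hom (star (sWord A (pre y n))) w⟫_ℂ = 0)
    (a : OA.{u} A) : ⟪v, π.hom a w⟫_ℂ = 0 := by
  rw [inner_hom_eq_of_tails (ρ := π) hv hw (zero_mem _) (zero_mem _) (fun m n hmn => ?_) a,
    inner_zero_left]
  rw [h m n hmn, map_zero, inner_zero_left]

/-! ## Intertwiners -/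

/-- No nonzero vector is orthogonal to all `π(a) v_k`. -/
def IsTotal (π : Rep.{u} A) {ι : Type*} (v : ι → π.H) : Prop :=
  ∀ w : π.H, (∀ k a, ⟪π.hom a (v k), w⟫_ℂ = 0) → w = 0

/-- The map `∑ k, a_k ↦ ∑ k, π(a_k) v_k`. -/
noncomputable def familyMap (π : Rep.{u} A) {ι : Type*} (v : ι → π.H) : (ι →₀ OA.{u} A) →ₗ[ℂ] π.H :=
  Finsupp.lsum ℂ fun k => π.orbitMap (v k)

theorem familyMap_single {ι : Type*} (v : ι → π.H) (k : ι) (a : OA.{u} A) :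
    π.familyMap v (Finsupp.single k a) = π.hom a (v k) := by
  simp [familyMap, orbitMap]

theorem IsTotal.denseRange {ι : Type*} {v : ι → π.H} (h : π.IsTotal v) :
    DenseRange (π.familyMap v) := by
  have : (LinearMap.range (π.familyMap v)).topologicalClosure = ⊤ := by
    rw [Submodule.topologicalClosure_eq_top_iff, Submodule.eq_bot_iff]
    intro w hw
    refine h w fun k a => ?_
    rw [← familyMap_single]
    exact hw _ ⟨_, rfl⟩
  exact Submodule.dense_iff_topologicalClosure_eq_top.2 this

theorem inner_familyMap {ι : Type*} {v : ι → π.H} {w : ι → ρ.H}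
    (h : ∀ k l a, ⟪v k, π.hom a (v l)⟫_ℂ = ⟪w k, ρ.hom a (w l)⟫_ℂ) (c d : ι →₀ OA.{u} A) :
    ⟪π.familyMap v c, π.familyMap v d⟫_ℂ = ⟪ρ.familyMap w c, ρ.familyMap w d⟫_ℂ := by
  induction c using Finsupp.induction_linear with
  | zero => simp
  | add c c' h1 h2 => rw [map_add, map_add, inner_add_left, inner_add_left, h1, h2]
  | single k a =>
    induction d using Finsupp.induction_linear with
    | zero => simp
    | add c c' h1 h2 => rw [map_add, map_add, inner_add_right, inner_add_right, h1, h2]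
    | single l b =>
      simp only [familyMap_single]
      rw [inner_hom_left, inner_hom_left, ← hom_mul_apply, ← hom_mul_apply, h]

/-- Families with the same matrix coefficients are related by an intertwiner. -/
theorem exists_intertwiner {ι : Type*} {v : ι → π.H} {w : ι → ρ.H} (hv : π.IsTotal v)
    (h : ∀ k l a, ⟪v k, π.hom a (v l)⟫_ℂ = ⟪w k, ρ.hom a (w l)⟫_ℂ) :
    ∃ V : π.H →ₗᵢ[ℂ] ρ.H, (∀ a u, V (π.hom a u) = ρ.hom a (V u)) ∧ ∀ k, V (v k) = w k := by
  have hn : ∀ c, ‖ρ.familyMap w c‖ = ‖π.familyMap v c‖ := fun c => by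
    rw [@norm_eq_sqrt_re_inner ℂ, ← inner_familyMap h, ← @norm_eq_sqrt_re_inner ℂ]
  have hd := hv.denseRange
  -- Equality of the coefficients makes π(a) v_k ↦ ρ(a) w_k norm preserving on a dense range, so it
  -- is well defined and extends by continuity.
  set T := (ρ.familyMap w).extendOfNorm (π.familyMap v) with hT
  have hTe : ∀ c, T (π.familyMap v c) = ρ.familyMap w c :=
    LinearMap.extendOfNorm_eq hd ⟨1, fun c => by rw [hn, one_mul]⟩
  have hTn : ∀ u, ‖T u‖ = ‖u‖ := by
    refine fun u => hd.induction_on (p := fun u => ‖T u‖ = ‖u‖) u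
      (isClosed_eq (by fun_prop) (by fun_prop)) fun c => ?_
    rw [hTe, hn]
  have hTk : ∀ k a, T (π.hom a (v k)) = ρ.hom a (w k) := fun k a => by
    rw [← familyMap_single, hTe, familyMap_single]
  refine ⟨⟨T.toLinearMap, hTn⟩, fun a u => ?_, fun k => ?_⟩
  · change T (π.hom a u) = ρ.hom a (T u)
    refine hd.induction_on (p := fun u => T (π.hom a u) = ρ.hom a (T u)) u
      (isClosed_eq (by fun_prop) (by fun_prop)) fun c => ?_
    induction c using Finsupp.induction_linear with
    | zero => simp
    | add c c' h1 h2 => simp only [map_add, h1, h2]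
    | single k b => rw [familyMap_single, ← hom_mul_apply, hTk, hTk, hom_mul_apply]
  · have := hTk k 1
    simpa [hom_one_apply] using this

/-- The range of the isometric intertwiner is closed, and totality of `w` leaves nothing orthogonal
to it. -/
theorem equivalent_of_total {ι : Type*} {v : ι → π.H} {w : ι → ρ.H} (hv : π.IsTotal v)
    (hw : ρ.IsTotal w) (h : ∀ k l a, ⟪v k, π.hom a (v l)⟫_ℂ = ⟪w k, ρ.hom a (w l)⟫_ℂ) :
    π.Equivalent ρ := by
  obtain ⟨V, hV, hVk⟩ := exists_intertwiner hv h
  have hs : Function.Surjective V := by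
    rw [← LinearIsometry.coe_toLinearMap, ← LinearMap.range_eq_top]
    have hc : IsClosed (LinearMap.range V.toLinearMap : Set ρ.H) := by
      have := V.isometry.isClosedEmbedding.isClosed_range
      rwa [← LinearIsometry.coe_toLinearMap, ← LinearMap.coe_range] at this
    have : (LinearMap.range V.toLinearMap).topologicalClosure = ⊤ := by
      rw [Submodule.topologicalClosure_eq_top_iff, Submodule.eq_bot_iff]
      intro u hu
      refine hw u fun k a => ?_
      rw [← hVk, ← hV]
      exact hu _ ⟨_, rfl⟩
    rwa [hc.submodule_topologicalClosure_eq] at this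
  exact ⟨LinearIsometryEquiv.ofSurjective V hs, hV⟩

theorem isTotal_of_isCyclicUnit {Ω : π.H} (h : π.IsCyclicUnit Ω) :
    π.IsTotal fun _ : Unit => Ω := by
  intro w hw
  have hd : DenseRange fun a : OA.{u} A => π.hom a Ω := h.2
  have : ∀ u : π.H, ⟪u, w⟫_ℂ = 0 := fun u =>
    hd.induction_on (p := fun u => ⟪u, w⟫_ℂ = 0) u
      (isClosed_eq (by fun_prop) (by fun_prop)) fun a => hw () a
  exact inner_self_eq_zero.1 (this w)

theorem isCyclicUnit_of_isTotal {Ω : π.H} (h1 : ‖Ω‖ = 1) (h : π.IsTotal fun _ : Unit => Ω) :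
    π.IsCyclicUnit Ω := by
  refine ⟨h1, h.denseRange.mono ?_⟩
  rintro _ ⟨c, rfl⟩
  induction c using Finsupp.induction_linear with
  | zero => exact ⟨0, by simp⟩
  | add c c' h1 h2 =>
    obtain ⟨a, ha⟩ := h1
    obtain ⟨b, hb⟩ := h2
    exact ⟨a + b, by simp only [map_add, ← ha, ← hb]; rfl⟩
  | single k a => exact ⟨a, (familyMap_single (fun _ : Unit => Ω) k a).symm⟩

/-- A vector of a spectral subspace that is orthogonal to a total family of vectors in spectral
subspaces, along all coincidences of tails, is zero. -/
theorem IsTotal.eq_zero_of_tails {ι : Type*} {v : ι → π.H} (h : π.IsTotal v) {y : ι → ℕ → Fin N}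
    (hv : ∀ k, v k ∈ π.atom (y k)) {u : π.H} (hu : u ∈ π.atom x)
    (h0 : ∀ k m n, shift^[m] x = shift^[n] (y k) →
      ⟪π.hom (star (sWord A (pre x m))) u, π.hom (star (sWord A (pre (y k) n))) (v k)⟫_ℂ = 0) :
    u = 0 :=
  h u fun k a => by
    rw [← inner_conj_symm, inner_hom_eq_zero_of_tails hu (hv k) (h0 k) a, map_zero]

end Rep

end CuntzKrieger

namespace CuntzKrieger

variable {N : ℕ} {A : Matrix (Fin N) (Fin N) ℕ}

/-! ## Periodic and eventually periodic words -/

theorem pre_mul_eq_flatten {x : ℕ → Fin N} {q : ℕ} (h : shift^[q] x = x) (m : ℕ) :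
    pre x (q * m) = (List.replicate m (pre x q)).flatten := by
  induction m with
  | zero => simp
  | succ m ih =>
    rw [Nat.mul_succ, add_comm, pre_add, h, ih, List.replicate_succ, List.flatten_cons]

theorem iterate_shift_mul {x : ℕ → Fin N} {q : ℕ} (h : shift^[q] x = x) (m : ℕ) :
    shift^[q * m] x = x :=
  Function.IsPeriodicPt.mul_const (f := shift) h m

theorem apply_mod_of_shift {x : ℕ → Fin N} {q : ℕ} (h : shift^[q] x = x) (n : ℕ) :
    x (n % q) = x n := by
  have := congrFun (iterate_shift_mul h (n / q)) (n % q)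
  rw [shift_iterate_apply, Nat.mod_add_div] at this
  exact this.symm

theorem rotate_pre {x : ℕ → Fin N} {q : ℕ} (h : shift^[q] x = x) (s : ℕ) :
    (pre x q).rotate s = pre (shift^[s] x) q := by
  refine List.ext_getElem (by simp) fun n h1 h2 => ?_
  rw [List.getElem_rotate, getElem_pre, getElem_pre, length_pre, apply_mod_of_shift h,
    shift_iterate_apply]

theorem eq_of_pre_eq {x y : ℕ → Fin N} {q : ℕ} (hq : 0 < q) (hx : shift^[q] x = x)
    (hy : shift^[q] y = y) (h : pre x q = pre y q) : x = y := by
  funext n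
  rw [← apply_mod_of_shift hx n, ← apply_mod_of_shift hy n]
  have h1 : n % q < (pre x q).length := by simpa using Nat.mod_lt _ hq
  have h2 : n % q < (pre y q).length := by simpa using Nat.mod_lt _ hq
  rw [← getElem_pre x q _ h1, ← getElem_pre y q _ h2]
  simp only [h]

theorem iterate_shift_comm {x : ℕ → Fin N} {q : ℕ} (h : shift^[q] x = x) (s : ℕ) :
    shift^[q] (shift^[s] x) = shift^[s] x :=
  Function.IsPeriodicPt.apply_iterate (f := shift) h s

namespace PrimWord

variable (J J' : PrimWord A)

theorem length_pos : 0 < J.1.length :=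
  List.length_pos_iff.2 J.2.1.2.1

/-- The infinite word `J J J ⋯`. -/
def inf : ℕ → Fin N := fun n => J.1[n % J.1.length]'(Nat.mod_lt _ J.length_pos)

theorem pre_inf : pre J.inf J.1.length = J.1 := by
  refine List.ext_getElem (by simp) fun n h1 h2 => ?_
  rw [getElem_pre]
  simp only [inf, Nat.mod_eq_of_lt h2]

theorem shift_inf : shift^[J.1.length] J.inf = J.inf := by
  funext n
  simp only [shift_iterate_apply, inf, Nat.add_mod_right]

theorem isInfWord_inf : IsInfWord A J.inf := by
  intro n
  have hk := J.length_pos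
  obtain ⟨hc, h0, hl⟩ := J.2.1
  rw [List.isChain_iff_getElem] at hc
  by_cases h : n % J.1.length + 1 < J.1.length
  · have h1 : (n + 1) % J.1.length = n % J.1.length + 1 := by
      rw [Nat.add_mod, ← Nat.add_mod_mod, Nat.mod_mod, ← Nat.add_mod]
      rw [← Nat.mod_add_mod, Nat.mod_eq_of_lt h]
    simp only [inf, h1]
    exact hc _ h
  · have h2 : n % J.1.length = J.1.length - 1 := by
      have := Nat.mod_lt n hk
      omega
    have h1 : (n + 1) % J.1.length = 0 := by
      rw [← Nat.mod_add_mod, h2, Nat.sub_add_cancel hk, Nat.mod_self]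
    simp only [inf, h1, h2]
    rwa [List.getLast_eq_getElem, List.head_eq_getElem] at hl

theorem inf_mem_periodicPts : J.inf ∈ Function.periodicPts (shift (N := N)) :=
  ⟨_, J.length_pos, J.shift_inf⟩

/-- A proper divisor q of |J| as period would exhibit J as a power, at least the second, of its
prefix of length q. -/
theorem minimalPeriod_inf : Function.minimalPeriod shift J.inf = J.1.length := by
  have hk := J.length_pos
  have hd : Function.minimalPeriod shift J.inf ∣ J.1.length :=
    Function.IsPeriodicPt.minimalPeriod_dvd J.shift_inf
  have hp := Function.minimalPeriod_pos_of_mem_periodicPts J.inf_mem_periodicPts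
  have hq := Function.iterate_minimalPeriod (f := shift) (x := J.inf)
  set q := Function.minimalPeriod shift J.inf
  obtain ⟨m, hm⟩ := hd
  by_contra hne
  refine J.2.2.2 ⟨m, pre J.inf q, ?_, ?_, ?_⟩
  · by_contra hlt
    interval_cases m <;> omega
  · rw [← List.length_pos_iff]; simpa using hp
  · rw [← pre_mul_eq_flatten hq, ← hm, pre_inf]

theorem iterate_shift_inf_eq_iff (m n : ℕ) :
    shift^[m] J.inf = shift^[n] J.inf ↔ m ≡ n [MOD J.1.length] := by
  have hk := J.length_pos
  rw [← Function.iterate_mod_minimalPeriod_eq (n := m),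
    ← Function.iterate_mod_minimalPeriod_eq (n := n), minimalPeriod_inf]
  rw [Function.iterate_eq_iterate_iff_of_lt_minimalPeriod] <;>
    first
    | rfl
    | (rw [minimalPeriod_inf]; exact Nat.mod_lt _ hk)

variable {J J'}

/-- Base N expansions of fixed length are unique for N ≥ 2. Consequently a rotation class has only
one word of minimal value. -/
theorem wordValue_injective (hN : 2 ≤ N) {I L : List (Fin N)} (hl : I.length = L.length)
    (h : wordValue I = wordValue L) : I = L := by
  have hd : ∀ M : List (Fin N), ∀ l ∈ (M.map Fin.val).reverse, l < N := by
    intro M l hl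
    rw [List.mem_reverse, List.mem_map] at hl
    obtain ⟨a, _, rfl⟩ := hl
    exact a.2
  have := Nat.ofDigits_inj_of_len_eq (b := N) (by omega) (by simpa using hl) (hd I) (hd L) h
  exact (List.map_injective_iff.2 Fin.val_injective) (List.reverse_injective this)

/-- Minimal periods are unchanged along the orbit of a periodic point, so the two words have equal
length. A common tail then makes them rotations of each other, and both are minimal. -/
theorem eq_of_tails (hN : 2 ≤ N) {m n : ℕ} (h : shift^[m] J.inf = shift^[n] J'.inf) :
    J = J' := by
  have h1 := Function.minimalPeriod_apply_iterate J.inf_mem_periodicPts m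
  have h2 := Function.minimalPeriod_apply_iterate J'.inf_mem_periodicPts n
  rw [h, h2, minimalPeriod_inf, minimalPeriod_inf] at h1
  have h3 : J.1.rotate m = J'.1.rotate n := by
    rw [← J.pre_inf, ← J'.pre_inf, rotate_pre J.shift_inf, rotate_pre J'.shift_inf, h, h1]
  have h4 : J.1 ~r J'.1 := by
    have a : J.1 ~r J.1.rotate m := ⟨m, rfl⟩
    have b : J'.1 ~r J'.1.rotate n := ⟨n, rfl⟩
    rw [h3] at a
    exact a.trans b.symm
  exact Subtype.ext (wordValue_injective hN h1.symm
    (le_antisymm (J.2.2.1 _ h4) (J'.2.2.1 _ h4.symm)))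

/-- After the preperiod is cut off, the tail is periodic. Among its shifts take one whose block over
the minimal period has least value: the block is minimal by choice, and primitive because its length
is the minimal period. -/
theorem exists_iterate_shift_eq_inf {x : ℕ → Fin N} (hx : IsInfWord A x)
    (h : IsEventuallyPeriodic x) : ∃ (J : PrimWord A) (m : ℕ), shift^[m] x = J.inf := by
  obtain ⟨n₀, q₀, hq₀, h⟩ := h
  set y := shift^[n₀] x with hy
  have hy0 : shift^[q₀] y = y := by
    funext n
    rw [shift_iterate_apply, hy, shift_iterate_apply, shift_iterate_apply, add_right_comm]
    exact h _ (by omega)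
  have hper : y ∈ Function.periodicPts (shift (N := N)) := ⟨q₀, hq₀, hy0⟩
  set q := Function.minimalPeriod shift y with hq
  have hq0 : 0 < q := Function.minimalPeriod_pos_of_mem_periodicPts hper
  have hyq : shift^[q] y = y := Function.iterate_minimalPeriod
  obtain ⟨r, hr⟩ : ∃ r, ∀ s, wordValue (pre (shift^[r] y) q) ≤ wordValue (pre (shift^[s] y) q) :=
    ⟨Function.argmin (fun s => wordValue (pre (shift^[s] y) q)),
      fun s => Function.argmin_le (fun s => wordValue (pre (shift^[s] y) q)) s⟩
  set z := shift^[r] y with hz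
  have hzq : shift^[q] z = z := iterate_shift_comm hyq r
  have hzA : IsInfWord A z := (hx.shift_iterate _).shift_iterate _
  have hzm : Function.minimalPeriod shift z = q := Function.minimalPeriod_apply_iterate hper r
  have hne : pre z q ≠ [] := by rw [← List.length_pos_iff]; simpa using hq0
  refine ⟨⟨pre z q, ⟨?_, hne, ?_⟩, ?_, ?_⟩, r + n₀, ?_⟩
  · rw [List.isChain_iff_getElem]
    intro i hi
    rw [getElem_pre, getElem_pre]
    exact hzA i
  · rw [List.getLast_eq_getElem, List.head_eq_getElem, getElem_pre, getElem_pre, length_pre]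
    have := hzA (q - 1)
    rw [Nat.sub_add_cancel hq0] at this
    rwa [← apply_mod_of_shift hzq q, Nat.mod_self] at this
  · rintro J' ⟨s, rfl⟩
    have h2 := hr (s + r)
    rw [Function.iterate_add_apply, ← hz] at h2
    rwa [rotate_pre hzq]
  · rintro ⟨m, L, hm, hL, he⟩
    have hlen : q = m * L.length := by
      have := congrArg List.length he
      simpa using this
    have hLpos := List.length_pos_iff.2 hL
    -- A block of the form L^m is fixed by rotation through |L|, so |L| is a period of z; but m ≥ 2
    -- makes |L| smaller than the minimal period q.
    have hrot : (pre z q).rotate L.length = pre z q := by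
      obtain ⟨m', rfl⟩ : ∃ m', m = m' + 1 := ⟨m - 1, by omega⟩
      conv_lhs => rw [he, List.replicate_succ, List.flatten_cons, List.rotate_append_length_eq]
      rw [he, List.replicate_succ', List.flatten_append]
      simp
    rw [rotate_pre hzq] at hrot
    have h1 := eq_of_pre_eq hq0 (iterate_shift_comm hzq _) hzq hrot
    have h2 := Function.IsPeriodicPt.minimalPeriod_le hLpos
      (show Function.IsPeriodicPt shift L.length z from h1)
    rw [hzm, hlen] at h2
    nlinarith
  · rw [Function.iterate_add_apply]
    funext n
    simp only [inf, length_pre, getElem_pre]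
    exact (apply_mod_of_shift hzq n).symm

theorem isEventuallyPeriodic_of_tails {y : ℕ → Fin N} {m n : ℕ}
    (h : shift^[m] J.inf = shift^[n] y) : IsEventuallyPeriodic y := by
  refine ⟨n, J.1.length, J.length_pos, fun k hk => ?_⟩
  have h1 : shift^[J.1.length] (shift^[n] y) = shift^[n] y := by
    rw [← h]; exact iterate_shift_comm J.shift_inf m
  have := congrFun h1 (k - n)
  rw [shift_iterate_apply, shift_iterate_apply, shift_iterate_apply] at this
  rwa [show k - n + J.1.length + n = k + J.1.length by omega, Nat.sub_add_cancel hk] at this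

end PrimWord

theorem eq_of_iterate_shift_eq {x : ℕ → Fin N} (hx : ¬ IsEventuallyPeriodic x) {m n : ℕ}
    (h : shift^[m] x = shift^[n] x) : m = n := by
  by_contra hne
  wlog hlt : m < n generalizing m n
  · exact this h.symm (Ne.symm hne) (by omega)
  refine hx ⟨m, n - m, by omega, fun k hk => ?_⟩
  have := congrFun h (k - m)
  rw [shift_iterate_apply, shift_iterate_apply, Nat.sub_add_cancel hk] at this
  rw [this]
  congr 1
  omega

theorem tailSetoid_iff {K K' : AperiodicInfWord A} :
    (Quotient.mk (tailSetoid A) K = Quotient.mk (tailSetoid A) K') ↔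
      ∃ m n, shift^[m] K.1 = shift^[n] K'.1 := by
  rw [Quotient.eq]
  refine exists_congr fun m => exists_congr fun n => ?_
  rw [funext_iff]
  simp only [shift_iterate_apply]

end CuntzKrieger

namespace CuntzKrieger

variable {N : ℕ} {A : Matrix (Fin N) (Fin N) ℕ}

namespace PrimWord

variable (J : PrimWord A)

theorem sWord_pre_mul (r : ℕ) :
    sWord.{u} A (pre J.inf (J.1.length * r)) = sWord A J.1 ^ r := by
  induction r with
  | zero => simp
  | succ r ih =>
    rw [Nat.mul_succ, add_comm, pre_add, shift_inf, pre_inf, sWord_append, ih, pow_succ']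

theorem shift_iterate_mul_inf (r : ℕ) : shift^[J.1.length * r] J.inf = J.inf :=
  iterate_shift_mul J.shift_inf r

end PrimWord

namespace Rep

variable {π ρ : Rep.{u} A} {J : PrimWord A}

/-! ## Spectral subspaces of periodic words -/

theorem hom_pow_mem_atom {v : π.H} (hv : v ∈ π.atom J.inf) (r : ℕ) :
    π.hom (sWord A J.1 ^ r) v ∈ π.atom J.inf := by
  have := (norm_pre_of_mem J.isInfWord_inf (J.1.length * r) (v := v)
    (by rwa [J.shift_iterate_mul_inf])).2.1
  rwa [J.sWord_pre_mul] at this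

theorem hom_star_pow_mem_atom {v : π.H} (hv : v ∈ π.atom J.inf) (r : ℕ) :
    π.hom (star (sWord A J.1 ^ r)) v ∈ π.atom J.inf := by
  have := star_pre_mem_atom hv (J.1.length * r)
  rwa [J.sWord_pre_mul, J.shift_iterate_mul_inf] at this

theorem hom_star_pow_hom_pow {v : π.H} (hv : v ∈ π.atom J.inf) (r : ℕ) :
    π.hom (star (sWord A J.1 ^ r)) (π.hom (sWord A J.1 ^ r) v) = v := by
  have := (norm_pre_of_mem J.isInfWord_inf (J.1.length * r) (v := v)
    (by rwa [J.shift_iterate_mul_inf])).2.2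
  rwa [J.sWord_pre_mul] at this

theorem hom_pow_hom_star_pow {v : π.H} (hv : v ∈ π.atom J.inf) (r : ℕ) :
    π.hom (sWord A J.1 ^ r) (π.hom (star (sWord A J.1 ^ r)) v) = v := by
  have := hv (J.1.length * r)
  rwa [J.sWord_pre_mul] at this

theorem hom_mem_atom {v : π.H} (hv : v ∈ π.atom J.inf) :
    π.hom (sWord A J.1) v ∈ π.atom J.inf := by
  simpa using hom_pow_mem_atom hv 1

theorem hom_star_mem_atom {v : π.H} (hv : v ∈ π.atom J.inf) :
    π.hom (star (sWord A J.1)) v ∈ π.atom J.inf := by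
  simpa using hom_star_pow_mem_atom hv 1

theorem hom_star_hom {v : π.H} (hv : v ∈ π.atom J.inf) :
    π.hom (star (sWord A J.1)) (π.hom (sWord A J.1) v) = v := by
  simpa using hom_star_pow_hom_pow hv 1

theorem hom_hom_star {v : π.H} (hv : v ∈ π.atom J.inf) :
    π.hom (sWord A J.1) (π.hom (star (sWord A J.1)) v) = v := by
  simpa using hom_pow_hom_star_pow hv 1

theorem inner_hom_hom {v w : π.H} (hv : v ∈ π.atom J.inf) :
    ⟪π.hom (sWord A J.1) v, π.hom (sWord A J.1) w⟫_ℂ = ⟪v, w⟫_ℂ := by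
  rw [inner_hom_right, hom_star_hom hv]

/-- The tails after m and n letters coincide exactly when m ≡ n modulo |J|. The surplus |m - n| =
r|J| leaves r factors s_J, on the left or on the right depending on which of m, n is larger. -/
theorem inner_hom_eq_of_periodic {v w : π.H} {v' w' : ρ.H} (hv : v ∈ π.atom J.inf)
    (hw : w ∈ π.atom J.inf) (hv' : v' ∈ ρ.atom J.inf) (hw' : w' ∈ ρ.atom J.inf)
    (h1 : ∀ r, ⟪π.hom (sWord A J.1 ^ r) v, w⟫_ℂ = ⟪ρ.hom (sWord A J.1 ^ r) v', w'⟫_ℂ)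
    (h2 : ∀ r, ⟪v, π.hom (sWord A J.1 ^ r) w⟫_ℂ = ⟪v', ρ.hom (sWord A J.1 ^ r) w'⟫_ℂ)
    (a : OA.{u} A) : ⟪v, π.hom a w⟫_ℂ = ⟪v', ρ.hom a w'⟫_ℂ := by
  refine inner_hom_eq_of_tails hv hw hv' hw' (fun m n hmn => ?_) a
  rw [J.iterate_shift_inf_eq_iff] at hmn
  rcases le_total m n with h | h
  · obtain ⟨r, hr⟩ := (Nat.modEq_iff_dvd' h).1 hmn
    obtain rfl : n = J.1.length * r + m := by omega
    have e : ∀ (σ : Rep.{u} A) {p q : σ.H}, p ∈ σ.atom J.inf →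
        ⟪σ.hom (star (sWord A (pre J.inf m))) p,
          σ.hom (star (sWord A (pre J.inf (J.1.length * r + m)))) q⟫_ℂ =
        ⟪σ.hom (sWord A J.1 ^ r) p, q⟫_ℂ := fun σ p q hp => by
      rw [pre_add, J.shift_iterate_mul_inf, hom_star_sWord_append, inner_star_pre_of_mem hp,
        J.sWord_pre_mul, ← inner_hom_left]
    rw [e π hv, e ρ hv', h1]
  · obtain ⟨r, hr⟩ := (Nat.modEq_iff_dvd' h).1 hmn.symm
    obtain rfl : m = J.1.length * r + n := by omega
    have e : ∀ (σ : Rep.{u} A) {p q : σ.H}, p ∈ σ.atom J.inf →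
        ⟪σ.hom (star (sWord A (pre J.inf (J.1.length * r + n)))) p,
          σ.hom (star (sWord A (pre J.inf n))) q⟫_ℂ =
        ⟪p, σ.hom (sWord A J.1 ^ r) q⟫_ℂ := fun σ p q hp => by
      rw [pre_add, J.shift_iterate_mul_inf, hom_star_sWord_append, J.sWord_pre_mul,
        inner_star_pre_of_mem (hom_star_pow_mem_atom hp r), ← inner_hom_right]
    rw [e π hv, e ρ hv', h2]

theorem inner_hom_eq_zero_of_periodic {v w : π.H} (hv : v ∈ π.atom J.inf)
    (hw : w ∈ π.atom J.inf) (h1 : ∀ r, ⟪π.hom (sWord A J.1 ^ r) v, w⟫_ℂ = 0)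
    (h2 : ∀ r, ⟪v, π.hom (sWord A J.1 ^ r) w⟫_ℂ = 0) (a : OA.{u} A) :
    ⟪v, π.hom a w⟫_ℂ = 0 := by
  rw [inner_hom_eq_of_periodic (ρ := π) hv hw (zero_mem _) (zero_mem _) (fun r => ?_)
    (fun r => ?_) a, inner_zero_left]
  · rw [h1, map_zero, inner_zero_left]
  · rw [h2, inner_zero_left]

/-- A word that is not eventually periodic shares tails with itself only at m = n, where stripping
letters preserves the inner product. -/
theorem inner_hom_eq_of_aperiodic {x : ℕ → Fin N} (hx : ¬ IsEventuallyPeriodic x) {v w : π.H}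
    {v' w' : ρ.H} (hv : v ∈ π.atom x) (hw : w ∈ π.atom x) (hv' : v' ∈ ρ.atom x)
    (hw' : w' ∈ ρ.atom x) (h : ⟪v, w⟫_ℂ = ⟪v', w'⟫_ℂ) (a : OA.{u} A) :
    ⟪v, π.hom a w⟫_ℂ = ⟪v', ρ.hom a w'⟫_ℂ := by
  refine inner_hom_eq_of_tails hv hw hv' hw' (fun m n hmn => ?_) a
  obtain rfl := eq_of_iterate_shift_eq hx hmn
  rw [inner_star_pre_of_mem hv, inner_star_pre_of_mem hv', h]

theorem inner_hom_eq_zero_of_aperiodic {x : ℕ → Fin N} (hx : ¬ IsEventuallyPeriodic x)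
    {v w : π.H} (hv : v ∈ π.atom x) (hw : w ∈ π.atom x) (h : ⟪v, w⟫_ℂ = 0) (a : OA.{u} A) :
    ⟪v, π.hom a w⟫_ℂ = 0 := by
  rw [inner_hom_eq_of_aperiodic (ρ := π) hx hv hw (zero_mem _) (zero_mem _)
    (by rw [h, inner_zero_left]) a, inner_zero_left]

theorem inner_hom_hom_eq_zero {v w : π.H} (h : ∀ a, ⟪v, π.hom a w⟫_ℂ = 0) (a b : OA.{u} A) :
    ⟪π.hom a v, π.hom b w⟫_ℂ = 0 := by
  rw [inner_hom_left, ← hom_mul_apply, h]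

theorem IsTotal.eq_zero_of_periodic {ι : Type*} {v : ι → π.H} (h : π.IsTotal v)
    (hv : ∀ k, v k ∈ π.atom J.inf) {u : π.H} (hu : u ∈ π.atom J.inf)
    (h1 : ∀ k r, ⟪π.hom (sWord A J.1 ^ r) u, v k⟫_ℂ = 0)
    (h2 : ∀ k r, ⟪u, π.hom (sWord A J.1 ^ r) (v k)⟫_ℂ = 0) : u = 0 :=
  h u fun k a => by
    rw [← inner_conj_symm, inner_hom_eq_zero_of_periodic hu (hv k) (h1 k) (h2 k), map_zero]

theorem IsTotal.eq_zero_of_aperiodic {x : ℕ → Fin N} (hx : ¬ IsEventuallyPeriodic x)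
    {ι : Type*} {v : ι → π.H} (h : π.IsTotal v) (hv : ∀ k, v k ∈ π.atom x) {u : π.H}
    (hu : u ∈ π.atom x) (h0 : ∀ k, ⟪u, v k⟫_ℂ = 0) : u = 0 :=
  h u fun k a => by
    rw [← inner_conj_symm, inner_hom_eq_zero_of_aperiodic hx hu (hv k) (h0 k), map_zero]

/-- Without coincidences of tails, all coefficients between u and the generating family vanish. This
isolates the summands with a given label when a decomposition is analysed. -/
theorem IsTotal.eq_zero_of_disjoint {x y : ℕ → Fin N} (hxy : ∀ m n, shift^[m] x ≠ shift^[n] y)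
    {ι : Type*} {v : ι → π.H} (h : π.IsTotal v) (hv : ∀ k, v k ∈ π.atom y) {u : π.H}
    (hu : u ∈ π.atom x) : u = 0 :=
  h.eq_zero_of_tails hv hu fun _ m n hmn => absurd hmn (hxy m n)

/-! ## Transport along intertwiners -/

theorem apply_mem_atom {V : π.H →ₗᵢ[ℂ] ρ.H} (hV : ∀ a u, V (π.hom a u) = ρ.hom a (V u))
    {x : ℕ → Fin N} {u : π.H} (hu : u ∈ π.atom x) : V u ∈ ρ.atom x := fun n => by
  rw [← hV, ← hV, hu]

theorem mem_atom_of_apply {V : π.H →ₗᵢ[ℂ] ρ.H} (hV : ∀ a u, V (π.hom a u) = ρ.hom a (V u))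
    {x : ℕ → Fin N} {u : π.H} (hu : V u ∈ ρ.atom x) : u ∈ π.atom x := fun n => by
  apply V.injective
  rw [hV, hV, hu]

theorem adjoint_hom {V : π.H →ₗᵢ[ℂ] ρ.H} (hV : ∀ a u, V (π.hom a u) = ρ.hom a (V u))
    (a : OA.{u} A) (v : ρ.H) :
    ContinuousLinearMap.adjoint V.toContinuousLinearMap (ρ.hom a v) =
      π.hom a (ContinuousLinearMap.adjoint V.toContinuousLinearMap v) := by
  refine ext_inner_left ℂ fun u => ?_
  rw [ContinuousLinearMap.adjoint_inner_right, inner_hom_right, inner_hom_right,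
    ContinuousLinearMap.adjoint_inner_right]
  change ⟪ρ.hom (star a) (V u), v⟫_ℂ = ⟪V (π.hom (star a) u), v⟫_ℂ
  rw [hV]

theorem adjoint_mem_atom {V : π.H →ₗᵢ[ℂ] ρ.H} (hV : ∀ a u, V (π.hom a u) = ρ.hom a (V u))
    {x : ℕ → Fin N} {v : ρ.H} (hv : v ∈ ρ.atom x) :
    ContinuousLinearMap.adjoint V.toContinuousLinearMap v ∈ π.atom x := fun n => by
  rw [← adjoint_hom hV, ← adjoint_hom hV, hv]

/-- The restriction of a representation to a closed invariant subspace. -/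
noncomputable def subrep (π : Rep.{u} A) (W : Submodule ℂ π.H) (hW : IsClosed (W : Set π.H))
    (h : ∀ (a : OA.{u} A), ∀ v ∈ W, π.hom a v ∈ W) : Rep.{u} A :=
  haveI : CompleteSpace W := hW.completeSpace_coe
  { H := W
    hom :=
      { toFun := fun a => ((π.hom a).comp W.subtypeL).codRestrict W fun v => h a v v.2
        map_one' := by ext v; simp
        map_mul' := fun a b => by ext v; exact π.hom_mul_apply a b v
        map_zero' := by ext v; simp
        map_add' := fun a b => by
          ext v
          change π.hom (a + b) v = π.hom a v + π.hom b v
          simp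
        commutes' := fun r => by
          ext v
          simp [Algebra.algebraMap_eq_smul_one]
        map_star' := fun a => by
          rw [ContinuousLinearMap.star_eq_adjoint, ContinuousLinearMap.eq_adjoint_iff]
          intro v w
          change ⟪π.hom (star a) v, (w : π.H)⟫_ℂ = ⟪(v : π.H), π.hom a w⟫_ℂ
          rw [inner_hom_left, star_star] } }

/-- Every family of vectors is total in some subrepresentation. -/
theorem exists_subrep {ι : Type*} (v : ι → π.H) :
    ∃ (ρ : Rep.{u} A) (V : ρ.H →ₗᵢ[ℂ] π.H) (w : ι → ρ.H),
      (∀ a u, V (ρ.hom a u) = π.hom a (V u)) ∧ (∀ k, V (w k) = v k) ∧ ρ.IsTotal w := by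
  set W := (LinearMap.range (π.familyMap v)).topologicalClosure with hW
  have hc : IsClosed (W : Set π.H) := Submodule.isClosed_topologicalClosure _
  have h0 : ∀ (a : OA.{u} A) c, π.hom a (π.familyMap v c) ∈ LinearMap.range (π.familyMap v) := by
    intro a c
    induction c using Finsupp.induction_linear with
    | zero => simp
    | add c c' h1 h2 => rw [map_add, map_add]; exact add_mem h1 h2
    | single k b =>
      rw [familyMap_single, ← hom_mul_apply, ← familyMap_single]
      exact ⟨_, rfl⟩
  have hi : ∀ (a : OA.{u} A), ∀ u ∈ W, π.hom a u ∈ W := by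
    intro a u hu
    refine map_mem_closure (π.hom a).continuous hu ?_
    rintro _ ⟨c, rfl⟩
    exact h0 a c
  have hv : ∀ k a, π.hom a (v k) ∈ W := fun k a => by
    rw [← familyMap_single]
    exact Submodule.le_topologicalClosure _ ⟨_, rfl⟩
  refine ⟨π.subrep W hc hi, W.subtypeₗᵢ,
    fun k => ⟨v k, by simpa [hom_one_apply] using hv k 1⟩, fun _ _ => rfl, fun _ => rfl, ?_⟩
  rintro ⟨u, hu⟩ h
  have : (⟨u, hu⟩ : W) = 0 := by
    rw [Subtype.ext_iff, Submodule.coe_zero]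
    have h1 : ∀ c, ⟪π.familyMap v c, u⟫_ℂ = 0 := by
      intro c
      induction c using Finsupp.induction_linear with
      | zero => simp
      | add c c' h1 h2 => rw [map_add, inner_add_left, h1, h2, add_zero]
      | single k b => rw [familyMap_single]; exact h k b
    refine (inner_self_eq_zero (𝕜 := ℂ)).1 ?_
    have h2 : u ∈ (LinearMap.range (π.familyMap v))ᗮᗮ := by
      rwa [Submodule.orthogonal_orthogonal_eq_closure]
    refine h2 u ?_
    rintro _ ⟨c, rfl⟩
    exact h1 c
  exact this

/-! ## The representations `P(J; z)` and `P(κ)` -/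

theorem IsCyclicUnit.ne_zero {Ω : π.H} (h : π.IsCyclicUnit Ω) : Ω ≠ 0 := by
  rw [← norm_ne_zero_iff, h.1]; exact one_ne_zero

/-- By `h1` the atom is the line through Ω. The projection of Ω to an invariant subspace V stays in
the atom, so it is a multiple of Ω. If it is zero, then Ω lies in Vᗮ; otherwise Ω lies in V.
Cyclicity finishes either case. -/
theorem isIrreducible_of_atom {x : ℕ → Fin N} {Ω : π.H} (hc : π.IsCyclicUnit Ω)
    (hΩ : Ω ∈ π.atom x) (h1 : ∀ u ∈ π.atom x, ⟪Ω, u⟫_ℂ = 0 → u = 0) : π.IsIrreducible := by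
  refine ⟨⟨⟨Ω, 0, hc.ne_zero⟩⟩, fun V hV hinv => ?_⟩
  have htop : ∀ W : Submodule ℂ π.H, IsClosed (W : Set π.H) →
      (∀ (a : OA.{u} A), ∀ v ∈ W, π.hom a v ∈ W) → Ω ∈ W → W = ⊤ := by
    intro W hW hi hΩW
    rw [eq_top_iff]
    intro u _
    have : closure (W : Set π.H) = Set.univ := by
      refine Dense.closure_eq (hc.2.mono ?_)
      rintro _ ⟨a, rfl⟩
      exact hi a _ hΩW
    rw [hW.closure_eq] at this
    exact this.ge (Set.mem_univ u)
  have : CompleteSpace V := hV.completeSpace_coe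
  have hinv' : ∀ (a : OA.{u} A), ∀ v ∈ Vᗮ, π.hom a v ∈ Vᗮ := by
    intro a v hv w hw
    rw [inner_hom_right]
    exact hv _ (hinv _ _ hw)
  obtain ⟨p, hp, q, hq, hpq⟩ := V.exists_add_mem_mem_orthogonal Ω
  have hpa : p ∈ π.atom x := by
    intro n
    set T := fun u => π.hom (sWord A (pre x n)) (π.hom (star (sWord A (pre x n))) u) with hT
    have h2 : T p - p ∈ V := V.sub_mem (hinv _ _ (hinv _ _ hp)) hp
    have h3 : T q - q ∈ Vᗮ := Vᗮ.sub_mem (hinv' _ _ (hinv' _ _ hq)) hq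
    -- T fixes p + q = Ω, so the defects of p and q are opposite. One lies in V and the other in Vᗮ,
    -- hence both are zero.
    have h4 : T p - p = -(T q - q) := by
      have h5 : T (p + q) = p + q := by rw [← hpq]; exact hΩ n
      have h6 : T (p + q) = T p + T q := by simp [hT]
      rw [h6] at h5
      rw [neg_sub, sub_eq_sub_iff_add_eq_add, h5, add_comm]
    have h5 : T p - p ∈ Vᗮ := by rw [h4]; exact Vᗮ.neg_mem h3
    exact sub_eq_zero.1 (inner_self_eq_zero.1 (h5 _ h2))
  by_cases h : ⟪Ω, p⟫_ℂ = 0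
  · have hp0 := h1 p hpa h
    rw [hp0, zero_add] at hpq
    left
    have := htop Vᗮ (Submodule.isClosed_orthogonal _) hinv' (hpq ▸ hq)
    rwa [Submodule.orthogonal_eq_top_iff] at this
  · right
    refine htop V hV hinv ?_
    have h2 : p - ⟪Ω, p⟫_ℂ • Ω = 0 := by
      refine h1 _ ((π.atom x).sub_mem hpa ((π.atom x).smul_mem _ hΩ)) ?_
      rw [inner_sub_right, inner_smul_right, inner_self_eq_norm_sq_to_K, hc.1]
      simp
    rw [sub_eq_zero] at h2
    have h3 : Ω = (⟪Ω, p⟫_ℂ)⁻¹ • p := by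
      rw [eq_inv_smul_iff₀ h, ← h2]
    rw [h3]
    exact V.smul_mem _ hp

theorem hom_pow_eigen {v : π.H} {z : ℂ} (h : π.hom (sWord A J.1) v = z • v) (r : ℕ) :
    π.hom (sWord A J.1 ^ r) v = z ^ r • v := by
  induction r with
  | zero => simp
  | succ r ih =>
    rw [pow_succ', hom_mul_apply, ih, map_smul, h, smul_smul, pow_succ]

/-- From s_J^n v = z^n v one gets ‖v‖² = |⟪(s_J^n)^* v, v⟫|, so the Cauchy–Schwarz inequality shows
that the contraction (s_J^n)^* preserves the norm of v. -/
theorem mem_atom_of_eigen {v : π.H} {z : Circle} (h : π.hom (sWord A J.1) v = (z : ℂ) • v) :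
    v ∈ π.atom J.inf := by
  rw [mem_atom_iff_norm]
  intro n
  refine le_antisymm (π.norm_hom_star_sWord_le _ v) ?_
  -- It suffices to treat prefixes of length |J| n: they extend the prefix of length n, and norms
  -- only decrease along prefixes.
  have hle : n ≤ J.1.length * n := Nat.le_mul_of_pos_left _ J.length_pos
  obtain ⟨m, hm⟩ := Nat.exists_eq_add_of_le hle
  have h1 := hom_pow_eigen h n
  rw [← J.sWord_pre_mul] at h1
  have h2 : ‖v‖ ≤ ‖π.hom (star (sWord A (pre J.inf (J.1.length * n)))) v‖ := by
    have h3 : (((z : ℂ) ^ n)⁻¹) • π.hom (sWord A (pre J.inf (J.1.length * n))) v = v := by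
      rw [h1, smul_smul, inv_mul_cancel₀ (by simp), one_smul]
    have h4 : ⟪v, v⟫_ℂ = ((z : ℂ) ^ n)⁻¹ *
        ⟪π.hom (star (sWord A (pre J.inf (J.1.length * n)))) v, v⟫_ℂ := by
      conv_lhs => rw [← h3, inner_smul_right, inner_hom_right, h3]
    have h5 : ‖v‖ * ‖v‖ ≤ ‖π.hom (star (sWord A (pre J.inf (J.1.length * n)))) v‖ * ‖v‖ := by
      have h6 := congrArg norm h4
      rw [norm_mul, norm_inv, norm_pow, Circle.norm_coe, one_pow, inv_one, one_mul,
        ← @inner_self_re_eq_norm ℂ, @inner_self_eq_norm_mul_norm ℂ] at h6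
      rw [h6]
      exact norm_inner_le_norm _ _
    rcases (norm_nonneg v).eq_or_lt with h0 | h0
    · rw [← h0]; exact norm_nonneg _
    · exact le_of_mul_le_mul_right h5 h0
  refine h2.trans ?_
  rw [hm, pre_add, hom_star_sWord_append]
  exact π.norm_hom_star_sWord_le _ _

theorem norm_hom_drop_of_mem {Ω : π.H} (hΩ : Ω ∈ π.atom J.inf) {l : ℕ} (hl : l ≤ J.1.length) :
    ‖π.hom (sWord A (J.1.drop l)) Ω‖ = ‖Ω‖ ∧
      π.hom (sWord A (J.1.drop l)) Ω ∈ π.atom (shift^[l] J.inf) := by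
  have h1 : J.1.drop l = pre (shift^[l] J.inf) (J.1.length - l) := by
    have : J.1 = pre J.inf (l + (J.1.length - l)) := by
      rw [Nat.add_sub_cancel' hl, J.pre_inf]
    conv_lhs => rw [this, pre_add]
    rw [List.drop_left' (by simp)]
  have := norm_pre_of_mem (π := π) (v := Ω) (J.isInfWord_inf.shift_iterate l) (J.1.length - l) (by
    rwa [← Function.iterate_add_apply, Nat.sub_add_cancel hl, J.shift_inf])
  rw [h1]
  exact ⟨this.1, this.2.1⟩

/-- The orthonormality required in P(J; z) is automatic: the |J| vectors lie in the atoms of |J|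
distinct shifts of J J J ⋯. -/
theorem isP_of_mem_atom {Ω : π.H} {z : Circle} (hc : π.IsCyclicUnit Ω)
    (hz : π.hom (sWord A J.1) Ω = (z : ℂ) • Ω) : π.IsP J.1 z := by
  have hΩ := mem_atom_of_eigen hz
  refine ⟨Ω, hc, hz, ⟨fun l => ?_, fun l l' hl => ?_⟩⟩
  · rw [(norm_hom_drop_of_mem hΩ l.2.le).1, hc.1]
  · refine inner_eq_zero_of_ne ?_ (norm_hom_drop_of_mem hΩ l.2.le).2
      (norm_hom_drop_of_mem hΩ l'.2.le).2
    rw [Ne, J.iterate_shift_inf_eq_iff]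
    intro h
    have := h.eq_of_lt_of_lt l.2 l'.2
    exact hl (Fin.ext this)

/-- Replacing Ω by s_J^r Ω changes inner products only by unimodular factors, so orthogonality to Ω
already gives orthogonality to everything it generates. Hence the atom of J J J ⋯ is the line
through Ω. -/
theorem IsTotal.eq_zero_of_eigen {Ω : π.H} {z : Circle} (hc : π.IsTotal fun _ : Unit => Ω)
    (hz : π.hom (sWord A J.1) Ω = (z : ℂ) • Ω) {u : π.H} (hu : u ∈ π.atom J.inf)
    (h : ⟪Ω, u⟫_ℂ = 0) : u = 0 := by
  have hΩ := mem_atom_of_eigen hz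
  have h' : ⟪u, Ω⟫_ℂ = 0 := by rw [← inner_conj_symm, h, map_zero]
  refine hc.eq_zero_of_periodic (fun _ => hΩ) hu (fun _ r => ?_) (fun _ r => ?_)
  · have h1 : Ω = ((z : ℂ) ^ r)⁻¹ • π.hom (sWord A J.1 ^ r) Ω := by
      rw [hom_pow_eigen hz, smul_smul, inv_mul_cancel₀ (by simp), one_smul]
    rw [h1, inner_smul_right, inner_hom_right, hom_star_pow_hom_pow hu, h', mul_zero]
  · rw [hom_pow_eigen hz, inner_smul_right, h', mul_zero]

theorem eq_inner_smul_of_eigen {Ω : π.H} {z : Circle} (hc : π.IsCyclicUnit Ω)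
    (hz : π.hom (sWord A J.1) Ω = (z : ℂ) • Ω) {u : π.H} (hu : u ∈ π.atom J.inf) :
    u = ⟪Ω, u⟫_ℂ • Ω := by
  have hΩ := mem_atom_of_eigen hz
  refine sub_eq_zero.1 ((isTotal_of_isCyclicUnit hc).eq_zero_of_eigen hz
    ((π.atom _).sub_mem hu ((π.atom _).smul_mem _ hΩ)) ?_)
  rw [inner_sub_right, inner_smul_right, inner_self_eq_norm_sq_to_K, hc.1]
  simp

theorem IsP.isIrreducible {z : Circle} (h : π.IsP J.1 z) : π.IsIrreducible := by
  obtain ⟨Ω, hc, hz, _⟩ := h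
  exact isIrreducible_of_atom hc (mem_atom_of_eigen hz) fun u hu =>
    (isTotal_of_isCyclicUnit hc).eq_zero_of_eigen hz hu

theorem inner_hom_eq_of_eigen {v w : π.H} {v' w' : ρ.H} {z : Circle}
    (hv : π.hom (sWord A J.1) v = (z : ℂ) • v) (hw : π.hom (sWord A J.1) w = (z : ℂ) • w)
    (hv' : ρ.hom (sWord A J.1) v' = (z : ℂ) • v') (hw' : ρ.hom (sWord A J.1) w' = (z : ℂ) • w')
    (h : ⟪v, w⟫_ℂ = ⟪v', w'⟫_ℂ) (a : OA.{u} A) : ⟪v, π.hom a w⟫_ℂ = ⟪v', ρ.hom a w'⟫_ℂ := by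
  refine inner_hom_eq_of_periodic (mem_atom_of_eigen hv) (mem_atom_of_eigen hw)
    (mem_atom_of_eigen hv') (mem_atom_of_eigen hw') (fun r => ?_) (fun r => ?_) a
  · rw [hom_pow_eigen hv, hom_pow_eigen hv', inner_smul_left, inner_smul_left, h]
  · rw [hom_pow_eigen hw, hom_pow_eigen hw', inner_smul_right, inner_smul_right, h]

theorem IsP.equivalent {z : Circle} (h : π.IsP J.1 z) (h' : ρ.IsP J.1 z) : π.Equivalent ρ := by
  obtain ⟨Ω, hc, hz, _⟩ := h
  obtain ⟨Ω', hc', hz', _⟩ := h'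
  refine equivalent_of_total (isTotal_of_isCyclicUnit hc) (isTotal_of_isCyclicUnit hc')
    fun _ _ a => inner_hom_eq_of_eigen hz hz hz' hz' ?_ a
  rw [inner_self_eq_norm_sq_to_K, inner_self_eq_norm_sq_to_K, hc.1, hc'.1]

theorem IsPInf.exists_mem_atom {K : ℕ → Fin N} (h : π.IsPInf K) :
    ∃ Ω, π.IsCyclicUnit Ω ∧ Ω ∈ π.atom K := by
  obtain ⟨Ω, hc, ho⟩ := h
  refine ⟨Ω, hc, mem_atom_iff_norm.2 fun n => ?_⟩
  cases n with
  | zero => simp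
  | succ n => rw [hc.1]; exact ho.1 n

theorem isPInf_of_mem_atom {K : ℕ → Fin N} (hK : ¬ IsEventuallyPeriodic K) {Ω : π.H}
    (hc : π.IsCyclicUnit Ω) (hΩ : Ω ∈ π.atom K) : π.IsPInf K := by
  refine ⟨Ω, hc, ⟨fun n => ?_, fun n m hnm => ?_⟩⟩
  · exact (mem_atom_iff_norm.1 hΩ (n + 1)).trans hc.1
  · refine inner_eq_zero_of_ne ?_ (star_pre_mem_atom hΩ (n + 1)) (star_pre_mem_atom hΩ (m + 1))
    exact fun h => hnm (by simpa using eq_of_iterate_shift_eq hK h)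

/-- Strip m letters of x and prepend n letters of y. The element s_I s_L^* with these two prefixes
takes the new vector back to Ω, so the new vector is cyclic as well. Thus P(κ) does not depend on
the representative word. -/
theorem exists_mem_atom_of_tails {x y : ℕ → Fin N} (hy : IsInfWord A y) {m n : ℕ}
    (h : shift^[m] x = shift^[n] y) {Ω : π.H} (hc : π.IsCyclicUnit Ω) (hΩ : Ω ∈ π.atom x) :
    ∃ Ω', π.IsCyclicUnit Ω' ∧ Ω' ∈ π.atom y := by
  have h1 := star_pre_mem_atom hΩ m
  rw [h] at h1
  obtain ⟨h2, h3, h4⟩ := norm_pre_of_mem hy n h1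
  set Ω' := π.hom (sWord A (pre y n)) (π.hom (star (sWord A (pre x m))) Ω) with hΩ'
  have h5 : ‖Ω'‖ = 1 := by rw [h2, mem_atom_iff_norm.1 hΩ, hc.1]
  have h6 : π.hom (sWord A (pre x m) * star (sWord A (pre y n))) Ω' = Ω := by
    rw [hom_mul_apply, h4, hΩ]
  refine ⟨Ω', isCyclicUnit_of_isTotal h5 fun w hw => ?_, h3⟩
  refine isTotal_of_isCyclicUnit hc w fun k a => ?_
  rw [← h6, ← hom_mul_apply]
  exact hw k _

theorem IsPClass.exists_mem_atom {K : AperiodicInfWord A} {κ : TailClass A}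
    (hK : Quotient.mk (tailSetoid A) K = κ) (h : π.IsPClass κ) :
    ∃ Ω, π.IsCyclicUnit Ω ∧ Ω ∈ π.atom K.1 := by
  obtain ⟨K', hK', h⟩ := h
  obtain ⟨Ω, hc, hΩ⟩ := h.exists_mem_atom
  obtain ⟨m, n, hmn⟩ := tailSetoid_iff.1 (hK'.trans hK.symm)
  exact exists_mem_atom_of_tails K.2.1 hmn hc hΩ

theorem IsPClass.isIrreducible {κ : TailClass A} (h : π.IsPClass κ) : π.IsIrreducible := by
  obtain ⟨K, hK⟩ := Quotient.exists_rep κ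
  obtain ⟨Ω, hc, hΩ⟩ := h.exists_mem_atom hK
  refine isIrreducible_of_atom hc hΩ fun u hu h0 =>
    (isTotal_of_isCyclicUnit hc).eq_zero_of_aperiodic K.2.2 (fun _ => hΩ) hu fun _ => ?_
  rw [← inner_conj_symm, h0, map_zero]

theorem IsPClass.equivalent {κ : TailClass A} (h : π.IsPClass κ) (h' : ρ.IsPClass κ) :
    π.Equivalent ρ := by
  obtain ⟨K, hK⟩ := Quotient.exists_rep κ
  obtain ⟨Ω, hc, hΩ⟩ := h.exists_mem_atom hK
  obtain ⟨Ω', hc', hΩ'⟩ := h'.exists_mem_atom hK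
  refine equivalent_of_total (isTotal_of_isCyclicUnit hc) (isTotal_of_isCyclicUnit hc')
    fun _ _ a => inner_hom_eq_of_aperiodic K.2.2 hΩ hΩ hΩ' hΩ' ?_ a
  rw [inner_self_eq_norm_sq_to_K, inner_self_eq_norm_sq_to_K, hc.1, hc'.1]

/-! ## Bilateral shifts -/

/-- An orthonormal family in the spectral subspace of `J J J ⋯` on which `s_J` acts as the
bilateral shift and which generates the representation. -/
structure IsShift (π : Rep.{u} A) (J : PrimWord A) (v : ℤ → π.H) : Prop where
  mem : ∀ k, v k ∈ π.atom J.inf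
  hom_apply : ∀ k, π.hom (sWord A J.1) (v k) = v (k + 1)
  orthonormal : Orthonormal ℂ v
  total : π.IsTotal v

theorem hom_pow_shift {v : ℤ → π.H} (h : ∀ k, π.hom (sWord A J.1) (v k) = v (k + 1)) (r : ℕ)
    (k : ℤ) : π.hom (sWord A J.1 ^ r) (v k) = v (k + r) := by
  induction r with
  | zero => simp
  | succ r ih => rw [pow_succ', hom_mul_apply, ih, h]; congr 1; push_cast; ring

theorem inner_hom_eq_of_shift {v : ℤ → π.H} {v' : ℤ → ρ.H} (hm : ∀ k, v k ∈ π.atom J.inf)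
    (h : ∀ k, π.hom (sWord A J.1) (v k) = v (k + 1)) (ho : Orthonormal ℂ v)
    (hm' : ∀ k, v' k ∈ ρ.atom J.inf) (h' : ∀ k, ρ.hom (sWord A J.1) (v' k) = v' (k + 1))
    (ho' : Orthonormal ℂ v') (k l : ℤ) (a : OA.{u} A) :
    ⟪v k, π.hom a (v l)⟫_ℂ = ⟪v' k, ρ.hom a (v' l)⟫_ℂ := by
  rw [orthonormal_iff_ite] at ho ho'
  refine inner_hom_eq_of_periodic (hm k) (hm l) (hm' k) (hm' l) (fun r => ?_) (fun r => ?_) a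
  · rw [hom_pow_shift h, hom_pow_shift h', ho, ho']
  · rw [hom_pow_shift h, hom_pow_shift h', ho, ho']

theorem IsShift.equivalent {v : ℤ → π.H} {w : ℤ → ρ.H} (h : π.IsShift J v) (h' : ρ.IsShift J w) :
    π.Equivalent ρ :=
  equivalent_of_total h.total h'.total (inner_hom_eq_of_shift h.mem h.hom_apply h.orthonormal
    h'.mem h'.hom_apply h'.orthonormal)

theorem IsShift.eq_zero {v : ℤ → π.H} (h : π.IsShift J v) {u : π.H} (hu : u ∈ π.atom J.inf)
    (h0 : ∀ k, ⟪v k, u⟫_ℂ = 0) : u = 0 := by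
  have h0' : ∀ k, ⟪u, v k⟫_ℂ = 0 := fun k => by rw [← inner_conj_symm, h0, map_zero]
  refine h.total.eq_zero_of_periodic h.mem hu (fun k r => ?_) (fun k r => ?_)
  · have : v k = π.hom (sWord A J.1 ^ r) (v (k - r)) := by
      rw [hom_pow_shift h.hom_apply, sub_add_cancel]
    rw [this, inner_hom_right, hom_star_pow_hom_pow hu, h0']
  · rw [hom_pow_shift h.hom_apply, h0']

end Rep

end CuntzKrieger

namespace CuntzKrieger

open Filter Topology

/-! ## Measurable fields of Hilbert spaces -/

namespace MeasurableField

variable {X : Type*} [MeasurableSpace X] {μ : Measure X} {H : X → Type u}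
    [∀ x, NormedAddCommGroup (H x)] [∀ x, InnerProductSpace ℂ (H x)] (F : MeasurableField μ H)

/-- Polarization: only measurability of norms is part of the structure. -/
theorem inner_measurable {s t : ∀ x, H x} (hs : s ∈ F.sections) (ht : t ∈ F.sections) :
    AEStronglyMeasurable (fun x => ⟪s x, t x⟫_ℂ) μ := by
  have h1 := F.norm_measurable _ (F.sections.add_mem hs ht)
  have h2 := F.norm_measurable _ (F.sections.sub_mem hs ht)
  have h3 := F.norm_measurable _
    (F.sections.sub_mem hs (F.sections.smul_mem (RCLike.I : ℂ) ht))
  have h4 := F.norm_measurable _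
    (F.sections.add_mem hs (F.sections.smul_mem (RCLike.I : ℂ) ht))
  have hc : ∀ {f : X → ℝ}, AEStronglyMeasurable f μ →
      AEStronglyMeasurable (fun x => ((f x : ℝ) : ℂ) ^ 2) μ := fun hf =>
    (Complex.continuous_ofReal.comp_aestronglyMeasurable hf).pow 2
  have := ((((hc h1).sub (hc h2)).add
    (((hc h3).sub (hc h4)).mul_const (RCLike.I : ℂ))).mul_const (4 : ℂ)⁻¹)
  refine this.congr (Eventually.of_forall fun x => ?_)
  simp only [inner_eq_sum_norm_sq_div_four (𝕜 := ℂ) (s x) (t x), Pi.add_apply, Pi.sub_apply,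
    Pi.smul_apply, div_eq_mul_inv]
  rfl

theorem smul_mem {f : X → ℂ} (hf : AEStronglyMeasurable f μ) {s : ∀ x, H x}
    (hs : s ∈ F.sections) : (fun x => f x • s x) ∈ F.sections := by
  refine F.maximal _ fun t ht => ?_
  simp only [inner_smul_right]
  exact hf.mul (F.inner_measurable ht hs)

theorem mem_of_tendsto {s : ℕ → ∀ x, H x} (hs : ∀ n, s n ∈ F.sections) {t : ∀ x, H x}
    (h : ∀ x, Tendsto (fun n => s n x) atTop (𝓝 (t x))) : t ∈ F.sections := by
  refine F.maximal _ fun r hr => ?_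
  exact aestronglyMeasurable_of_tendsto_ae atTop (fun n => F.inner_measurable hr (hs n))
    (Eventually.of_forall fun x => tendsto_const_nhds.inner (h x))

/-- A field of lines that is measurable has a measurable unit section. -/
theorem exists_unit_section {Ω : ∀ x, H x} (h0 : ∀ x, Ω x ≠ 0)
    (h : ∀ s ∈ F.sections, (fun x => ⟪Ω x, s x⟫_ℂ • Ω x) ∈ F.sections) :
    ∃ ω ∈ F.sections, ∀ x, ‖ω x‖ = 1 ∧ ∃ c : ℂ, ω x = c • Ω x := by
  -- The field Ω itself need not be measurable; only the maps onto its lines are. So a unit vector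
  -- is extracted from the images e_n of a fundamental sequence.
  obtain ⟨s, hs, hd⟩ := F.exists_fundamental
  set e : ℕ → ∀ x, H x := fun n x => ⟪Ω x, s n x⟫_ℂ • Ω x with he
  have hes : ∀ n, e n ∈ F.sections := fun n => h _ (hs n)
  -- The product is the indicator of the points where e_m vanishes for all m < n. Hence ∑ c_n e_n
  -- has at most one nonzero term at each point, namely the first nonzero e_n, normalized.
  set c : ℕ → X → ℂ := fun n x =>
    (∏ m ∈ Finset.range n, if ‖e m x‖ = 0 then (1 : ℂ) else 0) * ((‖e n x‖⁻¹ : ℝ) : ℂ) with hc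
  have hcm : ∀ n, AEStronglyMeasurable (c n) μ := by
    intro n
    refine AEStronglyMeasurable.mul ?_ ?_
    · refine Finset.aestronglyMeasurable_fun_prod _ fun m _ => ?_
      have hφ : Measurable fun r : ℝ => if r = 0 then (1 : ℂ) else 0 :=
        Measurable.ite (measurableSet_singleton 0) measurable_const measurable_const
      exact (hφ.comp_aemeasurable (F.norm_measurable _ (hes m)).aemeasurable).aestronglyMeasurable
    · exact Complex.continuous_ofReal.comp_aestronglyMeasurable
        (F.norm_measurable _ (hes n)).aemeasurable.inv.aestronglyMeasurable
  have hex : ∀ x, ∃ n, e n x ≠ 0 := by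
    intro x
    by_contra! hall
    refine h0 x ?_
    have h1 : ∀ u : H x, ⟪Ω x, u⟫_ℂ = 0 := by
      intro u
      refine (hd x).induction (P := fun u => ⟪Ω x, u⟫_ℂ = 0) (fun u hu => ?_)
        (isClosed_eq (by fun_prop) (by fun_prop)) u
      induction hu using Submodule.span_induction with
      | mem u hu =>
        obtain ⟨n, rfl⟩ := hu
        exact (smul_eq_zero.1 (hall n)).resolve_right (h0 x)
      | zero => simp
      | add u v _ _ hu hv => rw [inner_add_right, hu, hv, add_zero]
      | smul a u _ hu => rw [inner_smul_right, hu, mul_zero]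
    exact inner_self_eq_zero.1 (h1 (Ω x))
  have key : ∀ x, ∃ ω : H x, (‖ω‖ = 1 ∧ ∃ c : ℂ, ω = c • Ω x) ∧
      ∀ᶠ M in atTop, ∑ n ∈ Finset.range M, c n x • e n x = ω := by
    classical
    intro x
    set n := Nat.find (hex x) with hn
    have hne : e n x ≠ 0 := Nat.find_spec (hex x)
    have hlt : ∀ m < n, e m x = 0 := fun m hm => not_not.1 (Nat.find_min (hex x) hm)
    refine ⟨((‖e n x‖⁻¹ : ℝ) : ℂ) • e n x, ⟨?_, _, smul_smul _ _ _⟩, ?_⟩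
    · rw [norm_smul, Complex.norm_real, norm_inv, norm_norm, inv_mul_cancel₀]
      simpa using hne
    · filter_upwards [eventually_gt_atTop n] with M hM
      rw [Finset.sum_eq_single_of_mem n (Finset.mem_range.2 hM)]
      · congr 1
        simp only [hc]
        rw [Finset.prod_eq_one, one_mul]
        intro m hm
        rw [hlt m (Finset.mem_range.1 hm)]
        simp
      · intro m _ hm
        rcases lt_or_gt_of_ne hm with hm | hm
        · rw [hlt m hm, smul_zero]
        · have : c m x = 0 := by
            simp only [hc]
            rw [Finset.prod_eq_zero (Finset.mem_range.2 hm), zero_mul]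
            simp [hne]
          rw [this, zero_smul]
  choose ω hω hlim using key
  refine ⟨ω, F.mem_of_tendsto (s := fun M => ∑ n ∈ Finset.range M, fun x => c n x • e n x)
    (fun M => Submodule.sum_mem _ fun n _ => F.smul_mem (hcm n) (hes n)) fun x => ?_, hω⟩
  refine tendsto_const_nhds.congr' ?_
  filter_upwards [hlim x] with M hM
  rw [← hM, Finset.sum_apply]

end MeasurableField

variable {N : ℕ} {A : Matrix (Fin N) (Fin N) ℕ}

namespace Rep

variable {π : Rep.{u} A} {J : PrimWord A}

/-- Only countably many conditions are involved, which is what almost-everywhere and separability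
arguments need. -/
theorem inner_hom_eq_zero_of_words {v w : π.H}
    (h : ∀ I L, ⟪w, π.hom (sWord A I * star (sWord A L)) v⟫_ℂ = 0) (a : OA.{u} A) :
    ⟪w, π.hom a v⟫_ℂ = 0 := by
  have key : (innerSL ℂ w).toLinearMap ∘ₗ π.orbitMap v = 0 :=
    eq_of_eq_on_words ((innerSL ℂ w).continuous.comp (π.continuous_orbitMap v))
      continuous_const h
  exact LinearMap.congr_fun key a

/-- The mean ergodic theorem for the contraction z⁻¹ s_J, whose fixed space is the line through Ω.
It writes the projection onto that line as a limit of elements of the algebra applied to u, hence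
measurably in z. -/
theorem tendsto_birkhoffAverage_of_eigen {Ω : π.H} {z : Circle} (hc : π.IsCyclicUnit Ω)
    (hz : π.hom (sWord A J.1) Ω = (z : ℂ) • Ω) (u : π.H) :
    Tendsto (fun n : ℕ => ((n : ℂ)⁻¹) • ∑ k ∈ Finset.range n,
      ((z : ℂ)⁻¹) ^ k • π.hom (sWord A J.1 ^ k) u) atTop (𝓝 (⟪Ω, u⟫_ℂ • Ω)) := by
  set f : π.H →L[ℂ] π.H := ((z : ℂ)⁻¹) • π.hom (sWord A J.1) with hf
  have hf1 : ‖f‖ ≤ 1 := by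
    refine ContinuousLinearMap.opNorm_le_bound _ zero_le_one fun v => ?_
    rw [hf, smul_apply, norm_smul, norm_inv, Circle.norm_coe, inv_one]
    exact mul_le_mul_of_nonneg_left (π.norm_hom_sWord_le _ v) zero_le_one
  have h1 := f.tendsto_birkhoffAverage_orthogonalProjection hf1 u
  have hE : ∀ v, v ∈ f.eqLocus (1 : π.H →L[ℂ] π.H) ↔ π.hom (sWord A J.1) v = (z : ℂ) • v := by
    intro v
    change ((z : ℂ)⁻¹) • π.hom (sWord A J.1) v = v ↔ _
    rw [inv_smul_eq_iff₀ (by simp)]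
  set E := f.eqLocus (1 : π.H →L[ℂ] π.H) with hEdef
  have h2 : ((E.orthogonalProjectionOnto u : E) : π.H) = ⟪Ω, u⟫_ℂ • Ω := by
    have h3 := (hE _).1 (E.orthogonalProjectionOnto u).2
    rw [eq_inner_smul_of_eigen hc hz (mem_atom_of_eigen h3)]
    congr 1
    have h4 := E.inner_orthogonalProjectionOnto_eq_of_mem_left ⟨Ω, (hE Ω).2 hz⟩ u
    exact h4
  rw [h2] at h1
  refine h1.congr fun n => ?_
  rw [birkhoffAverage, birkhoffSum]
  congr 1
  refine Finset.sum_congr rfl fun k _ => ?_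
  have h5 : ∀ k, f^[k] u = ((z : ℂ)⁻¹) ^ k • π.hom (sWord A J.1 ^ k) u := by
    intro k
    induction k with
    | zero => simp
    | succ k ih =>
      rw [Function.iterate_succ_apply', ih, hf, smul_apply, map_smul, ← hom_mul_apply,
        ← pow_succ', smul_smul, ← pow_succ']
  exact h5 k

theorem inner_fourier_smul {H : Type*} [NormedAddCommGroup H] [InnerProductSpace ℂ H] (k : ℤ)
    (t : UnitAddCircle) (v w : H) :
    ⟪fourier k t • v, w⟫_ℂ = fourier (-k) t * ⟪v, w⟫_ℂ := by
  rw [inner_smul_left, fourier_neg]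

theorem ae_eq_zero_of_fourierCoeff {f : UnitAddCircle → ℂ}
    (hf : MemLp f 2 AddCircle.haarAddCircle)
    (h : ∀ k : ℤ, ∫ t, fourier (-k) t * f t ∂AddCircle.haarAddCircle = 0) :
    f =ᵐ[AddCircle.haarAddCircle] 0 := by
  have h1 : hf.toLp = 0 := by
    apply fourierBasis.repr.injective
    ext k
    rw [fourierBasis_repr, map_zero, fourierCoeff_congr_ae hf.coeFn_toLp]
    exact h k
  exact hf.coeFn_toLp.symm.trans (h1 ▸ Lp.coeFn_zero _ _ _)

/-- A direct integral of the representations `P(J; z)` is generated by a bilateral shift. -/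
theorem IsDirectIntegral.exists_isShift {ρ : UnitAddCircle → Rep.{u} A}
    (h : π.IsDirectIntegral AddCircle.haarAddCircle ρ)
    (hρ : ∀ t, (ρ t).IsP J.1 (AddCircle.toCircle t)) : ∃ v, π.IsShift J v := by
  obtain ⟨F, Ψ, hF, hsurj, hin, hact⟩ := h
  choose Ω hΩc hΩz _ using hρ
  have hmz : ∀ k : ℕ, AEStronglyMeasurable
      (fun t : UnitAddCircle => ((AddCircle.toCircle t : ℂ)⁻¹) ^ k) AddCircle.haarAddCircle := by
    intro k
    have : Continuous fun t : UnitAddCircle => ((AddCircle.toCircle t : ℂ)⁻¹) ^ k := by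
      have h1 : Continuous fun t : UnitAddCircle => (AddCircle.toCircle t : ℂ) := by
        exact (fourier (T := (1 : ℝ)) 1).continuous.congr fun t => fourier_one
      exact (h1.inv₀ fun t => by simp).pow k
    exact this.aestronglyMeasurable
  -- The eigenvectors Ω t are chosen point by point. The projections onto their lines are limits of
  -- ergodic averages and so preserve measurable sections, which yields a measurable unit
  -- eigenvector ω.
  obtain ⟨ω, hω, hω1⟩ := F.exists_unit_section (fun t => (hΩc t).ne_zero) fun s hs => by
    refine F.mem_of_tendsto (s := fun n : ℕ => ((n : ℂ)⁻¹) • ∑ k ∈ Finset.range n,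
      fun t => ((AddCircle.toCircle t : ℂ)⁻¹) ^ k • (ρ t).hom (sWord A J.1 ^ k) (s t))
      (fun n => ?_) fun t => ?_
    · exact Submodule.smul_mem _ _ (Submodule.sum_mem _ fun k _ => F.smul_mem (hmz k) (hF _ _ hs))
    · simpa only [Pi.smul_apply, Finset.sum_apply] using
        tendsto_birkhoffAverage_of_eigen (hΩc t) (hΩz t) (s t)
  have hω2 : ∀ t, (ρ t).hom (sWord A J.1) (ω t) = (AddCircle.toCircle t : ℂ) • ω t := by
    intro t
    obtain ⟨c, hc⟩ := (hω1 t).2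
    rw [hc, map_smul, hΩz, smul_comm]
  have hωc : ∀ t, (ρ t).IsTotal fun _ : Unit => ω t := by
    intro t
    obtain ⟨c, hc⟩ := (hω1 t).2
    have hc0 : c ≠ 0 := by
      rintro rfl
      have := (hω1 t).1
      rw [hc, zero_smul, norm_zero] at this
      exact zero_ne_one this
    intro w hw
    refine isTotal_of_isCyclicUnit (hΩc t) w fun k a => ?_
    have := hw () a
    rw [hc, map_smul, inner_smul_left] at this
    exact (mul_eq_zero.1 this).resolve_left (by simpa using hc0)
  have hfm : ∀ k : ℤ, (fun t => fourier k t • ω t) ∈ F.sqIntegrable := by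
    intro k
    refine ⟨F.smul_mem (fourier k).continuous.aestronglyMeasurable hω, ?_⟩
    refine (memLp_const (1 : ℝ)).ae_eq (Eventually.of_forall fun t => ?_)
    simp only [norm_smul, (hω1 t).1, mul_one, fourier_apply, Circle.norm_coe]
  have hactf : ∀ (a : OA.{u} A) (k : ℤ) (g : F.sqIntegrable),
      (∀ t, (ρ t).hom a (fourier k t • ω t) = g.1 t) → π.hom a (Ψ ⟨_, hfm k⟩) = Ψ g := by
    intro a k g hg
    obtain ⟨hm, he⟩ := hact a ⟨_, hfm k⟩
    rw [he]
    congr 1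
    exact Subtype.ext (funext hg)
  -- The shift basis is k ↦ z^k ω: since s_J multiplies ω by z, it raises the Fourier index by one.
  refine ⟨fun k => Ψ ⟨_, hfm k⟩, ⟨fun k n => ?_, fun k => ?_, ?_, ?_⟩⟩
  · rw [← hom_mul_apply]
    refine hactf _ _ _ fun t => ?_
    rw [hom_mul_apply]
    exact ((ρ t).atom J.inf).smul_mem _ (mem_atom_of_eigen (hω2 t)) n
  · refine hactf _ _ _ fun t => ?_
    change _ = fourier (k + 1) t • ω t
    rw [map_smul, hω2, smul_smul, fourier_add, fourier_one]
  · have ho := orthonormal_fourier (T := (1 : ℝ))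
    rw [orthonormal_iff_ite] at ho ⊢
    intro k l
    rw [hin, ← ho k l, fourierLp, fourierLp, ContinuousMap.inner_toLp]
    refine integral_congr_ae (Eventually.of_forall fun t => ?_)
    simp only [inner_smul_left, inner_smul_right, inner_self_eq_norm_sq_to_K, (hω1 t).1]
    simp [mul_comm]
  · intro u hu
    obtain ⟨s, rfl⟩ := hsurj u
    have hl2 : ∀ a : OA.{u} A, MemLp (fun t => ⟪(ρ t).hom a (ω t), s.1 t⟫_ℂ) 2
        AddCircle.haarAddCircle := by
      intro a
      refine (s.2.2.const_mul ‖a‖).mono (F.inner_measurable (hF a _ hω) s.2.1)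
        (Eventually.of_forall fun t => ?_)
      rw [norm_mul, norm_norm, norm_norm]
      refine (norm_inner_le_norm _ _).trans (mul_le_mul_of_nonneg_right ?_ (norm_nonneg _))
      have := (ρ t).norm_hom_apply_le a (ω t)
      rwa [(hω1 t).1, mul_one] at this
    -- The Fourier coefficients of t ↦ ⟪ρ_t(a) ω_t, s_t⟫ are the inner products of u with the
    -- vectors π(a) v_k, and these vanish.
    have hz : ∀ a : OA.{u} A, ∀ᵐ t ∂AddCircle.haarAddCircle (T := (1 : ℝ)),
        ⟪(ρ t).hom a (ω t), s.1 t⟫_ℂ = 0 := by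
      intro a
      refine ae_eq_zero_of_fourierCoeff (hl2 a) fun k => ?_
      have h1 := hu k a
      obtain ⟨hm, he⟩ := hact a ⟨_, hfm k⟩
      rw [he, hin] at h1
      rw [← h1]
      refine integral_congr_ae (Eventually.of_forall fun t => ?_)
      simp only [map_smul, inner_fourier_smul]
    have hz' : ∀ᵐ t ∂AddCircle.haarAddCircle (T := (1 : ℝ)), s.1 t = 0 := by
      -- The exceptional null set depends on a, so a is restricted to the countably many s_I s_L^*;
      -- they suffice because ω_t is total.
      have h2 : ∀ᵐ t ∂AddCircle.haarAddCircle (T := (1 : ℝ)), ∀ p : List (Fin N) × List (Fin N),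
          ⟪(ρ t).hom (sWord A p.1 * star (sWord A p.2)) (ω t), s.1 t⟫_ℂ = 0 :=
        ae_all_iff.2 fun p => hz _
      filter_upwards [h2] with t ht
      refine hωc t _ fun _ a => ?_
      rw [← inner_conj_symm, inner_hom_eq_zero_of_words (fun I L => ?_) a, map_zero]
      rw [← inner_conj_symm, ht (I, L), map_zero]
    have h3 : ⟪Ψ s, Ψ s⟫_ℂ = 0 := by
      rw [hin]
      refine integral_eq_zero_of_ae ?_
      filter_upwards [hz'] with t ht
      simp [ht]
    exact inner_self_eq_zero.1 h3

end Rep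

end CuntzKrieger

namespace CuntzKrieger

open Filter Topology

variable {N : ℕ} {A : Matrix (Fin N) (Fin N) ℕ}

/-! ## A permutative representation on the infinite words -/

theorem exists_isometry_of_orthonormal {H : Type*} [NormedAddCommGroup H] [InnerProductSpace ℂ H]
    [CompleteSpace H] {ι : Type*} [DecidableEq ι] {v : ι → H} (hv : Orthonormal ℂ v) :
    ∃ W : lp (fun _ : ι => ℂ) 2 →ₗᵢ[ℂ] H, (∀ n, W (lp.single 2 n 1) = v n) ∧
      (∀ n, ContinuousLinearMap.adjoint W.toContinuousLinearMap (v n) = lp.single 2 n 1) ∧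
      ∀ u, (∀ n, ⟪v n, u⟫_ℂ = 0) →
        ContinuousLinearMap.adjoint W.toContinuousLinearMap u = 0 := by
  have h1 : ∀ n, hv.orthogonalFamily.linearIsometry (lp.single 2 n (1 : ℂ)) = v n := fun n => by
    rw [OrthogonalFamily.linearIsometry_apply_single]
    simp
  refine ⟨hv.orthogonalFamily.linearIsometry, h1, fun n => ?_, fun u hu => ?_⟩
  · refine ext_inner_right ℂ fun w => ?_
    rw [ContinuousLinearMap.adjoint_inner_left, ← h1]
    exact LinearIsometry.inner_map_map _ _ _
  · ext n
    have := lp.inner_single_left (𝕜 := ℂ) (G := fun _ : ι => ℂ) n (1 : ℂ)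
      (ContinuousLinearMap.adjoint
        hv.orthogonalFamily.linearIsometry.toContinuousLinearMap u)
    rw [ContinuousLinearMap.adjoint_inner_right] at this
    have h2 : ⟪hv.orthogonalFamily.linearIsometry (lp.single 2 n (1 : ℂ)), u⟫_ℂ = 0 := by
      rw [h1, hu]
    erw [h2] at this
    simpa using this.symm

/-- T = W V^*, where V and W are the isometries of ℓ²(D) that send the basis vector at n to b_n and
to b_{m n}. -/
theorem exists_partial_isometry {H Λ : Type*} [NormedAddCommGroup H] [InnerProductSpace ℂ H]
    [CompleteSpace H] (b : HilbertBasis Λ ℂ H) (D : Set Λ) (m : Λ → Λ) (hm : Set.InjOn m D) :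
    ∃ T : H →L[ℂ] H, (∀ n ∈ D, T (b n) = b (m n)) ∧ (∀ n ∉ D, T (b n) = 0) ∧
      (∀ n ∈ D, star T (b (m n)) = b n) ∧ ∀ k, (∀ n ∈ D, m n ≠ k) → star T (b k) = 0 := by
  classical
  have hb := b.orthonormal
  obtain ⟨W, hW1, hW2, hW3⟩ := exists_isometry_of_orthonormal
    (hb.comp (fun n : D => m n) fun x y h => Subtype.ext (hm x.2 y.2 h))
  obtain ⟨V, hV1, hV2, hV3⟩ := exists_isometry_of_orthonormal
    (hb.comp (fun n : D => (n : Λ)) Subtype.val_injective)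
  have hort : ∀ k l, k ≠ l → ⟪b k, b l⟫_ℂ = 0 := fun k l h => hb.2 h
  refine ⟨W.toContinuousLinearMap.comp (ContinuousLinearMap.adjoint V.toContinuousLinearMap),
    fun n hn => ?_, fun n hn => ?_, fun n hn => ?_, fun k hk => ?_⟩
  · have := hV2 ⟨n, hn⟩
    simp only [Function.comp_apply] at this
    rw [ContinuousLinearMap.comp_apply, this]
    exact hW1 ⟨n, hn⟩
  · rw [ContinuousLinearMap.comp_apply, hV3, map_zero]
    intro k
    exact hort _ _ fun h => hn (h ▸ k.2)
  · have := hW2 ⟨n, hn⟩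
    simp only [Function.comp_apply] at this
    rw [ContinuousLinearMap.star_eq_adjoint, ContinuousLinearMap.adjoint_comp,
      ContinuousLinearMap.adjoint_adjoint, ContinuousLinearMap.comp_apply, this]
    exact hV1 ⟨n, hn⟩
  · rw [ContinuousLinearMap.star_eq_adjoint, ContinuousLinearMap.adjoint_comp,
      ContinuousLinearMap.adjoint_adjoint, ContinuousLinearMap.comp_apply, hW3, map_zero]
    intro n
    exact hort _ _ (hk n n.2)

theorem hilbertBasis_ext {H Λ : Type*} [NormedAddCommGroup H] [InnerProductSpace ℂ H]
    (b : HilbertBasis Λ ℂ H) {S T : H →L[ℂ] H} (h : ∀ n, S (b n) = T (b n)) : S = T := by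
  refine ContinuousLinearMap.ext_on (s := Set.range b) ?_ ?_
  · exact Submodule.dense_iff_topologicalClosure_eq_top.2 b.dense_span
  · rintro _ ⟨n, rfl⟩
    exact h n

/-- The admissible infinite words, lifted to a given universe. -/
abbrev InfWord (A : Matrix (Fin N) (Fin N) ℕ) : Type u := ULift.{u} {x : ℕ → Fin N // IsInfWord A x}

open Classical in
/-- Prepending a letter to an admissible word. -/
noncomputable def InfWord.cons (i : Fin N) (x : InfWord.{u} A) : InfWord.{u} A :=
  if h : A i (x.down.1 0) = 1 then ⟨⟨prepend i x.down.1, fun n => by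
    cases n with
    | zero => exact h
    | succ n => exact x.down.2 n⟩⟩ else x

theorem InfWord.cons_down {i : Fin N} {x : InfWord.{u} A} (h : A i (x.down.1 0) = 1) :
    (InfWord.cons i x).down.1 = prepend i x.down.1 := by
  rw [InfWord.cons, dif_pos h]

/-- The shift on admissible words. -/
def InfWord.tail (x : InfWord.{u} A) : InfWord.{u} A := ⟨⟨shift x.down.1, x.down.2.shift⟩⟩

theorem InfWord.cons_tail (x : InfWord.{u} A) : InfWord.cons (x.down.1 0) x.tail = x := by
  refine ULift.ext _ _ (Subtype.ext ?_)
  rw [InfWord.cons_down (x.down.2 0)]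
  exact prepend_shift _

/-- The representation of `O_A` on the square summable functions on the admissible words. -/
theorem exists_rep_infWord (hA : IsAdmissible A) :
    ∃ (π : Rep.{u} A) (b : HilbertBasis (InfWord.{u} A) ℂ π.H),
      ∀ x : InfWord.{u} A, π.hom (star (gen A (x.down.1 0))) (b x) = b x.tail := by
  classical
  let H := lp (fun _ : InfWord.{u} A => ℂ) 2
  let b : HilbertBasis (InfWord.{u} A) ℂ H := ⟨LinearIsometryEquiv.refl ℂ _⟩
  let D : Fin N → Set (InfWord.{u} A) := fun i => {x | A i (x.down.1 0) = 1}
  have hinj : ∀ i, Set.InjOn (InfWord.cons i) (D i) := by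
    intro i x hx y hy hxy
    have := congrArg (fun z : InfWord.{u} A => shift z.down.1) hxy
    simp only [InfWord.cons_down hx, InfWord.cons_down hy, shift_prepend] at this
    exact ULift.ext _ _ (Subtype.ext this)
  choose S h1 h2 h3 h4 using fun i => exists_partial_isometry b (D i) (InfWord.cons i) (hinj i)
  have hs : ∀ x : InfWord.{u} A, star (S (x.down.1 0)) (b x) = b x.tail := by
    intro x
    have := h3 (x.down.1 0) x.tail (x.down.2 0)
    rwa [x.cons_tail] at this
  have hs0 : ∀ i (x : InfWord.{u} A), i ≠ x.down.1 0 → star (S i) (b x) = 0 := by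
    intro i x hi
    refine h4 i x fun n hn h => hi ?_
    rw [← h, InfWord.cons_down hn, prepend_zero]
  have hss : ∀ i (x : InfWord.{u} A), S i (star (S i) (b x)) =
      if i = x.down.1 0 then b x else 0 := by
    intro i x
    split_ifs with h
    · subst h
      rw [hs, h1 _ _ (x.down.2 0), x.cons_tail]
    · rw [hs0 i x h, map_zero]
  have hss' : ∀ i (x : InfWord.{u} A), star (S i) (S i (b x)) =
      if A i (x.down.1 0) = 1 then b x else 0 := by
    intro i x
    split_ifs with h
    · rw [h1 i x h, h3 i x h]
    · rw [h2 i x h, map_zero]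
  have hck : IsCKFamily A S := by
    refine ⟨fun i => ?_, fun i => ?_, ?_⟩
    · refine hilbertBasis_ext b fun x => ?_
      change S i (star (S i) (S i (b x))) = S i (b x)
      rw [hss']
      split_ifs with h
      · rfl
      · rw [map_zero, h2 i x h]
    · refine hilbertBasis_ext b fun x => ?_
      change star (S i) (S i (b x)) = (∑ j, A i j • (S j * star (S j))) (b x)
      rw [hss', sum_apply]
      have : ∀ j, (A i j • (S j * star (S j))) (b x) = if j = x.down.1 0 then A i j • b x else 0 := by
        intro j
        have h5 := hss j x
        change A i j • (S j (star (S j) (b x))) = _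
        rw [h5]
        split_ifs <;> simp
      simp only [this]
      rw [Finset.sum_ite_eq' Finset.univ, if_pos (Finset.mem_univ _)]
      -- The domain of S_i is cut out by a_{ij} = 1, while the relation carries the coefficient
      -- a_{ij}; the two agree because entries are 0 or 1.
      rcases hA.zero_or_one i (x.down.1 0) with h | h
      · simp [h]
      · simp [h]
    · refine hilbertBasis_ext b fun x => ?_
      rw [sum_apply]
      have : ∀ j, (S j * star (S j)) (b x) = if j = x.down.1 0 then b x else 0 := fun j => hss j x
      simp only [this]
      rw [Finset.sum_ite_eq' Finset.univ, if_pos (Finset.mem_univ _)]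
      rfl
  obtain ⟨φ, hφ, -⟩ := universal.{u} A S hck
  refine ⟨⟨H, φ⟩, b, fun x => ?_⟩
  change φ (star (gen A (x.down.1 0))) (b x) = b x.tail
  rw [map_star, hφ]
  exact hs x

/-- There is a representation `P(J; 1)`. -/
theorem exists_isP_one (hA : IsAdmissible A) (J : PrimWord A) :
    ∃ (π : Rep.{u} A) (Ω : π.H), π.IsCyclicUnit Ω ∧ π.hom (sWord A J.1) Ω = Ω := by
  obtain ⟨π, b, hb⟩ := exists_rep_infWord.{u} hA
  have hpre : ∀ n (x : InfWord.{u} A), ∃ y : InfWord.{u} A, y.down.1 = shift^[n] x.down.1 ∧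
      π.hom (star (sWord A (pre x.down.1 n))) (b x) = b y := by
    intro n
    induction n with
    | zero => exact fun x => ⟨x, rfl, by simp⟩
    | succ n ih =>
      intro x
      obtain ⟨y, hy, h⟩ := ih x.tail
      refine ⟨y, hy, ?_⟩
      rw [pre_succ, Rep.hom_star_sWord_cons, hb]
      exact h
  let x : InfWord.{u} A := ⟨⟨J.inf, J.isInfWord_inf⟩⟩
  have hx : b x ∈ π.atom J.inf := by
    rw [Rep.mem_atom_iff_norm]
    intro n
    obtain ⟨y, -, h⟩ := hpre n x
    rw [h, b.orthonormal.1, b.orthonormal.1]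
  -- The word J J J ⋯ is fixed by the |J|-fold shift, so s_J^* fixes its basis vector, and then so
  -- does s_J.
  have hJ : π.hom (sWord A J.1) (b x) = b x := by
    obtain ⟨y, hy, h⟩ := hpre J.1.length x
    have hyx : y = x := ULift.ext _ _ (Subtype.ext (hy.trans J.shift_inf))
    rw [hyx] at h
    have h2 := hx J.1.length
    rw [show pre x.down.1 J.1.length = pre J.inf J.1.length from rfl, J.pre_inf] at h
    rwa [J.pre_inf, h] at h2
  obtain ⟨ρ, V, w, hV, hVw, hw⟩ := Rep.exists_subrep (fun _ : Unit => b x)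
  refine ⟨ρ, w (), Rep.isCyclicUnit_of_isTotal ?_ hw, ?_⟩
  · rw [← V.norm_map, hVw, b.orthonormal.1]
  · apply V.injective
    rw [hV, hVw, hJ]

/-! ## The gauge action -/

theorem IsCKFamily.circle_smul {B : Type*} [CStarAlgebra B] {s : Fin N → B} (hs : IsCKFamily A s)
    (w : Circle) : IsCKFamily A fun i => (w : ℂ) • s i := by
  have hw : (w : ℂ) * star (w : ℂ) = 1 := by
    have := Complex.mul_conj (w : ℂ)
    rw [Complex.normSq_eq_norm_sq, Circle.norm_coe] at this
    simpa using this
  have hw' : star (w : ℂ) * (w : ℂ) = 1 := by rw [mul_comm, hw]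
  refine ⟨fun i => ?_, fun i => ?_, ?_⟩
  · simp only [star_smul, smul_mul_smul_comm, hw, one_mul, hs.partialIsometry]
  · simp only [star_smul, smul_mul_smul_comm, hw, hw', one_smul, hs.star_mul_self]
  · simp only [star_smul, smul_mul_smul_comm, hw, one_smul, hs.sum_mul_star]

theorem IsCKFamily.map {B C : Type*} [CStarAlgebra B] [CStarAlgebra C] {s : Fin N → B}
    (hs : IsCKFamily A s) (φ : B →⋆ₐ[ℂ] C) : IsCKFamily A fun i => φ (s i) := by
  refine ⟨fun i => ?_, fun i => ?_, ?_⟩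
  · rw [← map_star, ← map_mul, ← map_mul, hs.partialIsometry]
  · rw [← map_star, ← map_mul, hs.star_mul_self, map_sum]
    simp only [map_nsmul, map_mul, map_star]
  · simp only [← map_star, ← map_mul, ← map_sum, hs.sum_mul_star, map_one]

/-- The twist by s_i ↦ w s_i turns P(J; 1) into P(J; w^|J|) without changing the Hilbert space, so
the P(J; z) can be placed over a constant field. -/
theorem exists_gauge (π : Rep.{u} A) (w : Circle) :
    ∃ φ : OA.{u} A →⋆ₐ[ℂ] (π.H →L[ℂ] π.H),
      ∀ I, φ (sWord A I) = ((w : ℂ) ^ I.length) • π.hom (sWord A I) := by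
  obtain ⟨φ, hφ, -⟩ := universal.{u} A _ (((isCKFamily_gen A).map π.hom).circle_smul w)
  refine ⟨φ, fun I => ?_⟩
  induction I with
  | nil => simp
  | cons i I ih =>
    rw [sWord_cons, map_mul, map_mul, ih, hφ, smul_mul_smul_comm, List.length_cons, pow_succ']

end CuntzKrieger

namespace CuntzKrieger

open Filter Topology

variable {N : ℕ} {A : Matrix (Fin N) (Fin N) ℕ}

/-! ## Direct integrals over constant fields of Hilbert spaces -/

section ConstantField

variable {X : Type} [MeasurableSpace X] {μ : Measure X} {H : Type u} [NormedAddCommGroup H]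
  [InnerProductSpace ℂ H]

/-- Weakly measurable functions with values in a separable Hilbert space are measurable. -/
theorem aestronglyMeasurable_of_inner [TopologicalSpace.SeparableSpace H] {f : X → H}
    (h : ∀ v, AEStronglyMeasurable (fun x => ⟪v, f x⟫_ℂ) μ) : AEStronglyMeasurable f μ := by
  set d := TopologicalSpace.denseSeq H
  -- The finite-dimensional projections of f have measurable coordinates and converge to f
  -- pointwise.
  let U : ℕ → Submodule ℂ H := fun n => Submodule.span ℂ (d '' Set.Iic n)
  have hfin : ∀ n, FiniteDimensional ℂ (U n) := fun n =>
    FiniteDimensional.span_of_finite ℂ ((Set.finite_Iic n).image d)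
  have hU : Monotone U := fun m n hmn =>
    Submodule.span_mono (Set.image_mono (Set.Iic_subset_Iic.2 hmn))
  have hUt : ⊤ ≤ (⨆ n, U n).topologicalClosure := by
    intro v _
    refine closure_mono ?_ (TopologicalSpace.denseRange_denseSeq H v)
    rintro _ ⟨n, rfl⟩
    exact Submodule.mem_iSup_of_mem n (Submodule.subset_span ⟨n, Set.mem_Iic.2 le_rfl, rfl⟩)
  refine aestronglyMeasurable_of_tendsto_ae atTop (f := fun n x => (U n).starProjection (f x))
    (fun n => ?_) (Eventually.of_forall fun x =>
      Submodule.starProjection_tendsto_self U hU (f x) hUt)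
  have : ∀ x, (U n).starProjection (f x) =
      ∑ i, ⟪(stdOrthonormalBasis ℂ (U n) i : H), f x⟫_ℂ • (stdOrthonormalBasis ℂ (U n) i : H) := by
    intro x
    rw [Submodule.starProjection_apply,
      (stdOrthonormalBasis ℂ (U n)).orthogonalProjectionOnto_apply_eq_sum]
    simp
  simp only [this]
  exact Finset.aestronglyMeasurable_fun_sum _ fun i _ => (h _).smul_const _

/-- The constant field of Hilbert spaces. -/
def constantField (μ : Measure X) (H : Type u) [NormedAddCommGroup H] [InnerProductSpace ℂ H]
    [TopologicalSpace.SeparableSpace H] : MeasurableField μ (fun _ : X => H) where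
  sections :=
    { carrier := {s | AEStronglyMeasurable s μ}
      add_mem' := fun hs ht => AEStronglyMeasurable.add hs ht
      zero_mem' := aestronglyMeasurable_zero
      smul_mem' := fun c _ hs => AEStronglyMeasurable.const_smul hs c }
  norm_measurable := fun _ hs => AEStronglyMeasurable.norm hs
  maximal := fun _ h => aestronglyMeasurable_of_inner fun v => h (fun _ => v)
    aestronglyMeasurable_const
  exists_fundamental := ⟨fun n _ => TopologicalSpace.denseSeq H n,
    fun _ => aestronglyMeasurable_const, fun _ =>
      (TopologicalSpace.denseRange_denseSeq H).mono Submodule.subset_span⟩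

variable [CompleteSpace H] {φ : X → OA.{u} A →⋆ₐ[ℂ] (H →L[ℂ] H)}

theorem norm_starAlgHom_apply_le (ψ : OA.{u} A →⋆ₐ[ℂ] (H →L[ℂ] H)) (a : OA.{u} A) (v : H) :
    ‖ψ a v‖ ≤ ‖a‖ * ‖v‖ :=
  Rep.norm_hom_apply_le ⟨H, ψ⟩ a v

theorem stronglyMeasurable_of_words
    (h : ∀ I L v, StronglyMeasurable fun x => φ x (sWord A I * star (sWord A L)) v)
    (a : OA.{u} A) (v : H) : StronglyMeasurable fun x => φ x a v := by
  have hspan : ∀ b ∈ wordSpan A, StronglyMeasurable fun x => φ x b v := by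
    intro b hb
    induction hb using Submodule.span_induction with
    | mem x hx => obtain ⟨p, rfl⟩ := hx; exact h _ _ _
    | zero => simpa using stronglyMeasurable_const (b := (0 : H))
    | add b c _ _ hb hc =>
      have : (fun x => φ x (b + c) v) = (fun x => φ x b v) + fun x => φ x c v := by ext; simp
      rw [this]; exact hb.add hc
    | smul r b _ hb =>
      have : (fun x => φ x (r • b) v) = r • fun x => φ x b v := by ext; simp
      rw [this]; exact hb.const_smul r
  obtain ⟨b, hb, hlim⟩ := mem_closure_iff_seq_limit.1 (dense_wordSpan (A := A) a)
  refine stronglyMeasurable_of_tendsto atTop (fun n => hspan (b n) (hb n)) ?_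
  rw [tendsto_pi_nhds]
  exact fun x => ((Rep.continuous_hom_apply ⟨H, φ x⟩ v).tendsto a).comp hlim

/-- A Carathéodory argument: (v, x) ↦ φ_x(a) v is continuous in v and measurable in x, hence jointly
measurable, and it is composed with x ↦ (f x, x). -/
theorem aestronglyMeasurable_apply [TopologicalSpace.SeparableSpace H]
    (h : ∀ a v, StronglyMeasurable fun x => φ x a v) (a : OA.{u} A) {f : X → H}
    (hf : AEStronglyMeasurable f μ) : AEStronglyMeasurable (fun x => φ x a (f x)) μ := by
  borelize H
  have := stronglyMeasurable_uncurry_of_continuous_of_stronglyMeasurable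
    (u := fun (v : H) (x : X) => φ x a v) (fun x => (φ x a).continuous) (h a)
  have hSC : SecondCountableTopology H := UniformSpace.secondCountable_of_separable H
  exact this.aestronglyMeasurable.comp_aemeasurable (f := fun x => (f x, x))
    (μ := μ) (hf.aemeasurable.prodMk aemeasurable_id)

theorem memLp_apply [TopologicalSpace.SeparableSpace H]
    (h : ∀ a v, StronglyMeasurable fun x => φ x a v) (a : OA.{u} A) {f : X → H}
    (hf : MemLp f 2 μ) : MemLp (fun x => φ x a (f x)) 2 μ :=
  hf.of_le_mul (c := ‖a‖) (aestronglyMeasurable_apply h a hf.1)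
    (Eventually.of_forall fun _ => norm_starAlgHom_apply_le _ _ _)

/-- The decomposable operator of a measurable field of operators on a constant field. -/
noncomputable def decomposable [TopologicalSpace.SeparableSpace H]
    (h : ∀ a v, StronglyMeasurable fun x => φ x a v) (a : OA.{u} A) :
    Lp H 2 μ →L[ℂ] Lp H 2 μ :=
  LinearMap.mkContinuous
    { toFun := fun f => (memLp_apply h a (Lp.memLp f)).toLp
      map_add' := fun f g => by
        rw [← MemLp.toLp_add, MemLp.toLp_eq_toLp_iff]
        filter_upwards [Lp.coeFn_add f g] with x hx
        change φ x a ((f + g : Lp H 2 μ) x) = φ x a (f x) + φ x a (g x)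
        rw [hx, Pi.add_apply, map_add]
      map_smul' := fun c f => by
        rw [RingHom.id_apply, ← MemLp.toLp_const_smul, MemLp.toLp_eq_toLp_iff]
        filter_upwards [Lp.coeFn_smul c f] with x hx
        change φ x a ((c • f : Lp H 2 μ) x) = c • φ x a (f x)
        rw [hx, Pi.smul_apply, map_smul] } ‖a‖ fun f => by
    refine Lp.norm_le_mul_norm_of_ae_le_mul ?_
    filter_upwards [(memLp_apply h a (Lp.memLp f)).coeFn_toLp] with x hx
    refine (le_of_eq ?_).trans (norm_starAlgHom_apply_le (φ x) a (f x))
    exact congrArg norm hx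

theorem coeFn_decomposable [TopologicalSpace.SeparableSpace H]
    (h : ∀ a v, StronglyMeasurable fun x => φ x a v) (a : OA.{u} A) (f : Lp H 2 μ) :
    decomposable h a f =ᵐ[μ] fun x => φ x a (f x) :=
  (memLp_apply h a (Lp.memLp f)).coeFn_toLp

/-- The direct integral of a measurable family of representations on one Hilbert space. -/
noncomputable def constantIntegral [TopologicalSpace.SeparableSpace H] (μ : Measure X)
    (h : ∀ a v, StronglyMeasurable fun x => φ x a v) :
    OA.{u} A →⋆ₐ[ℂ] (Lp H 2 μ →L[ℂ] Lp H 2 μ) where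
  toFun := decomposable h
  map_one' := by
    ext1 f
    refine Lp.ext ?_
    filter_upwards [coeFn_decomposable h 1 f] with x hx
    rw [hx]; simp
  map_mul' a b := by
    ext1 f
    refine Lp.ext ?_
    filter_upwards [coeFn_decomposable h (a * b) f, coeFn_decomposable h a (decomposable h b f),
      coeFn_decomposable h b f] with x h1 h2 h3
    change _ = (decomposable h a (decomposable h b f)) x
    rw [h1, h2, h3, map_mul]
    rfl
  map_zero' := by
    ext1 f
    refine Lp.ext ?_
    filter_upwards [coeFn_decomposable h 0 f, Lp.coeFn_zero H 2 μ] with x hx h0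
    change _ = (0 : Lp H 2 μ) x
    rw [hx, h0, map_zero]
    rfl
  map_add' a b := by
    ext1 f
    refine Lp.ext ?_
    change _ =ᵐ[μ] (decomposable h a f + decomposable h b f : Lp H 2 μ)
    filter_upwards [coeFn_decomposable h (a + b) f, coeFn_decomposable h a f,
      coeFn_decomposable h b f, Lp.coeFn_add (decomposable h a f) (decomposable h b f)]
      with x h1 h2 h3 h4
    rw [h1, h4, Pi.add_apply, h2, h3, map_add]
    rfl
  commutes' c := by
    ext1 f
    refine Lp.ext ?_
    change _ =ᵐ[μ] (c • f : Lp H 2 μ)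
    filter_upwards [coeFn_decomposable h (algebraMap ℂ _ c) f, Lp.coeFn_smul c f] with x h1 h2
    rw [h1, h2, AlgHomClass.commutes, Algebra.algebraMap_eq_smul_one]
    rfl
  map_star' a := by
    rw [ContinuousLinearMap.star_eq_adjoint, ContinuousLinearMap.eq_adjoint_iff]
    intro f g
    rw [L2.inner_def, L2.inner_def]
    refine integral_congr_ae ?_
    filter_upwards [coeFn_decomposable h (star a) f, coeFn_decomposable h a g] with x h1 h2
    rw [h1, h2, map_star, ContinuousLinearMap.star_eq_adjoint,
      ContinuousLinearMap.adjoint_inner_left]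

theorem isDirectIntegral_constantIntegral [TopologicalSpace.SeparableSpace H] (μ : Measure X)
    (h : ∀ a v, StronglyMeasurable fun x => φ x a v) :
    Rep.IsDirectIntegral (A := A) ⟨Lp H 2 μ, constantIntegral μ h⟩ μ fun x => ⟨H, φ x⟩ := by
  have hmem : ∀ s : (constantField μ H).sqIntegrable, MemLp s.1 2 μ := fun s =>
    (memLp_norm_iff s.2.1).1 s.2.2
  refine ⟨constantField μ H,
    { toFun := fun s => (hmem s).toLp
      map_add' := fun s t => MemLp.toLp_add (hmem s) (hmem t)
      map_smul' := fun c s => MemLp.toLp_const_smul c (hmem s) }, ?_, ?_, ?_, ?_⟩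
  · exact fun a s hs => aestronglyMeasurable_apply h a hs
  · intro f
    refine ⟨⟨f, (Lp.memLp f).1, (Lp.memLp f).norm⟩, ?_⟩
    exact Lp.toLp_coeFn (f : Lp H 2 μ) (Lp.memLp (f : Lp H 2 μ))
  · intro s t
    change ⟪(hmem s).toLp, (hmem t).toLp⟫_ℂ = _
    rw [L2.inner_def]
    refine integral_congr_ae ?_
    filter_upwards [(hmem s).coeFn_toLp, (hmem t).coeFn_toLp] with x h1 h2
    rw [h1, h2]
  · intro a s
    have hm := memLp_apply h a (hmem s)
    refine ⟨⟨hm.1, hm.norm⟩, ?_⟩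
    refine Lp.ext ?_
    filter_upwards [coeFn_decomposable h a ((hmem s).toLp), (hmem s).coeFn_toLp,
      hm.coeFn_toLp] with x h1 h2 h3
    exact h1.trans ((congrArg (φ x a) h2).trans h3.symm)

end ConstantField

theorem Rep.IsCyclicUnit.separableSpace {π : Rep.{u} A} {Ω : π.H} (h : π.IsCyclicUnit Ω) :
    TopologicalSpace.SeparableSpace π.H := by
  set S : Set π.H := Set.range fun p : List (Fin N) × List (Fin N) =>
    π.hom (sWord A p.1 * star (sWord A p.2)) Ω with hS
  have hc : TopologicalSpace.IsSeparable (closure (Submodule.span ℂ S : Set π.H)) :=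
    ((Set.countable_range _).isSeparable.span).closure
  have huniv : closure (Submodule.span ℂ S : Set π.H) = Set.univ := by
    have hsub : (Submodule.span ℂ S).topologicalClosure = ⊤ := by
      rw [Submodule.topologicalClosure_eq_top_iff, Submodule.eq_bot_iff]
      intro w hw
      refine isTotal_of_isCyclicUnit h w fun _ a => ?_
      rw [← inner_conj_symm, inner_hom_eq_zero_of_words (fun I L => ?_) a, map_zero]
      rw [← inner_conj_symm, hw _ (Submodule.subset_span ⟨(I, L), rfl⟩), map_zero]
    have := congrArg (fun W : Submodule ℂ π.H => (W : Set π.H)) hsub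
    simpa using this
  rw [huniv] at hc
  exact TopologicalSpace.isSeparable_univ_iff.1 hc

/-- The direct integral of the representations `P(J; z)` over the circle exists. -/
theorem exists_isDirectIntegral (hA : IsAdmissible A) (J : PrimWord A) :
    ∃ (σ : Rep.{u} A) (ρ : UnitAddCircle → Rep.{u} A),
      (∀ t, (ρ t).IsP J.1 (AddCircle.toCircle t)) ∧
        σ.IsDirectIntegral AddCircle.haarAddCircle ρ := by
  obtain ⟨π, Ω, hc, hJ⟩ := exists_isP_one.{u} hA J
  have hsep := hc.separableSpace
  -- A measurable |J|-th root of z, obtained from the argument.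
  set w : UnitAddCircle → Circle := fun t =>
    Circle.exp (Complex.arg (AddCircle.toCircle t) / J.1.length) with hw
  have hwJ : ∀ t, w t ^ J.1.length = AddCircle.toCircle t := by
    intro t
    have hk : (J.1.length : ℝ) ≠ 0 := by exact_mod_cast J.length_pos.ne'
    rw [hw]
    simp only
    rw [← Circle.exp_nsmul, nsmul_eq_mul, mul_div_cancel₀ _ hk, Circle.exp_arg]
  have hwm : StronglyMeasurable fun t => (w t : ℂ) := by
    have h1 : Measurable fun t : UnitAddCircle => (AddCircle.toCircle t : ℂ) :=
      ((fourier (T := (1 : ℝ)) 1).continuous.congr fun t => fourier_one).measurable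
    have h2 : Measurable fun t : UnitAddCircle =>
        Complex.exp (((Complex.arg (AddCircle.toCircle t) / J.1.length : ℝ) : ℂ) * Complex.I) := by
      fun_prop
    have h3 : (fun t => (w t : ℂ)) = fun t : UnitAddCircle => Complex.exp
        (((Complex.arg (AddCircle.toCircle t) / J.1.length : ℝ) : ℂ) * Complex.I) := by
      ext t; rfl
    rw [h3]
    exact h2.stronglyMeasurable
  choose φ hφ using fun t => exists_gauge π (w t)
  have hmeas : ∀ a v, StronglyMeasurable fun t => φ t a v := by
    refine stronglyMeasurable_of_words fun I L v => ?_
    have : ∀ t, φ t (sWord A I * star (sWord A L)) v = ((w t : ℂ) ^ I.length *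
        star ((w t : ℂ) ^ L.length)) • π.hom (sWord A I * star (sWord A L)) v := by
      intro t
      rw [map_mul, map_star, hφ, hφ, star_smul, smul_mul_smul_comm, map_mul, map_star]
      rfl
    simp only [this]
    exact ((hwm.pow _).mul (Complex.continuous_conj.comp_stronglyMeasurable
      (hwm.pow _))).smul_const _
  -- On each s_I s_L^* the twisted action differs from π by a nonzero scalar, so Ω remains cyclic.
  have htot : ∀ t, ∀ u : π.H, (∀ a, ⟪φ t a Ω, u⟫_ℂ = 0) → u = 0 := by
    intro t u hu
    refine Rep.isTotal_of_isCyclicUnit hc u fun _ a => ?_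
    rw [← inner_conj_symm, Rep.inner_hom_eq_zero_of_words (fun I L => ?_) a, map_zero]
    have h1 := hu (sWord A I * star (sWord A L))
    rw [map_mul, map_star, hφ, hφ, star_smul, smul_mul_smul_comm, ← map_star, ← map_mul,
      smul_apply, inner_smul_left] at h1
    rw [← inner_conj_symm, (mul_eq_zero.1 h1).resolve_left (by simp), map_zero]
  refine ⟨_, _, fun t => ?_, isDirectIntegral_constantIntegral AddCircle.haarAddCircle hmeas⟩
  refine Rep.isP_of_mem_atom (π := ⟨π.H, φ t⟩) (Ω := Ω)
    (Rep.isCyclicUnit_of_isTotal hc.1 fun u hu => htot t u (hu ())) ?_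
  change φ t (sWord A J.1) Ω = _
  rw [hφ, smul_apply, hJ, ← hwJ, Circle.coe_pow]

end CuntzKrieger

namespace CuntzKrieger

variable {N : ℕ} {A : Matrix (Fin N) (Fin N) ℕ}

/-! ## Roots of unity and cyclic unitaries -/

/-- The number `e^{2πi(j+1)/p}`. -/
noncomputable def rootPhase (p j : ℕ) : Circle :=
  AddCircle.toCircle ((((j : ℝ) + 1) / p : ℝ) : UnitAddCircle)

/-- The fractions (j+1)/p lie in (0, 1], a fundamental domain of the circle, so equal phases mean
equal fractions. -/
theorem rootPhase_eq_iff {p d j l : ℕ} (hj : j < p) (hl : l < d) :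
    rootPhase p j = rootPhase d l ↔ (j + 1) * d = (l + 1) * p := by
  have hp : (0 : ℝ) < p := by exact_mod_cast (Nat.zero_le j).trans_lt hj
  have hd : (0 : ℝ) < d := by exact_mod_cast (Nat.zero_le l).trans_lt hl
  have hmem : ∀ {p j : ℕ}, j < p → (0 : ℝ) < p →
      (((j : ℝ) + 1) / p : ℝ) ∈ Set.Ioc (0 : ℝ) (0 + 1) := by
    intro p j hj hp
    refine ⟨by positivity, ?_⟩
    rw [zero_add, div_le_one hp]
    exact_mod_cast hj
  have : Fact ((0 : ℝ) < 1) := ⟨one_pos⟩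
  rw [rootPhase, rootPhase, (AddCircle.injective_toCircle one_ne_zero).eq_iff,
    AddCircle.coe_eq_coe_iff_of_mem_Ioc (hmem hj hp) (hmem hl hd), div_eq_div_iff hp.ne' hd.ne']
  norm_cast

theorem rootPhase_pow {p : ℕ} (hp : 0 < p) (j : ℕ) : rootPhase p j ^ p = 1 := by
  rw [rootPhase, ← AddCircle.toCircle_nsmul, ← AddCircle.coe_nsmul, nsmul_eq_mul,
    mul_div_cancel₀ _ (by exact_mod_cast hp.ne')]
  have : ((j : ℝ) + 1 : ℝ) = (j + 1 : ℕ) • (1 : ℝ) := by simp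
  rw [this, AddCircle.coe_nsmul, AddCircle.coe_period, smul_zero, AddCircle.toCircle_zero]

theorem rootPhase_ne {p : ℕ} {j l : Fin p} (h : j ≠ l) : rootPhase p j ≠ rootPhase p l := by
  rw [Ne, rootPhase_eq_iff j.2 l.2, Nat.mul_left_inj (by have := j.2; omega), Nat.add_left_inj]
  exact fun h' => h (Fin.ext h')

/-- Isometry gives ⟪v, w⟫ = z̄ z' ⟪v, w⟫, and z̄ z' ≠ 1. In use, v' and w' are images under s_J or a
unitary. -/
theorem inner_eq_zero_of_phase_ne {H : Type*} [NormedAddCommGroup H] [InnerProductSpace ℂ H]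
    {v w v' w' : H} {z z' : Circle} (hz : z ≠ z') (h : ⟪v', w'⟫_ℂ = ⟪v, w⟫_ℂ)
    (hv : v' = (z : ℂ) • v) (hw : w' = (z' : ℂ) • w) : ⟪v, w⟫_ℂ = 0 := by
  rw [hv, hw, inner_smul_left, inner_smul_right, ← mul_assoc] at h
  by_contra h0
  have h1 : (starRingEnd ℂ) (z : ℂ) * z' = 1 := mul_right_cancel₀ h0 (by rw [h, one_mul])
  rw [← Circle.coe_inv_eq_conj, ← Circle.coe_mul, Circle.coe_eq_one, inv_mul_eq_one] at h1
  exact hz h1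

/-- A unitary that permutes an orthonormal system `v, U v, …, U^{p-1} v` cyclically is diagonalized
by the discrete Fourier transform. -/
theorem exists_eigenvectors_of_cyclic {H : Type*} [NormedAddCommGroup H] [InnerProductSpace ℂ H]
    (U : H ≃ₗᵢ[ℂ] H) {v : H} {p : ℕ} (hp : 0 < p) (hv : ‖v‖ = 1) (hU : (U ^ p) v = v)
    (h0 : ∀ k, 0 < k → k < p → ⟪v, (U ^ k) v⟫_ℂ = 0) :
    ∃ Ω : Fin p → H, (∀ j, ‖Ω j‖ = 1) ∧ (∀ j, U (Ω j) = (rootPhase p j : ℂ) • Ω j) ∧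
      (∀ j, Ω j ∈ Submodule.span ℂ (Set.range fun k : Fin p => (U ^ (k : ℕ)) v)) ∧
      v ∈ Submodule.span ℂ (Set.range Ω) := by
  let Φ : Fin p → H := fun j =>
    ∑ k ∈ Finset.range p, ((rootPhase p j : ℂ) ^ k)⁻¹ • (U ^ k) v
  have hΦv : ∀ j, ⟪v, Φ j⟫_ℂ = 1 := by
    intro j
    rw [inner_sum, Finset.sum_eq_single_of_mem 0 (Finset.mem_range.2 hp) fun k hk hk0 => ?_]
    · simp [hv]
    · rw [inner_smul_right, h0 k (Nat.pos_of_ne_zero hk0) (Finset.mem_range.1 hk), mul_zero]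
  have hΦ0 : ∀ j, ‖Φ j‖ ≠ 0 := fun j hj => by
    have := hΦv j
    rw [norm_eq_zero.1 hj, inner_zero_right] at this
    exact zero_ne_one this
  have hΦU : ∀ j, U (Φ j) = (rootPhase p j : ℂ) • Φ j := by
    intro j
    -- Moving the summation range by one replaces the term k = 0 by the term k = p; both are v,
    -- since U^p v = v and the phase is a p-th root of unity.
    have h1 : ∑ k ∈ Finset.range p, ((rootPhase p j : ℂ) ^ (k + 1))⁻¹ • (U ^ (k + 1)) v = Φ j := by
      have h2 := Finset.sum_range_succ
        (fun k => ((rootPhase p j : ℂ) ^ k)⁻¹ • (U ^ k) v) p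
      rw [Finset.sum_range_succ'] at h2
      refine add_right_cancel (h2.trans ?_)
      rw [hU, ← Circle.coe_pow, rootPhase_pow hp]
      simp [Φ]
    conv_rhs => rw [← h1, Finset.smul_sum]
    simp only [Φ, map_sum]
    refine Finset.sum_congr rfl fun k _ => ?_
    rw [map_smul, smul_smul, pow_succ' U, pow_succ', mul_inv,
      mul_inv_cancel_left₀ (Circle.coe_ne_zero _)]
    rfl
  let Ω : Fin p → H := fun j => ((‖Φ j‖⁻¹ : ℝ) : ℂ) • Φ j
  have hΩ1 : ∀ j, ‖Ω j‖ = 1 := fun j => by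
    rw [norm_smul, Complex.norm_real, norm_inv, norm_norm, inv_mul_cancel₀ (hΦ0 j)]
  have hΩU : ∀ j, U (Ω j) = (rootPhase p j : ℂ) • Ω j := fun j => by
    rw [map_smul, hΦU, smul_comm]
  have hspan : ∀ j, Ω j ∈ Submodule.span ℂ (Set.range fun k : Fin p => (U ^ (k : ℕ)) v) :=
    fun j => Submodule.smul_mem _ _ (Submodule.sum_mem _ fun k hk =>
      Submodule.smul_mem _ _ (Submodule.subset_span ⟨⟨k, Finset.mem_range.1 hk⟩, rfl⟩))
  have hon : Orthonormal ℂ Ω := ⟨hΩ1, fun j l hjl =>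
    inner_eq_zero_of_phase_ne (rootPhase_ne hjl) (U.inner_map_map _ _) (hΩU j) (hΩU l)⟩
  refine ⟨Ω, hΩ1, hΩU, hspan, ?_⟩
  have hfin : FiniteDimensional ℂ
      (Submodule.span ℂ (Set.range fun k : Fin p => (U ^ (k : ℕ)) v)) :=
    FiniteDimensional.span_of_finite ℂ (Set.finite_range _)
  -- A dimension count replaces Fourier inversion: p orthonormal vectors in the span of p vectors
  -- fill it, so v is a combination of the eigenvectors.
  have heq := Submodule.eq_of_le_of_finrank_le (Submodule.span_le.2 (Set.range_subset_iff.2 hspan))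
    (by
      rw [finrank_span_eq_card hon.linearIndependent]
      exact finrank_range_le_card _)
  rw [heq]
  exact Submodule.subset_span ⟨⟨0, hp⟩, by simp⟩

namespace Rep

variable {π ρ : Rep.{u} A} {J : PrimWord A}

/-! ## The unitary `s_J` on the spectral subspace of `J J J ⋯` -/

/-- The restriction of `s_J` to the spectral subspace of `J J J ⋯`. -/
noncomputable def atomShift (π : Rep.{u} A) (J : PrimWord A) :
    π.atom J.inf ≃ₗᵢ[ℂ] π.atom J.inf where
  toFun v := ⟨π.hom (sWord A J.1) v, hom_mem_atom v.2⟩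
  map_add' v w := Subtype.ext (map_add _ _ _)
  map_smul' c v := Subtype.ext (map_smul _ _ _)
  invFun v := ⟨π.hom (star (sWord A J.1)) v, hom_star_mem_atom v.2⟩
  left_inv v := Subtype.ext (hom_star_hom v.2)
  right_inv v := Subtype.ext (hom_hom_star v.2)
  norm_map' v := by
    change ‖π.hom (sWord A J.1) v‖ = ‖(v : π.H)‖
    rw [@norm_eq_sqrt_re_inner ℂ, inner_hom_hom v.2, ← @norm_eq_sqrt_re_inner ℂ]

theorem coe_atomShift (v : π.atom J.inf) :
    (π.atomShift J v : π.H) = π.hom (sWord A J.1) v := rfl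

theorem coe_atomShift_pow (k : ℕ) (v : π.atom J.inf) :
    ((π.atomShift J ^ k) v : π.H) = π.hom (sWord A J.1 ^ k) v := by
  induction k with
  | zero => simp
  | succ k ih =>
    rw [pow_succ', pow_succ', hom_mul_apply, ← ih]
    rfl

theorem coe_atomShift_inv_pow (k : ℕ) (v : π.atom J.inf) :
    (((π.atomShift J)⁻¹ ^ k) v : π.H) = π.hom (star (sWord A J.1 ^ k)) v := by
  have h : (π.atomShift J ^ k) (((π.atomShift J)⁻¹ ^ k) v) = v := by
    rw [← Function.comp_apply (f := ⇑(π.atomShift J ^ k)), ← LinearIsometryEquiv.coe_mul, inv_pow,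
      mul_inv_cancel]
    rfl
  conv_rhs => rw [← h, coe_atomShift_pow]
  rw [hom_star_pow_hom_pow (Subtype.mem _)]

theorem exists_coe_atomShift_zpow (π : Rep.{u} A) (J : PrimWord A) (k : ℤ) :
    ∃ a, ∀ v : π.atom J.inf, ((π.atomShift J ^ k) v : π.H) = π.hom a v := by
  cases k with
  | ofNat n => exact ⟨_, coe_atomShift_pow n⟩
  | negSucc n =>
    refine ⟨star (sWord A J.1 ^ (n + 1)), fun v => ?_⟩
    rw [zpow_negSucc, ← inv_pow]
    exact coe_atomShift_inv_pow (n + 1) v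

theorem atomShift_zpow_add (k l : ℤ) (v : π.atom J.inf) :
    (π.atomShift J ^ (k + l)) v = (π.atomShift J ^ k) ((π.atomShift J ^ l) v) := by
  rw [zpow_add]; rfl

theorem inner_atomShift_zpow (k l : ℤ) (v w : π.atom J.inf) :
    ⟪(π.atomShift J ^ k) v, (π.atomShift J ^ l) w⟫_ℂ = ⟪v, (π.atomShift J ^ (l - k)) w⟫_ℂ := by
  conv_lhs => rw [← add_sub_cancel k l, atomShift_zpow_add]
  exact (π.atomShift J ^ k).inner_map_map _ _

/-! ## Subrepresentations generated by parts of an orbit -/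

/-- An isometric intertwiner whose range is contained in the cyclic subspace generated by `b`. -/
structure IsPart (π : Rep.{u} A) (b : π.H) (ρ : Rep.{u} A) (V : ρ.H →ₗᵢ[ℂ] π.H) : Prop where
  hom_apply : ∀ a u, V (ρ.hom a u) = π.hom a (V u)
  inner_eq_zero : ∀ u, (∀ a, ⟪π.hom a b, u⟫_ℂ = 0) → ∀ t, ⟪V t, u⟫_ℂ = 0

theorem inner_apply_eq_zero {V : ρ.H →ₗᵢ[ℂ] π.H} (hV : ∀ a u, V (ρ.hom a u) = π.hom a (V u))
    {ι : Type*} {w : ι → ρ.H} (hw : ρ.IsTotal w) {u : π.H}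
    (h : ∀ k a, ⟪π.hom a (V (w k)), u⟫_ℂ = 0) (t : ρ.H) : ⟪V t, u⟫_ℂ = 0 := by
  have h0 : ContinuousLinearMap.adjoint V.toContinuousLinearMap u = 0 := hw _ fun k a => by
    rw [ContinuousLinearMap.adjoint_inner_right]
    exact (congrArg (⟪·, u⟫_ℂ) (hV a (w k))).trans (h k a)
  have := ContinuousLinearMap.adjoint_inner_right V.toContinuousLinearMap t u
  rw [h0, inner_zero_right] at this
  exact this.symm

theorem isPart_of_total {V : ρ.H →ₗᵢ[ℂ] π.H} (hV : ∀ a u, V (ρ.hom a u) = π.hom a (V u))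
    {ι : Type*} {w : ι → ρ.H} (hw : ρ.IsTotal w) {b : π.H} (h : ∀ k, ∃ a, V (w k) = π.hom a b) :
    π.IsPart b ρ V := by
  refine ⟨hV, fun u hu => inner_apply_eq_zero hV hw fun k a => ?_⟩
  obtain ⟨a', ha'⟩ := h k
  rw [ha', ← hom_mul_apply, hu]

theorem IsPart.inner_apply_eq_zero {σ : Rep.{u} A} {b b' : π.H} {V : ρ.H →ₗᵢ[ℂ] π.H}
    {V' : σ.H →ₗᵢ[ℂ] π.H} (h : π.IsPart b ρ V) (h' : π.IsPart b' σ V')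
    (hbb : ∀ a, ⟪b, π.hom a b'⟫_ℂ = 0) (t : ρ.H) (t' : σ.H) : ⟪V t, V' t'⟫_ℂ = 0 := by
  refine h.inner_eq_zero _ (fun a => ?_) t
  rw [← inner_conj_symm, h'.inner_eq_zero _ (fun a' => ?_) t', map_zero]
  rw [← inner_conj_symm, inner_hom_hom_eq_zero hbb, map_zero]

end Rep

end CuntzKrieger

namespace CuntzKrieger

variable {N : ℕ} {A : Matrix (Fin N) (Fin N) ℕ}

namespace Rep

variable {π : Rep.{u} A}

/-! ## The coding map of a permutative representation -/

theorem exists_star_gen_ne_zero {v : π.H} (hv : v ≠ 0) : ∃ i, π.hom (star (gen A i)) v ≠ 0 := by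
  by_contra! h
  apply hv
  have h1 := congrArg (fun a => π.hom a v) (isCKFamily_gen.{u} A).sum_mul_star
  simp only [map_sum, hom_one_apply] at h1
  rw [← h1, sum_apply]
  exact Finset.sum_eq_zero fun i _ => by rw [hom_mul_apply, h, map_zero]

/-- Every vector of the basis `e` is obtained from another one by applying a generator. -/
def IsCoding (π : Rep.{u} A) {Λ : Type u} (e : HilbertBasis Λ ℂ π.H) (c : Λ → Fin N)
    (F : Λ → Λ) : Prop :=
  ∀ n, π.hom (gen A (c n)) (e (F n)) = e n ∧ π.hom (star (gen A (c n))) (e n) = e (F n)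

/-- As ∑ s_i s_i^* = 1, some s_i^* e_n is nonzero, so some s_i e_{n'} is not orthogonal to e_n.
Since s_i maps basis vectors to basis vectors or 0, this forces s_i e_{n'} = e_n, and the norm
criterion gives s_i^* e_n = e_{n'}. -/
theorem IsPermutative.exists_coding (h : π.IsPermutative) :
    ∃ (Λ : Type u) (e : HilbertBasis Λ ℂ π.H) (c : Λ → Fin N) (F : Λ → Λ),
      π.IsCoding e c F := by
  classical
  obtain ⟨Λ, e, D, m, hm⟩ := h
  have key : ∀ n, ∃ i n', π.hom (gen A i) (e n') = e n ∧ π.hom (star (gen A i)) (e n) = e n' := by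
    intro n
    obtain ⟨i, hi⟩ := exists_star_gen_ne_zero (e.orthonormal.ne_zero n)
    obtain ⟨n', hn'⟩ : ∃ n', ⟪e n', π.hom (star (gen A i)) (e n)⟫_ℂ ≠ 0 := by
      by_contra! h0
      refine hi (e.repr.injective ?_)
      ext k
      rw [e.repr_apply_apply, h0]
      simp
    rw [inner_hom_right, star_star] at hn'
    have hD : n' ∈ D i := by
      by_contra hD
      rw [(hm i n').2 hD, inner_zero_left] at hn'
      exact hn' rfl
    rw [(hm i n').1 hD, orthonormal_iff_ite.1 e.orthonormal] at hn'
    have hmn : m i n' = n := by simpa using hn'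
    have h1 : π.hom (gen A i) (e n') = e n := by rw [(hm i n').1 hD, hmn]
    refine ⟨i, n', h1, ?_⟩
    rw [← h1]
    refine norm_apply_apply_eq (T := π.hom (star (gen A i))) (S := π.hom (gen A i))
      (fun w => ?_) (fun w => ?_) ?_
    · simpa [sWord_singleton] using π.norm_hom_star_sWord_le [i] w
    · rw [inner_hom_left, star_star]
    · rw [h1, e.orthonormal.1, e.orthonormal.1]
  choose c F hcF using key
  exact ⟨Λ, e, c, F, hcF⟩

section Coding

variable {Λ : Type u} {e : HilbertBasis Λ ℂ π.H} {c : Λ → Fin N} {F : Λ → Λ}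

/-- The itinerary of `n` under `F`. -/
def itinerary (c : Λ → Fin N) (F : Λ → Λ) (n : Λ) : ℕ → Fin N := fun k => c (F^[k] n)

theorem shift_itinerary (n : Λ) : shift (itinerary c F n) = itinerary c F (F n) := rfl

theorem iterate_shift_itinerary (k : ℕ) (n : Λ) :
    shift^[k] (itinerary c F n) = itinerary c F (F^[k] n) := by
  induction k generalizing n with
  | zero => rfl
  | succ k ih => rw [Function.iterate_succ_apply, Function.iterate_succ_apply, ← ih]; rfl

theorem hom_star_pre_itinerary (hF : π.IsCoding e c F) (k : ℕ) (n : Λ) :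
    π.hom (star (sWord A (pre (itinerary c F n) k))) (e n) = e (F^[k] n) := by
  induction k generalizing n with
  | zero => simp
  | succ k ih =>
    rw [pre_succ, hom_star_sWord_cons, shift_itinerary, Function.iterate_succ_apply, ← ih]
    exact congrArg _ (hF n).2

theorem mem_atom_itinerary (hF : π.IsCoding e c F) (n : Λ) : e n ∈ π.atom (itinerary c F n) :=
  mem_atom_iff_norm.2 fun k => by
    rw [hom_star_pre_itinerary hF, e.orthonormal.1, e.orthonormal.1]

/-- Stripping m and n letters replaces the vectors by e_{F^m a} and e_{F^n b}, which are distinct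
members of an orthonormal basis. Different grand orbits therefore generate orthogonal subspaces. -/
theorem inner_hom_basis_eq_zero (hF : π.IsCoding e c F) {a b : Λ}
    (h : ∀ m n, F^[m] a ≠ F^[n] b) (x : OA.{u} A) :
    ⟪e a, π.hom x (e b)⟫_ℂ = 0 :=
  inner_hom_eq_zero_of_tails (mem_atom_itinerary hF a) (mem_atom_itinerary hF b)
    (fun m n _ => by
      rw [hom_star_pre_itinerary hF, hom_star_pre_itinerary hF, e.orthonormal.2 (h m n)]) x

theorem exists_hom_basis_eq (hF : π.IsCoding e c F) {a b : Λ} {m n : ℕ}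
    (h : F^[m] a = F^[n] b) :
    ∃ x, e a = π.hom x (e b) := by
  refine ⟨sWord A (pre (itinerary c F a) m) * star (sWord A (pre (itinerary c F b) n)), ?_⟩
  rw [hom_mul_apply, hom_star_pre_itinerary hF, ← h, ← hom_star_pre_itinerary hF]
  exact (mem_atom_itinerary hF a m).symm

variable {J : PrimWord A} {b : Λ}

theorem mem_atom_inf (hF : π.IsCoding e c F) (hb : itinerary c F b = J.inf) :
    e b ∈ π.atom J.inf :=
  hb ▸ mem_atom_itinerary hF b

theorem atomShift_inv_pow_basis (hF : π.IsCoding e c F) (hb : itinerary c F b = J.inf) (k : ℕ) :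
    (((π.atomShift J)⁻¹ ^ k) ⟨e b, mem_atom_inf hF hb⟩ : π.H) =
      e ((F^[J.1.length])^[k] b) := by
  have h1 := hom_star_pre_itinerary hF (J.1.length * k) b
  rw [hb, J.sWord_pre_mul, Function.iterate_mul] at h1
  rw [coe_atomShift_inv_pow, h1]

theorem inner_atomShift_pow_basis (hF : π.IsCoding e c F) (hb : itinerary c F b = J.inf)
    {k : ℕ} (hk : (F^[J.1.length])^[k] b ≠ b) :
    ⟪(⟨e b, mem_atom_inf hF hb⟩ : π.atom J.inf),
      (π.atomShift J ^ k) ⟨e b, mem_atom_inf hF hb⟩⟫_ℂ = 0 := by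
  set v : π.atom J.inf := ⟨e b, mem_atom_inf hF hb⟩ with hv
  have h1 := inner_atomShift_zpow (-k : ℤ) 0 v v
  rw [zero_sub, neg_neg, zpow_natCast, zpow_zero, zpow_neg, zpow_natCast, ← inv_pow] at h1
  rw [← h1, Submodule.coe_inner, atomShift_inv_pow_basis hF hb]
  exact e.orthonormal.2 hk

/-- The subrepresentations `P(J; e^{2πij/p})` generated by a basis vector of period `p`. -/
theorem exists_cyclic_parts (hF : π.IsCoding e c F) (hb : itinerary c F b = J.inf)
    (hp : 0 < Function.minimalPeriod F^[J.1.length] b) :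
    ∃ (ρ : Fin (Function.minimalPeriod F^[J.1.length] b) → Rep.{u} A)
      (V : ∀ j, (ρ j).H →ₗᵢ[ℂ] π.H),
      (∀ j, (ρ j).IsP J.1 (rootPhase (Function.minimalPeriod F^[J.1.length] b) j)) ∧
      (∀ j, π.IsPart (e b) (ρ j) (V j)) ∧
      (∀ j j', j ≠ j' → ∀ t t', ⟪V j t, V j' t'⟫_ℂ = 0) ∧
      ∀ u, (∀ j t, ⟪V j t, u⟫_ℂ = 0) → ∀ a, ⟪π.hom a (e b), u⟫_ℂ = 0 := by
  set p := Function.minimalPeriod F^[J.1.length] b with hpdef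
  set v : π.atom J.inf := ⟨e b, mem_atom_inf hF hb⟩ with hv
  -- The inverse of s_J acts on e_b as F^|J| does on b, so a point of period p is fixed by the p-th
  -- power.
  have hU : (π.atomShift J ^ p) v = v := by
    have h1 : ((π.atomShift J)⁻¹ ^ p) v = v := by
      refine Subtype.ext ?_
      rw [hv, atomShift_inv_pow_basis hF hb, hpdef, Function.iterate_minimalPeriod]
    conv_lhs => rw [← h1]
    rw [← Function.comp_apply (f := ⇑(π.atomShift J ^ p)), ← LinearIsometryEquiv.coe_mul, inv_pow,
      mul_inv_cancel]
    rfl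
  obtain ⟨Ω, h1, h2, h3, h4⟩ := exists_eigenvectors_of_cyclic (π.atomShift J) hp
    (v := v) (e.orthonormal.1 b) hU fun k h0 hk =>
      inner_atomShift_pow_basis hF hb fun h =>
        Function.not_isPeriodicPt_of_pos_of_lt_minimalPeriod h0.ne' hk h
  have h2' : ∀ j, π.hom (sWord A J.1) (Ω j) = (rootPhase p j : ℂ) • (Ω j : π.H) := fun j =>
    congrArg Subtype.val (h2 j)
  -- The eigenvectors are finite combinations of the s_J^k e_b, so they equal π(a) e_b for some a,
  -- with no closure needed.
  have h3' : ∀ j, ∃ a, (Ω j : π.H) = π.hom a (e b) := by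
    intro j
    suffices ∀ w ∈ Submodule.span ℂ (Set.range fun k : Fin p => (π.atomShift J ^ (k : ℕ)) v),
        (w : π.H) ∈ LinearMap.range (π.orbitMap (e b)) by
      obtain ⟨a, ha⟩ := this _ (h3 j)
      exact ⟨a, ha.symm⟩
    intro w hw
    have : Submodule.span ℂ (Set.range fun k : Fin p => (π.atomShift J ^ (k : ℕ)) v) ≤
        (LinearMap.range (π.orbitMap (e b))).comap (π.atom J.inf).subtype := by
      rw [Submodule.span_le]
      rintro _ ⟨k, rfl⟩
      exact ⟨sWord A J.1 ^ (k : ℕ), (coe_atomShift_pow (k : ℕ) v).symm⟩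
    exact this hw
  choose ρ V w hV hw ht using fun j => exists_subrep (π := π) fun _ : Unit => (Ω j : π.H)
  have hw1 : ∀ j, ‖w j ()‖ = 1 := fun j => by
    rw [← (V j).norm_map, hw j]; exact h1 j
  refine ⟨ρ, V, fun j => ?_, fun j => ?_, fun j j' hjj t t' => ?_, fun u hu a => ?_⟩
  · refine isP_of_mem_atom (isCyclicUnit_of_isTotal (hw1 j) (ht j)) ((V j).injective ?_)
    rw [hV, hw, h2', map_smul, hw]
  · refine isPart_of_total (hV j) (ht j) fun k => ?_
    rw [hw]; exact h3' j
  · refine (isPart_of_total (hV j) (ht j) (b := (Ω j : π.H)) fun k =>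
      ⟨1, by rw [hw, hom_one_apply]⟩).inner_apply_eq_zero
      (isPart_of_total (hV j') (ht j') (b := (Ω j' : π.H)) fun k =>
      ⟨1, by rw [hw, hom_one_apply]⟩) (fun a => ?_) t t'
    have h0 : ⟪(Ω j : π.H), (Ω j' : π.H)⟫_ℂ = 0 :=
      inner_eq_zero_of_phase_ne (rootPhase_ne hjj) (inner_hom_hom (Ω j).2) (h2' j) (h2' j')
    refine inner_hom_eq_zero_of_periodic (Ω j).2 (Ω j').2 (fun r => ?_) (fun r => ?_) a
    · rw [hom_pow_eigen (h2' j), inner_smul_left, h0, mul_zero]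
    · rw [hom_pow_eigen (h2' j'), inner_smul_right, h0, mul_zero]
  · have : ∀ x ∈ Submodule.span ℂ (Set.range Ω), ⟪π.hom a (x : π.H), u⟫_ℂ = 0 := by
      intro x hx
      induction hx using Submodule.span_induction with
      | mem x hx =>
        obtain ⟨j, rfl⟩ := hx
        have := hu j ((ρ j).hom a (w j ()))
        rwa [hV, hw] at this
      | zero => simp
      | add x y _ _ hx hy =>
        rw [Submodule.coe_add, map_add, inner_add_left, hx, hy, add_zero]
      | smul r x _ hx => rw [Submodule.coe_smul, map_smul, inner_smul_left, hx, mul_zero]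
    exact this v h4

/-- The direct integral generated by a basis vector which is not periodic. -/
theorem exists_integral_part (hA : IsAdmissible A) (hF : π.IsCoding e c F) 
    (hb : itinerary c F b = J.inf)
    (hp : Function.minimalPeriod F^[J.1.length] b = 0) :
    ∃ (σ : Rep.{u} A) (ρ : UnitAddCircle → Rep.{u} A) (V : σ.H →ₗᵢ[ℂ] π.H),
      (∀ t, (ρ t).IsP J.1 (AddCircle.toCircle t)) ∧
      σ.IsDirectIntegral AddCircle.haarAddCircle ρ ∧ π.IsPart (e b) σ V ∧
      ∀ u, (∀ t, ⟪V t, u⟫_ℂ = 0) → ∀ a, ⟪π.hom a (e b), u⟫_ℂ = 0 := by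
  obtain ⟨σ, ρ, hρ, hσ⟩ := exists_isDirectIntegral.{u} hA J
  obtain ⟨w, hw⟩ := hσ.exists_isShift hρ
  set v : π.atom J.inf := ⟨e b, mem_atom_inf hF hb⟩ with hv
  have hv1 : ‖v‖ = 1 := e.orthonormal.1 b
  -- Minimal period 0 encodes that no positive iterate of F^|J| returns to b; this makes the
  -- two-sided orbit of s_J orthonormal.
  have hpos : ∀ k : ℕ, 0 < k → ⟪v, (π.atomShift J ^ k) v⟫_ℂ = 0 := fun k hk =>
    inner_atomShift_pow_basis hF hb fun h => by
      have := Function.IsPeriodicPt.minimalPeriod_pos hk h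
      omega
  have ho : Orthonormal ℂ fun k : ℤ => (((π.atomShift J ^ k) v : π.atom J.inf) : π.H) := by
    refine Orthonormal.comp_linearIsometry (v := fun k : ℤ => (π.atomShift J ^ k) v) ⟨fun k => ?_,
      fun k l hkl => ?_⟩ (π.atom J.inf).subtypeₗᵢ
    · rw [LinearIsometryEquiv.norm_map, hv1]
    · change ⟪(π.atomShift J ^ k) v, (π.atomShift J ^ l) v⟫_ℂ = 0
      rw [inner_atomShift_zpow]
      rcases lt_or_gt_of_ne hkl with h | h
      · obtain ⟨n, hn⟩ := Int.eq_ofNat_of_zero_le (sub_pos.2 h).le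
        rw [hn, zpow_natCast]
        exact hpos n (by omega)
      · obtain ⟨n, hn⟩ := Int.eq_ofNat_of_zero_le (sub_pos.2 h).le
        have h2 := inner_atomShift_zpow (l - k) 0 v v
        rw [zero_sub, neg_sub, hn, zpow_natCast, hpos n (by omega), zpow_zero] at h2
        have h3 : ⟪(π.atomShift J ^ (l - k)) v, v⟫_ℂ = 0 := h2
        rw [← inner_conj_symm, h3, map_zero]
  have hshift : ∀ k : ℤ, π.hom (sWord A J.1) (((π.atomShift J ^ k) v : π.atom J.inf) : π.H) =
      (((π.atomShift J ^ (k + 1)) v : π.atom J.inf) : π.H) := fun k => by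
    rw [← coe_atomShift, add_comm, atomShift_zpow_add, zpow_one]
  -- The abstractly built integral and the orbit of e_b are both bilateral shifts, so the integral
  -- embeds onto what e_b generates.
  obtain ⟨V, hV, hVw⟩ := exists_intertwiner hw.total (inner_hom_eq_of_shift hw.mem hw.hom_apply
    hw.orthonormal (fun k => Subtype.mem ((π.atomShift J ^ k) v)) hshift ho)
  refine ⟨σ, ρ, V, hρ, hσ, isPart_of_total hV hw.total fun k => ?_, fun u hu a => ?_⟩
  · obtain ⟨a, ha⟩ := exists_coe_atomShift_zpow π J k
    exact ⟨a, (hVw k).trans (ha v)⟩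
  · have := hu (σ.hom a (w 0))
    rw [hV, hVw] at this
    simpa using this

end Coding

/-- The subrepresentation `P(K)` generated by a vector in a spectral subspace. -/
theorem exists_aperiodic_part {K : AperiodicInfWord A} {b : π.H} (hb1 : ‖b‖ = 1)
    (hb : b ∈ π.atom K.1) :
    ∃ (ρ : Rep.{u} A) (V : ρ.H →ₗᵢ[ℂ] π.H), ρ.IsPClass (Quotient.mk (tailSetoid A) K) ∧
      π.IsPart b ρ V ∧ ∀ u, (∀ t, ⟪V t, u⟫_ℂ = 0) → ∀ a, ⟪π.hom a b, u⟫_ℂ = 0 := by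
  obtain ⟨ρ, V, w, hV, hw, ht⟩ := exists_subrep (π := π) fun _ : Unit => b
  refine ⟨ρ, V, ⟨K, rfl, isPInf_of_mem_atom K.2.2 (isCyclicUnit_of_isTotal (Ω := w ()) ?_ ht)
    (mem_atom_of_apply hV ?_)⟩, isPart_of_total hV ht fun k => ⟨1, ?_⟩, fun u hu a => ?_⟩
  · rw [← V.norm_map, hw, hb1]
  · rwa [hw]
  · rw [hw, hom_one_apply]
  · have := hu (ρ.hom a (w ()))
    rwa [hV, hw] at this

end Rep

end CuntzKrieger

namespace CuntzKrieger

variable {N : ℕ} {A : Matrix (Fin N) (Fin N) ℕ}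

/-! ## Existence of the decomposition -/

namespace Rep

variable {π : Rep.{u} A}

/-- The map `q` records the orbit that produced a summand. Orthogonality comes from `hsame` within
an orbit and from `hdis` between orbits. -/
theorem isDirectSum_of_parts {ι : Type u} {ρ : ι → Rep.{u} A} (V : ∀ i, (ρ i).H →ₗᵢ[ℂ] π.H)
    {Q : Type*} {b : Q → π.H} (q : ι → Q) (hpart : ∀ i, π.IsPart (b (q i)) (ρ i) (V i))
    (hdis : ∀ k l, k ≠ l → ∀ a, ⟪b k, π.hom a (b l)⟫_ℂ = 0)
    (hsame : ∀ i j, i ≠ j → q i = q j → ∀ t t', ⟪V i t, V j t'⟫_ℂ = 0) (htot : π.IsTotal b)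
    (hgen : ∀ k u, (∀ i, q i = k → ∀ t, ⟪V i t, u⟫_ℂ = 0) → ∀ a, ⟪π.hom a (b k), u⟫_ℂ = 0) :
    π.IsDirectSum ρ := by
  refine ⟨V, IsHilbertSum.mk (fun i j hij t t' => ?_) ?_, fun i => (hpart i).hom_apply⟩
  · by_cases h : q i = q j
    · exact hsame i j hij h t t'
    · exact (hpart i).inner_apply_eq_zero (hpart j) (hdis _ _ h) t t'
  · rw [top_le_iff, Submodule.topologicalClosure_eq_top_iff, Submodule.eq_bot_iff]
    intro u hu
    refine htot u fun k a => hgen k u (fun i _ t => ?_) a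
    exact hu _ (Submodule.mem_iSup_of_mem i ⟨t, rfl⟩)

/-- Points with a common forward iterate. -/
def grandOrbit {Λ : Type*} (F : Λ → Λ) : Setoid Λ where
  r a b := ∃ m n, F^[m] a = F^[n] b
  iseqv :=
    { refl := fun _ => ⟨0, 0, rfl⟩
      symm := fun ⟨m, n, h⟩ => ⟨n, m, h.symm⟩
      trans := by
        rintro a b d ⟨m, n, h⟩ ⟨p, q, h'⟩
        refine ⟨p + m, n + q, ?_⟩
        rw [Function.iterate_add_apply, h, ← Function.iterate_add_apply, add_comm,
          Function.iterate_add_apply, h', ← Function.iterate_add_apply] }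

/-- Every grand orbit contains a point whose itinerary is either purely periodic or not eventually
periodic. -/
theorem IsCoding.exists_label (hA : IsAdmissible A) {Λ : Type u} {e : HilbertBasis Λ ℂ π.H}
    {c : Λ → Fin N} {F : Λ → Λ} (hF : π.IsCoding e c F) (q : Quotient (grandOrbit F)) :
    ∃ (l : (PrimWord A × ℕ) ⊕ TailClass A) (b : Λ), Quotient.mk _ b = q ∧
      (∀ J p, l = Sum.inl (J, p) →
        itinerary c F b = J.inf ∧ Function.minimalPeriod F^[J.1.length] b = p) ∧
      ∀ κ, l = Sum.inr κ →
        ∃ K, Quotient.mk (tailSetoid A) K = κ ∧ itinerary c F b = K.1 := by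
  obtain ⟨a, rfl⟩ := Quotient.exists_rep q
  have hinf : IsInfWord A (itinerary c F a) :=
    isInfWord_of_mem_atom hA (mem_atom_itinerary hF a) (e.orthonormal.ne_zero a)
  by_cases h : IsEventuallyPeriodic (itinerary c F a)
  · obtain ⟨J, m, hm⟩ := PrimWord.exists_iterate_shift_eq_inf hinf h
    rw [iterate_shift_itinerary] at hm
    refine ⟨Sum.inl (J, Function.minimalPeriod F^[J.1.length] (F^[m] a)), F^[m] a,
      Quotient.sound ⟨0, m, rfl⟩, fun J' p h => ?_, fun κ h => by simp at h⟩
    obtain ⟨rfl, rfl⟩ := Prod.mk.inj (Sum.inl.inj h)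
    exact ⟨hm, rfl⟩
  · exact ⟨Sum.inr (Quotient.mk _ ⟨_, hinf, h⟩), a, rfl, fun J p h => by simp at h,
      fun κ hκ => ⟨⟨_, hinf, h⟩, Sum.inr.inj hκ, rfl⟩⟩

/-- One representative is chosen in each grand orbit, and the multiplicities count the orbits with a
given label. A label (J, p) with p > 0 produces a cyclic sum, (J, 0) an integral, and κ a copy of
P(κ). -/
theorem IsPermutative.nonempty_decomposition (hA : IsAdmissible A) (h : π.IsPermutative) :
    Nonempty (Decomposition π) := by
  obtain ⟨Λ, e, c, F, hF⟩ := h.exists_coding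
  choose lab b hb hper hap using hF.exists_label hA
  have hdis : ∀ q q', q ≠ q' → ∀ a, ⟪e (b q), π.hom a (e (b q'))⟫_ℂ = 0 := by
    refine fun q q' hq => inner_hom_basis_eq_zero hF fun m n hmn => hq ?_
    rw [← hb q, ← hb q']
    exact Quotient.sound ⟨m, n, hmn⟩
  have htot : π.IsTotal fun q => e (b q) := by
    intro u hu
    refine e.repr.injective ?_
    ext n
    obtain ⟨m, k, hmk⟩ := Quotient.exact (hb (Quotient.mk _ n)).symm
    obtain ⟨a, ha⟩ := exists_hom_basis_eq hF hmk
    rw [e.repr_apply_apply, ha, hu, map_zero]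
    rfl
  have hC : ∀ (J : PrimWord A) (p : ℕ+) (q : {q // lab q = Sum.inl (J, (p : ℕ))}),
      ∃ (ρ : Fin p → Rep.{u} A) (V : ∀ j, (ρ j).H →ₗᵢ[ℂ] π.H),
        (∀ j, (ρ j).IsP J.1 (rootPhase p j)) ∧ (∀ j, π.IsPart (e (b q)) (ρ j) (V j)) ∧
        (∀ j j', j ≠ j' → ∀ t t', ⟪V j t, V j' t'⟫_ℂ = 0) ∧
        ∀ u, (∀ j t, ⟪V j t, u⟫_ℂ = 0) → ∀ a, ⟪π.hom a (e (b q)), u⟫_ℂ = 0 := by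
    intro J p q
    obtain ⟨h1, h2⟩ := hper q J p q.2
    have := exists_cyclic_parts hF h1 (by rw [h2]; exact p.pos)
    rwa [h2] at this
  have hI : ∀ (J : PrimWord A) (q : {q // lab q = Sum.inl (J, 0)}), _ := fun J q =>
    exists_integral_part hA hF (hper q J 0 q.2).1 (hper q J 0 q.2).2
  have hK : ∀ (κ : TailClass A) (q : {q // lab q = Sum.inr κ}),
      ∃ (ρ : Rep.{u} A) (V : ρ.H →ₗᵢ[ℂ] π.H), ρ.IsPClass κ ∧ π.IsPart (e (b q)) ρ V ∧
        ∀ u, (∀ t, ⟪V t, u⟫_ℂ = 0) → ∀ a, ⟪π.hom a (e (b q)), u⟫_ℂ = 0 := by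
    intro κ q
    obtain ⟨K, hK, hbK⟩ := hap q κ q.2
    have := exists_aperiodic_part (K := K) (e.orthonormal.1 (b q))
      (hbK ▸ mem_atom_itinerary hF (b q))
    rwa [hK] at this
  choose ρc Vc hc1 hc2 hc3 hc4 using hC
  choose ρi τ Vi hi1 hi2 hi3 hi4 using hI
  choose ρk Vk hk1 hk2 hk3 using hK
  let mC : PrimWord A → ℕ+ → Cardinal.{u} := fun J p =>
    Cardinal.mk {q // lab q = Sum.inl (J, (p : ℕ))}
  let mI : PrimWord A → Cardinal.{u} := fun J => Cardinal.mk {q // lab q = Sum.inl (J, 0)}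
  let mK : TailClass A → Cardinal.{u} := fun κ => Cardinal.mk {q // lab q = Sum.inr κ}
  let ιc := Σ (J : PrimWord A) (p : ℕ+), (mC J p).out × Fin p
  let ιi := Σ J : PrimWord A, (mI J).out
  let ιk := Σ κ : TailClass A, (mK κ).out
  let gc : ∀ J p, (mC J p).out ≃ {q // lab q = Sum.inl (J, (p : ℕ))} :=
    fun J p => Cardinal.outMkEquiv
  let gi : ∀ J, (mI J).out ≃ {q // lab q = Sum.inl (J, 0)} := fun J => Cardinal.outMkEquiv
  let gk : ∀ κ, (mK κ).out ≃ {q // lab q = Sum.inr κ} := fun κ => Cardinal.outMkEquiv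
  let cyc : ιc → Rep.{u} A := fun i => ρc i.1 i.2.1 (gc _ _ i.2.2.1) i.2.2.2
  let int : ιi → Rep.{u} A := fun i => ρi i.1 (gi _ i.2)
  let inf : ιk → Rep.{u} A := fun i => ρk i.1 (gk _ i.2)
  let V : ∀ i : ιc ⊕ (ιi ⊕ ιk), (Sum.elim cyc (Sum.elim int inf) i).H →ₗᵢ[ℂ] π.H := fun i =>
    match i with
    | .inl i => Vc i.1 i.2.1 (gc _ _ i.2.2.1) i.2.2.2
    | .inr (.inl i) => Vi i.1 (gi _ i.2)
    | .inr (.inr i) => Vk i.1 (gk _ i.2)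
  let Q : ιc ⊕ (ιi ⊕ ιk) → Quotient (grandOrbit F) := fun i =>
    match i with
    | .inl i => (gc _ _ i.2.2.1).1
    | .inr (.inl i) => (gi _ i.2).1
    | .inr (.inr i) => (gk _ i.2).1
  have hlab : ∀ i, lab (Q i) = match i with
      | .inl i => Sum.inl (i.1, (i.2.1 : ℕ))
      | .inr (.inl i) => Sum.inl (i.1, 0)
      | .inr (.inr i) => Sum.inr i.1 := by
    rintro (i | i | i)
    · exact (gc _ _ i.2.2.1).2
    · exact (gi _ i.2).2
    · exact (gk _ i.2).2
  refine ⟨⟨mC, mI, mK, cyc, int, fun i => τ i.1 (gi _ i.2), inf, fun i => hc1 _ _ _ _,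
    fun i => hi1 _ _, fun i => hi2 _ _, fun i => hk1 _ _,
    isDirectSum_of_parts (b := fun q => e (b q)) V Q ?_ hdis ?_ htot ?_⟩⟩
  · rintro (i | i | i)
    · exact hc2 _ _ _ _
    · exact hi3 _ _
    · exact hk2 _ _
  · intro i j hij hQ
    -- Summands from one orbit have equal labels, which excludes the mixed cases; cyclic sums and
    -- integrals are separated by p ≠ 0. Only different phases of the same cycle remain.
    have hl := congrArg lab hQ
    rw [hlab, hlab] at hl
    rcases i with ⟨J, p, o, k⟩ | ⟨J, o⟩ | ⟨κ, o⟩ <;>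
    rcases j with ⟨J', p', o', k'⟩ | ⟨J', o'⟩ | ⟨κ', o'⟩
    · obtain ⟨rfl, hp⟩ := Prod.mk.inj (Sum.inl.inj hl)
      obtain rfl := PNat.coe_injective hp
      obtain rfl := (gc J p).injective (Subtype.ext hQ)
      exact hc3 _ _ _ _ _ fun h => hij (congrArg
        (fun x => (Sum.inl ⟨J, p, o, x⟩ : ιc ⊕ (ιi ⊕ ιk))) h)
    · exact absurd (Prod.mk.inj (Sum.inl.inj hl)).2 p.ne_zero
    · exact nomatch hl
    · exact absurd (Prod.mk.inj (Sum.inl.inj hl)).2.symm p'.ne_zero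
    · obtain ⟨rfl, -⟩ := Prod.mk.inj (Sum.inl.inj hl)
      obtain rfl := (gi J).injective (Subtype.ext hQ)
      exact absurd rfl hij
    · exact nomatch hl
    · exact nomatch hl
    · exact nomatch hl
    · obtain rfl := Sum.inr.inj hl
      obtain rfl := (gk κ).injective (Subtype.ext hQ)
      exact absurd rfl hij
  · intro q u hu
    rcases hq : lab q with ⟨J, p⟩ | κ
    · rcases Nat.eq_zero_or_pos p with rfl | hp
      · obtain ⟨o, ho⟩ := (gi J).surjective ⟨q, hq⟩
        have := hi4 J (gi J o) u fun t => hu (.inr (.inl ⟨J, o⟩)) (congrArg Subtype.val ho) t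
        rwa [ho] at this
      · obtain ⟨o, ho⟩ := (gc J ⟨p, hp⟩).surjective ⟨q, hq⟩
        have := hc4 J ⟨p, hp⟩ (gc J ⟨p, hp⟩ o) u fun j t =>
          hu (.inl ⟨J, ⟨p, hp⟩, o, j⟩) (congrArg Subtype.val ho) t
        rwa [ho] at this
    · obtain ⟨o, ho⟩ := (gk κ).surjective ⟨q, hq⟩
      have := hk3 κ (gk κ o) u fun t => hu (.inr (.inr ⟨κ, o⟩)) (congrArg Subtype.val ho) t
      rwa [ho] at this

end Rep

end CuntzKrieger

namespace CuntzKrieger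

/-! ## Counting orthonormal systems -/

section Counting

open Cardinal

theorem countable_inner_ne_zero {E : Type*} [NormedAddCommGroup E] [InnerProductSpace ℂ E]
    {ι : Type*} {f : ι → E} (hf : Orthonormal ℂ f) (x : E) : {i | ⟪x, f i⟫_ℂ ≠ 0}.Countable := by
  refine (hf.inner_products_summable x).countable_support.mono fun i hi => ?_
  rw [Function.mem_support]
  have : ⟪f i, x⟫_ℂ ≠ 0 := fun h => hi (by rw [← inner_conj_symm, h, map_zero])
  positivity

variable {E : Type*} [NormedAddCommGroup E] [InnerProductSpace ℂ E] [CompleteSpace E]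
  {W : Submodule ℂ E}

/-- Parseval's identity for an orthonormal system which is complete in a closed subspace. -/
theorem hasSum_norm_inner_sq (hW : IsClosed (W : Set E)) {κ : Type*} {g : κ → E}
    (hg : Orthonormal ℂ g) (hgW : ∀ k, g k ∈ W) (hgt : ∀ u ∈ W, (∀ k, ⟪g k, u⟫_ℂ = 0) → u = 0)
    {x : E} (hx : x ∈ W) : HasSum (fun k => ‖⟪g k, x⟫_ℂ‖ ^ 2) (‖x‖ ^ 2) := by
  have : CompleteSpace W := hW.completeSpace_coe
  have hg' : Orthonormal ℂ fun k => (⟨g k, hgW k⟩ : W) := ⟨hg.1, fun i j hij => hg.2 hij⟩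
  let b := HilbertBasis.mkOfOrthogonalEqBot hg' (by
    rw [Submodule.eq_bot_iff]
    intro u hu
    exact Subtype.ext (hgt u u.2 fun k => hu _ (Submodule.subset_span ⟨k, rfl⟩)))
  have hb : ∀ k, ((b k : W) : E) = g k := fun k => by
    simp [b]
  have h1 := b.hasSum_inner_mul_inner ⟨x, hx⟩ ⟨x, hx⟩
  have h2 : ∀ k, ⟪(⟨x, hx⟩ : W), b k⟫_ℂ * ⟪b k, (⟨x, hx⟩ : W)⟫_ℂ =
      ((‖⟪g k, x⟫_ℂ‖ ^ 2 : ℝ) : ℂ) := fun k => by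
    rw [← inner_conj_symm, ← Complex.normSq_eq_conj_mul_self, Complex.normSq_eq_norm_sq,
      Submodule.coe_inner, hb]
  simp only [h2] at h1
  rw [inner_self_eq_norm_sq_to_K] at h1
  have h3 : ((‖(⟨x, hx⟩ : W)‖ : ℂ) ^ 2) = ((‖x‖ ^ 2 : ℝ) : ℂ) := by push_cast; rfl
  exact Complex.hasSum_ofReal.1 (h3 ▸ h1)

/-- If the translates of `f` and `g` under a countable group are orthonormal systems and those of
`g` are complete, then there are at most as many `f`'s as `g`'s. For the trivial group this is the
invariance of the Hilbert space dimension, for `ℤ` that of the dimension of wandering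
subspaces. -/
theorem mk_le_of_orthonormal (hW : IsClosed (W : Set E)) {ι κ : Type u} {G : Type}
    [AddGroup G] [Countable G] {f : ι → G → E} {g : κ → G → E}
    (hf : Orthonormal ℂ fun p : ι × G => f p.1 p.2)
    (hg : Orthonormal ℂ fun p : κ × G => g p.1 p.2) (hfW : ∀ i n, f i n ∈ W)
    (hgW : ∀ k n, g k n ∈ W) (hgt : ∀ u ∈ W, (∀ k n, ⟪g k n, u⟫_ℂ = 0) → u = 0)
    (h : ∀ i k n, ‖⟪g k n, f i 0⟫_ℂ‖ = ‖⟪g k 0, f i (-n)⟫_ℂ‖) : #ι ≤ #κ := by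
  classical
  have hpar : ∀ i, HasSum (fun p : κ × G => ‖⟪g p.1 p.2, f i 0⟫_ℂ‖ ^ 2) 1 := fun i => by
    have := hasSum_norm_inner_sq hW hg (fun p => hgW _ _)
      (fun u hu h0 => hgt u hu fun k n => h0 (k, n)) (hfW i 0)
    rwa [hf.1 (i, 0), one_pow] at this
  have hf0 : Orthonormal ℂ fun i => f i 0 :=
    hf.comp (fun i => (i, (0 : G))) fun i j hij => (Prod.mk.inj hij).1
  cases finite_or_infinite κ with
  | inl hfin =>
    have := Fintype.ofFinite κ
    by_contra! hlt
    have hle : ((Fintype.card κ + 1 : ℕ) : Cardinal) ≤ #ι := by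
      rw [Cardinal.mk_fintype] at hlt
      push_cast
      exact Cardinal.add_one_le_of_lt hlt
    -- For |κ|+1 indices i, Parseval gives ∑ |⟪g_{k,n}, f_{i,0}⟫|² = |κ|+1. By `h` the same sum runs
    -- over |⟪g_{k,0}, f_{i,-n}⟫|², which Bessel bounds by ∑ ‖g_{k,0}‖² = |κ|.
    obtain ⟨s, hs⟩ := exists_finset_le_card ι _ hle
    have h1 : HasSum (fun p : κ × G => ∑ i ∈ s, ‖⟪g p.1 0, f i (-p.2)⟫_ℂ‖ ^ 2) (s.card : ℝ) := by
      have := hasSum_sum (s := s) fun i _ => hpar i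
      simpa [h] using this
    have h2 : (s.card : ℝ) ≤ Fintype.card κ := by
      refine hasSum_le_of_sum_le h1 fun T => ?_
      calc ∑ p ∈ T, ∑ i ∈ s, ‖⟪g p.1 0, f i (-p.2)⟫_ℂ‖ ^ 2
          ≤ ∑ p ∈ Finset.univ ×ˢ T.image Prod.snd, ∑ i ∈ s, ‖⟪g p.1 0, f i (-p.2)⟫_ℂ‖ ^ 2 :=
            Finset.sum_le_sum_of_subset_of_nonneg (fun p hp => Finset.mem_product.2
              ⟨Finset.mem_univ _, Finset.mem_image_of_mem _ hp⟩)
              fun _ _ _ => Finset.sum_nonneg fun _ _ => by positivity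
        _ = ∑ k : κ, ∑ q ∈ T.image Prod.snd ×ˢ s, ‖⟪g k 0, f q.2 (-q.1)⟫_ℂ‖ ^ 2 := by
            rw [Finset.sum_product]
            refine Finset.sum_congr rfl fun k _ => ?_
            rw [Finset.sum_product]
        _ ≤ ∑ k : κ, (1 : ℝ) := by
            refine Finset.sum_le_sum fun k _ => ?_
            have hf' : Orthonormal ℂ fun q : G × ι => f q.2 (-q.1) :=
              hf.comp (fun q : G × ι => (q.2, -q.1)) fun q q' hq => by
                obtain ⟨h1, h2⟩ := Prod.mk.inj hq
                exact Prod.ext (neg_injective h2) h1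
            have := hf'.sum_inner_products_le (s := T.image Prod.snd ×ˢ s) (g k 0)
            rw [hg.1 (k, 0), one_pow] at this
            refine le_trans (le_of_eq (Finset.sum_congr rfl fun q _ => ?_)) this
            rw [norm_inner_symm]
        _ = Fintype.card κ := by simp
    have h3 : s.card ≤ Fintype.card κ := by exact_mod_cast h2
    omega
  | inr hinf =>
    -- For infinite κ, every f_{i,0} meets some g_{k,n} and each g_{k,n} meets only countably many
    -- of them.
    have hex : ∀ i, ∃ p : κ × G, ⟪g p.1 p.2, f i 0⟫_ℂ ≠ 0 := by
      intro i
      by_contra! h0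
      exact hf0.ne_zero i (hgt _ (hfW i 0) fun k n => h0 (k, n))
    choose φ hφ using hex
    have h1 : #ι ≤ #(κ × G) * ℵ₀ := by
      refine mk_le_mk_mul_of_mk_preimage_le φ fun p => ?_
      refine Set.Countable.le_aleph0 ((countable_inner_ne_zero hf0 (g p.1 p.2)).mono ?_)
      rintro i rfl
      exact hφ i
    have h2 : ℵ₀ ≤ #κ := Cardinal.aleph0_le_mk κ
    refine h1.trans ?_
    rw [mk_prod, Cardinal.lift_uzero]
    calc #κ * Cardinal.lift.{u} #G * ℵ₀ ≤ #κ * ℵ₀ * ℵ₀ := by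
          gcongr
          exact Cardinal.lift_le_aleph0.2 Cardinal.mk_le_aleph0
      _ = #κ := by rw [Cardinal.mul_aleph0_eq h2, Cardinal.mul_aleph0_eq h2]

theorem mk_le_of_orthonormal_of_complete (hW : IsClosed (W : Set E)) {ι κ : Type u} {f : ι → E}
    {g : κ → E} (hf : Orthonormal ℂ f) (hg : Orthonormal ℂ g) (hfW : ∀ i, f i ∈ W)
    (hgW : ∀ k, g k ∈ W) (hgt : ∀ u ∈ W, (∀ k, ⟪g k, u⟫_ℂ = 0) → u = 0) : #ι ≤ #κ :=
  mk_le_of_orthonormal (G := Unit) (f := fun i _ => f i) (g := fun k _ => g k) hW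
    (hf.comp Prod.fst fun _ _ h => Prod.ext h rfl) (hg.comp Prod.fst fun _ _ h => Prod.ext h rfl)
    (fun i _ => hfW i) (fun k _ => hgW k) (fun u hu h0 => hgt u hu fun k => h0 k ())
    fun _ _ _ => rfl

end Counting

/-! ### Finite multisets of positive integers and divisibility counts -/

theorem card_filter_dvd_eq_add {S : Type*} [Fintype S] {s : S → ℕ} {M : ℕ} (hs : ∀ x, 0 < s x)
    (hsM : ∀ x, s x ≤ M) (d : ℕ) :
    (Finset.univ.filter fun x => d ∣ s x).card = (Finset.univ.filter fun x => s x = d).card +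
      ∑ q ∈ (Finset.range (M + 1)).filter (fun q => d ∣ q ∧ d < q),
        (Finset.univ.filter fun x => s x = q).card := by
  rw [Finset.card_eq_sum_card_fiberwise (f := s)
    (t := insert d ((Finset.range (M + 1)).filter fun q => d ∣ q ∧ d < q)) ?_,
    Finset.sum_insert (by simp)]
  · congr 1
    · rw [Finset.filter_filter]
      congr 1
      ext x
      simp only [Finset.mem_filter, Finset.mem_univ, true_and]
      exact ⟨fun h => h.2, fun h => ⟨h ▸ dvd_rfl, h⟩⟩
    · refine Finset.sum_congr rfl fun q hq => ?_
      rw [Finset.filter_filter]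
      congr 1
      ext x
      simp only [Finset.mem_filter, Finset.mem_univ, true_and]
      exact ⟨fun h => h.2, fun h => ⟨h ▸ (Finset.mem_filter.1 hq).2.1, h⟩⟩
  · intro x hx
    have hx : d ∣ s x := by simpa using hx
    have := Nat.le_of_dvd (hs x) hx
    have := hsM x
    simp only [Finset.coe_insert, Set.mem_insert_iff, Finset.coe_filter, Finset.mem_range,
      Set.mem_ofPred_eq]
    rcases eq_or_ne (s x) d with h | h
    · exact Or.inl h
    · exact Or.inr ⟨by omega, hx, by omega⟩

/-- Two integer-valued functions on finite types have the same distribution if they have the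
same number of values divisible by `d`, for every `d`. -/
theorem card_filter_eq_of_card_filter_dvd {S T : Type*} [Fintype S] [Fintype T] {s : S → ℕ}
    {t : T → ℕ} (hs : ∀ x, 0 < s x) (ht : ∀ x, 0 < t x)
    (h : ∀ d, 0 < d → (Finset.univ.filter fun x => d ∣ s x).card =
      (Finset.univ.filter fun x => d ∣ t x).card) (p : ℕ) :
    (Finset.univ.filter fun x => s x = p).card = (Finset.univ.filter fun x => t x = p).card := by
  classical
  obtain ⟨M, hM⟩ : ∃ M, (∀ x, s x ≤ M) ∧ ∀ x, t x ≤ M :=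
    ⟨max (Finset.univ.sup s) (Finset.univ.sup t),
      fun x => le_max_of_le_left (Finset.le_sup (f := s) (Finset.mem_univ x)),
      fun x => le_max_of_le_right (Finset.le_sup (f := t) (Finset.mem_univ x))⟩
  by_contra hp
  let B := (Finset.range (M + 1)).filter fun q => (Finset.univ.filter fun x => s x = q).card ≠
    (Finset.univ.filter fun x => t x = q).card
  have hmem : ∀ q, (Finset.univ.filter fun x => s x = q).card ≠
      (Finset.univ.filter fun x => t x = q).card → q ∈ B := by
    intro q hq
    refine Finset.mem_filter.2 ⟨Finset.mem_range.2 ?_, hq⟩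
    by_contra hlt
    apply hq
    rw [Finset.filter_false_of_mem fun x _ hx => hlt (by have := hM.1 x; omega),
      Finset.filter_false_of_mem fun x _ hx => hlt (by have := hM.2 x; omega)]
    rfl
  -- At the largest d where the distributions differ, all proper multiples of d have equal counts,
  -- so equality of the divisibility counts forces equality at d.
  obtain ⟨d, hd, hmax⟩ := B.exists_max_image id ⟨p, hmem p hp⟩
  have hd' := (Finset.mem_filter.1 hd).2
  have hd0 : 0 < d := by
    rcases Nat.eq_zero_or_pos d with rfl | h0
    · exfalso
      apply hd'
      rw [Finset.filter_false_of_mem fun x _ => (hs x).ne',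
        Finset.filter_false_of_mem fun x _ => (ht x).ne']
      rfl
    · exact h0
  have h1 := h d hd0
  rw [card_filter_dvd_eq_add hs hM.1, card_filter_dvd_eq_add ht hM.2, Finset.sum_congr rfl fun q hq => ?_] at h1
  · exact hd' (Nat.add_right_cancel h1)
  · by_contra hne
    have := hmax q (hmem q hne)
    have := (Finset.mem_filter.1 hq).2.2
    simp only [id] at *
    omega

end CuntzKrieger

namespace CuntzKrieger

variable {N : ℕ} {A : Matrix (Fin N) (Fin N) ℕ}

/-! ### Disjointness of labels and eigenvectors of bilateral shifts -/

theorem PrimWord.tails_ne (hN : 2 ≤ N) {J J' : PrimWord A} (h : J ≠ J') (m n : ℕ) :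
    shift^[m] J.inf ≠ shift^[n] J'.inf :=
  fun h' => h (PrimWord.eq_of_tails hN h')

theorem PrimWord.tails_ne_aperiodic (J : PrimWord A) (K : AperiodicInfWord A) (m n : ℕ) :
    shift^[m] J.inf ≠ shift^[n] K.1 :=
  fun h => K.2.2 (PrimWord.isEventuallyPeriodic_of_tails h)

theorem tails_ne_of_mk_ne {K K' : AperiodicInfWord A}
    (h : Quotient.mk (tailSetoid A) K ≠ Quotient.mk (tailSetoid A) K') (m n : ℕ) :
    shift^[m] K.1 ≠ shift^[n] K'.1 :=
  fun h' => h (tailSetoid_iff.2 ⟨m, n, h'⟩)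

namespace Rep

variable {π ρ : Rep.{u} A} {J : PrimWord A}

theorem isClosed_atom (π : Rep.{u} A) (x : ℕ → Fin N) : IsClosed (π.atom x : Set π.H) := by
  have : (π.atom x : Set π.H) =
      ⋂ n, {v | π.hom (sWord A (pre x n)) (π.hom (star (sWord A (pre x n))) v) = v} := by
    ext v
    simp only [SetLike.mem_coe, mem_atom_iff, Set.mem_iInter]
    rfl
  rw [this]
  exact isClosed_iInter fun n => isClosed_eq (by fun_prop) continuous_id

theorem inner_adjoint (V : π.H →ₗᵢ[ℂ] ρ.H) (t : π.H) (u : ρ.H) :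
    ⟪t, ContinuousLinearMap.adjoint V.toContinuousLinearMap u⟫_ℂ = ⟪V t, u⟫_ℂ :=
  ContinuousLinearMap.adjoint_inner_right _ _ _

theorem IsP.eq_zero_of_disjoint {z : Circle} (h : π.IsP J.1 z) {y : ℕ → Fin N}
    (hy : ∀ m n, shift^[m] y ≠ shift^[n] J.inf) {u : π.H} (hu : u ∈ π.atom y) : u = 0 := by
  obtain ⟨Ω, hc, hz, _⟩ := h
  exact (isTotal_of_isCyclicUnit hc).eq_zero_of_disjoint hy (fun _ => mem_atom_of_eigen hz) hu

theorem IsShift.eq_zero_of_disjoint {v : ℤ → π.H} (h : π.IsShift J v) {y : ℕ → Fin N}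
    (hy : ∀ m n, shift^[m] y ≠ shift^[n] J.inf) {u : π.H} (hu : u ∈ π.atom y) : u = 0 :=
  h.total.eq_zero_of_disjoint hy h.mem hu

theorem IsPClass.eq_zero_of_disjoint {κ : TailClass A} (h : π.IsPClass κ) {y : ℕ → Fin N}
    (hy : ∀ K, Quotient.mk (tailSetoid A) K = κ → ∀ m n, shift^[m] y ≠ shift^[n] K.1) {u : π.H}
    (hu : u ∈ π.atom y) : u = 0 := by
  obtain ⟨K, hK⟩ := Quotient.exists_rep κ
  obtain ⟨Ω, hc, hΩ⟩ := h.exists_mem_atom hK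
  exact (isTotal_of_isCyclicUnit hc).eq_zero_of_disjoint (hy K hK) (fun _ => hΩ) hu

/-- Since s_J preserves inner products on the atom, they depend only on the difference of the
indices. This supplies the translation hypothesis of `mk_le_of_orthonormal` for the group ℤ. -/
theorem inner_shift_apply {v : ℤ → π.H} {w : ℤ → π.H} (hv : ∀ k, v k ∈ π.atom J.inf)
    (hvs : ∀ k, π.hom (sWord A J.1) (v k) = v (k + 1))
    (hws : ∀ k, π.hom (sWord A J.1) (w k) = w (k + 1)) (n : ℤ) :
    ⟪v n, w 0⟫_ℂ = ⟪v 0, w (-n)⟫_ℂ := by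
  have h1 : ∀ k l, ⟪v (k + 1), w (l + 1)⟫_ℂ = ⟪v k, w l⟫_ℂ := fun k l => by
    rw [← hvs, ← hws, inner_hom_hom (hv k)]
  have h2 : ∀ n k l, ⟪v (k + n), w (l + n)⟫_ℂ = ⟪v k, w l⟫_ℂ := fun n => by
    induction n using Int.induction_on with
    | zero => simp
    | succ n ih => intro k l; rw [← add_assoc, ← add_assoc, h1, ih]
    | pred n ih => intro k l; rw [← h1, add_assoc, add_assoc, sub_add_cancel, ih]
  rw [← h2 n 0 (-n), zero_add, neg_add_cancel]

/-- A bilateral shift has no eigenvectors. -/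
theorem IsShift.eq_zero_of_eigen {v : ℤ → π.H} (h : π.IsShift J v) {u : π.H} {z : Circle}
    (hu : π.hom (sWord A J.1) u = (z : ℂ) • u) : u = 0 := by
  -- The coefficients of an eigenvector have constant modulus along the shift, and square
  -- summability makes them zero.
  have hc : ∀ k, ‖⟪v (k + 1), u⟫_ℂ‖ = ‖⟪v k, u⟫_ℂ‖ := fun k => by
    rw [← inner_hom_hom (h.mem k) (w := u), h.hom_apply, hu, inner_smul_right, norm_mul,
      Circle.norm_coe, one_mul]
  have hc' : ∀ k, ‖⟪v k, u⟫_ℂ‖ = ‖⟪v 0, u⟫_ℂ‖ := fun k => by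
    induction k using Int.induction_on with
    | zero => rfl
    | succ n ih => rw [hc, ih]
    | pred n ih => rw [← hc, sub_add_cancel, ih]
  have hs := h.orthonormal.inner_products_summable u
  simp only [hc'] at hs
  rw [summable_const_iff] at hs
  refine h.eq_zero (mem_atom_of_eigen hu) fun k => ?_
  rw [← norm_eq_zero, hc']
  exact pow_eq_zero_iff two_ne_zero |>.1 hs

end Rep

/-! ## Uniqueness of the decomposition -/

namespace Decomposition

variable {π : Rep.{u} A}

/-- The embeddings of the summands of a decomposition. -/
structure Embeddings (D : Decomposition π) where
  cyc : ∀ i, (D.cyc i).H →ₗᵢ[ℂ] π.H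
  int : ∀ i, (D.int i).H →ₗᵢ[ℂ] π.H
  inf : ∀ i, (D.inf i).H →ₗᵢ[ℂ] π.H
  cyc_hom : ∀ i a u, cyc i ((D.cyc i).hom a u) = π.hom a (cyc i u)
  int_hom : ∀ i a u, int i ((D.int i).hom a u) = π.hom a (int i u)
  inf_hom : ∀ i a u, inf i ((D.inf i).hom a u) = π.hom a (inf i u)
  inner_cyc : ∀ i j, i ≠ j → ∀ t t', ⟪cyc i t, cyc j t'⟫_ℂ = 0
  inner_int : ∀ i j, i ≠ j → ∀ t t', ⟪int i t, int j t'⟫_ℂ = 0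
  inner_inf : ∀ i j, i ≠ j → ∀ t t', ⟪inf i t, inf j t'⟫_ℂ = 0
  eq_zero : ∀ u, (∀ i, ContinuousLinearMap.adjoint (cyc i).toContinuousLinearMap u = 0) →
    (∀ i, ContinuousLinearMap.adjoint (int i).toContinuousLinearMap u = 0) →
    (∀ i, ContinuousLinearMap.adjoint (inf i).toContinuousLinearMap u = 0) → u = 0

theorem nonempty_embeddings (D : Decomposition π) : Nonempty D.Embeddings := by
  obtain ⟨V, hV, hint⟩ := D.isDirectSum
  refine ⟨⟨fun i => V (.inl i), fun i => V (.inr (.inl i)), fun i => V (.inr (.inr i)),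
    fun i => hint (.inl i), fun i => hint (.inr (.inl i)), fun i => hint (.inr (.inr i)),
    fun i j hij => hV.OrthogonalFamily fun h => hij (Sum.inl.inj h),
    fun i j hij => hV.OrthogonalFamily fun h => hij (Sum.inl.inj (Sum.inr.inj h)),
    fun i j hij => hV.OrthogonalFamily fun h => hij (Sum.inr.inj (Sum.inr.inj h)),
    fun u h1 h2 h3 => ?_⟩⟩
  have h0 : ∀ i t, ⟪u, V i t⟫_ℂ = 0 := by
    have key : ∀ i, ContinuousLinearMap.adjoint (V i).toContinuousLinearMap u = 0 := by
      rintro (i | i | i)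
      exacts [h1 i, h2 i, h3 i]
    intro i t
    rw [← inner_conj_symm, ← Rep.inner_adjoint, key, inner_zero_right, map_zero]
  have hs := hV.hasSum_linearIsometryEquiv_symm (hV.linearIsometryEquiv u)
  rw [LinearIsometryEquiv.symm_apply_apply] at hs
  have hs2 := hs.mapL (innerSL ℂ u)
  simp only [innerSL_apply_apply, h0] at hs2
  exact inner_self_eq_zero.1 (hs2.unique hasSum_zero)

/-- An eigenvector of s_J lies in the atom of J J J ⋯. Its component in a summand vanishes if the
tails are disjoint, if the phase differs (eigenvectors are then orthogonal), or if the summand is an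
integral (shifts have no eigenvectors); otherwise it is a multiple of the cyclic vector. -/
theorem exists_cyc_basis (hN : 2 ≤ N) (D : Decomposition π) (J : PrimWord A) (z : Circle) :
    ∃ f : {i : D.CycIndex // (i.1, D.phase i) = (J, z)} → π.H, Orthonormal ℂ f ∧
      (∀ i, π.hom (sWord A J.1) (f i) = (z : ℂ) • f i) ∧
      ∀ u, π.hom (sWord A J.1) u = (z : ℂ) • u → (∀ i, ⟪f i, u⟫_ℂ = 0) → u = 0 := by
  obtain ⟨V⟩ := D.nonempty_embeddings
  choose Ω hΩc hΩz _ using D.isP_cyc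
  refine ⟨fun i => V.cyc i.1 (Ω i.1), ⟨fun i => ?_, fun i j hij => ?_⟩, fun i => ?_,
    fun u hu h0 => ?_⟩
  · rw [LinearIsometry.norm_map, (hΩc _).1]
  · exact V.inner_cyc _ _ (fun h => hij (Subtype.ext h)) _ _
  · obtain ⟨i, hi⟩ := i
    obtain ⟨rfl, rfl⟩ := Prod.mk.inj hi
    rw [← V.cyc_hom, hΩz, map_smul]
    rfl
  · have hm := Rep.mem_atom_of_eigen hu
    refine V.eq_zero u (fun i => ?_) (fun i => ?_) (fun i => ?_)
    · have hx := Rep.adjoint_mem_atom (V.cyc_hom i) hm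
      by_cases hJ : J = i.1
      · subst hJ
        refine (Rep.isTotal_of_isCyclicUnit (hΩc i)).eq_zero_of_eigen (hΩz i) hx ?_
        by_cases hz : D.phase i = z
        · rw [Rep.inner_adjoint]
          exact h0 ⟨i, by rw [hz]⟩
        · refine inner_eq_zero_of_phase_ne hz
            (Rep.inner_hom_hom (Rep.mem_atom_of_eigen (hΩz i))) (hΩz i) ?_
          rw [← Rep.adjoint_hom (V.cyc_hom i), hu, map_smul]
      · exact (D.isP_cyc i).eq_zero_of_disjoint (PrimWord.tails_ne hN hJ) hx
    · have hx := Rep.adjoint_mem_atom (V.int_hom i) hm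
      obtain ⟨v, hv⟩ := (D.isDirectIntegral i).exists_isShift (D.isP_fiber i)
      by_cases hJ : J = i.1
      · subst hJ
        refine hv.eq_zero_of_eigen (z := z) ?_
        rw [← Rep.adjoint_hom (V.int_hom i), hu, map_smul]
      · exact hv.eq_zero_of_disjoint (PrimWord.tails_ne hN hJ) hx
    · exact (D.isP_inf i).eq_zero_of_disjoint (fun K _ => J.tails_ne_aperiodic K)
        (Rep.adjoint_mem_atom (V.inf_hom i) hm)

/-- Inside the atom, orthogonality to all eigenvectors of s_J removes the summands P(J; z) and
leaves just the shifts of the integrals. This condition refers to π only, so different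
decompositions can be compared on the same subspace. -/
theorem exists_int_basis (hN : 2 ≤ N) (D : Decomposition π) (J : PrimWord A) :
    ∃ f : {i : D.IntIndex // i.1 = J} → ℤ → π.H,
      (Orthonormal ℂ fun p : {i : D.IntIndex // i.1 = J} × ℤ => f p.1 p.2) ∧
      (∀ i k, f i k ∈ π.atom J.inf) ∧ (∀ i k, π.hom (sWord A J.1) (f i k) = f i (k + 1)) ∧
      (∀ i k (z : Circle) w, π.hom (sWord A J.1) w = (z : ℂ) • w → ⟪w, f i k⟫_ℂ = 0) ∧
      ∀ u ∈ π.atom J.inf,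
        (∀ (z : Circle) w, π.hom (sWord A J.1) w = (z : ℂ) • w → ⟪w, u⟫_ℂ = 0) →
        (∀ i k, ⟪f i k, u⟫_ℂ = 0) → u = 0 := by
  obtain ⟨V⟩ := D.nonempty_embeddings
  choose v hv using fun i => (D.isDirectIntegral i).exists_isShift (D.isP_fiber i)
  refine ⟨fun i k => V.int i.1 (v i.1 k), ⟨fun p => ?_, fun p q hpq => ?_⟩, fun i k => ?_,
    fun i k => ?_, fun i k z w hw => ?_, fun u hu he h0 => ?_⟩
  · rw [LinearIsometry.norm_map, (hv _).orthonormal.1]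
  · by_cases h : p.1 = q.1
    · obtain ⟨i, k⟩ := p
      obtain ⟨j, l⟩ := q
      obtain rfl : i = j := h
      rw [LinearIsometry.inner_map_map]
      exact (hv _).orthonormal.2 fun h => hpq (congrArg (Prod.mk i) h)
    · exact V.inner_int _ _ (fun h' => h (Subtype.ext h')) _ _
  · obtain ⟨i, rfl⟩ := i
    exact Rep.apply_mem_atom (V.int_hom i) ((hv i).mem k)
  · obtain ⟨i, rfl⟩ := i
    rw [← V.int_hom, (hv i).hom_apply]
  · obtain ⟨i, rfl⟩ := i
    have : ContinuousLinearMap.adjoint (V.int i).toContinuousLinearMap w = 0 := by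
      refine (hv i).eq_zero_of_eigen (z := z) ?_
      rw [← Rep.adjoint_hom (V.int_hom i), hw, map_smul]
    rw [← inner_conj_symm, ← Rep.inner_adjoint, this, inner_zero_right, map_zero]
  · refine V.eq_zero u (fun i => ?_) (fun i => ?_) (fun i => ?_)
    · have hx := Rep.adjoint_mem_atom (V.cyc_hom i) hu
      by_cases hJ : J = i.1
      · subst hJ
        obtain ⟨Ω, hc, hz, _⟩ := D.isP_cyc i
        refine (Rep.isTotal_of_isCyclicUnit hc).eq_zero_of_eigen hz hx ?_
        rw [Rep.inner_adjoint]
        refine he (D.phase i) _ ?_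
        rw [← V.cyc_hom, hz, map_smul]
        rfl
      · exact (D.isP_cyc i).eq_zero_of_disjoint (PrimWord.tails_ne hN hJ) hx
    · have hx := Rep.adjoint_mem_atom (V.int_hom i) hu
      by_cases hJ : J = i.1
      · subst hJ
        refine (hv i).eq_zero hx fun k => ?_
        rw [Rep.inner_adjoint]
        exact h0 ⟨i, rfl⟩ k
      · exact (hv i).eq_zero_of_disjoint (PrimWord.tails_ne hN hJ) hx
    · exact (D.isP_inf i).eq_zero_of_disjoint (fun K _ => J.tails_ne_aperiodic K)
        (Rep.adjoint_mem_atom (V.inf_hom i) hu)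

theorem exists_inf_basis (D : Decomposition π) (K : AperiodicInfWord A) :
    ∃ f : {i : D.InfIndex // i.1 = Quotient.mk (tailSetoid A) K} → π.H, Orthonormal ℂ f ∧
      (∀ i, f i ∈ π.atom K.1) ∧ ∀ u ∈ π.atom K.1, (∀ i, ⟪f i, u⟫_ℂ = 0) → u = 0 := by
  obtain ⟨V⟩ := D.nonempty_embeddings
  choose Ω hΩc hΩ using fun i : {i : D.InfIndex // i.1 = Quotient.mk (tailSetoid A) K} =>
    (D.isP_inf i.1).exists_mem_atom i.2.symm
  refine ⟨fun i => V.inf i.1 (Ω i), ⟨fun i => ?_, fun i j hij => ?_⟩, fun i => ?_,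
    fun u hu h0 => ?_⟩
  · rw [LinearIsometry.norm_map, (hΩc _).1]
  · exact V.inner_inf _ _ (fun h => hij (Subtype.ext h)) _ _
  · exact Rep.apply_mem_atom (V.inf_hom i) (hΩ i)
  · refine V.eq_zero u (fun i => ?_) (fun i => ?_) (fun i => ?_)
    · exact (D.isP_cyc i).eq_zero_of_disjoint
        (fun m n h => PrimWord.tails_ne_aperiodic _ K n m h.symm)
        (Rep.adjoint_mem_atom (V.cyc_hom i) hu)
    · obtain ⟨v, hv⟩ := (D.isDirectIntegral i).exists_isShift (D.isP_fiber i)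
      exact hv.eq_zero_of_disjoint (fun m n h => PrimWord.tails_ne_aperiodic _ K n m h.symm)
        (Rep.adjoint_mem_atom (V.int_hom i) hu)
    · have hx := Rep.adjoint_mem_atom (V.inf_hom i) hu
      by_cases hi : i.1 = Quotient.mk (tailSetoid A) K
      · refine (Rep.isTotal_of_isCyclicUnit (hΩc ⟨i, hi⟩)).eq_zero_of_aperiodic K.2.2
          (fun _ => hΩ ⟨i, hi⟩) hx fun _ => ?_
        rw [← inner_conj_symm, Rep.inner_adjoint, h0 ⟨i, hi⟩, map_zero]
      · exact (D.isP_inf i).eq_zero_of_disjoint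
          (fun K' hK' => tails_ne_of_mk_ne fun h => hi (hK'.symm.trans h.symm)) hx

theorem mk_cyc_le (hN : 2 ≤ N) (D D' : Decomposition π) (J : PrimWord A) (z : Circle) :
    Cardinal.mk {i : D.CycIndex // (i.1, D.phase i) = (J, z)} ≤
      Cardinal.mk {i : D'.CycIndex // (i.1, D'.phase i) = (J, z)} := by
  obtain ⟨f, hf, hfz, _⟩ := D.exists_cyc_basis hN J z
  obtain ⟨g, hg, hgz, hgt⟩ := D'.exists_cyc_basis hN J z
  have hmem : ∀ u, u ∈ LinearMap.ker ((π.hom (sWord A J.1) - (z : ℂ) • 1 : π.H →L[ℂ] π.H) :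
      π.H →ₗ[ℂ] π.H) ↔ π.hom (sWord A J.1) u = (z : ℂ) • u := fun u => by
    rw [LinearMap.mem_ker]
    exact sub_eq_zero
  exact mk_le_of_orthonormal_of_complete
    (ContinuousLinearMap.isClosed_ker (π.hom (sWord A J.1) - (z : ℂ) • 1 : π.H →L[ℂ] π.H)) hf hg
    (fun i => (hmem _).2 (hfz i)) (fun i => (hmem _).2 (hgz i))
    fun u hu => hgt u ((hmem u).1 hu)

theorem mk_int_le (hN : 2 ≤ N) (D D' : Decomposition π) (J : PrimWord A) :
    Cardinal.mk {i : D.IntIndex // i.1 = J} ≤ Cardinal.mk {i : D'.IntIndex // i.1 = J} := by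
  obtain ⟨f, hf, hfm, hfs, hfe, _⟩ := D.exists_int_basis hN J
  obtain ⟨g, hg, hgm, hgs, hge, hgt⟩ := D'.exists_int_basis hN J
  let S : Set π.H := {w | ∃ z : Circle, π.hom (sWord A J.1) w = (z : ℂ) • w}
  have hS : ∀ u, u ∈ (Submodule.span ℂ S)ᗮ ↔
      ∀ (z : Circle) w, π.hom (sWord A J.1) w = (z : ℂ) • w → ⟪w, u⟫_ℂ = 0 := fun u => by
    refine ⟨fun h z w hw => h w (Submodule.subset_span ⟨z, hw⟩), fun h w hw => ?_⟩
    induction hw using Submodule.span_induction with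
    | mem w hw => obtain ⟨z, hw⟩ := hw; exact h z w hw
    | zero => exact inner_zero_left _
    | add x y _ _ hx hy => rw [inner_add_left, hx, hy, add_zero]
    | smul c x _ hx => rw [inner_smul_left, hx, mul_zero]
  refine mk_le_of_orthonormal (W := π.atom J.inf ⊓ (Submodule.span ℂ S)ᗮ)
    ((π.isClosed_atom _).inter (Submodule.isClosed_orthogonal _)) hf hg
    (fun i k => ⟨hfm i k, (hS _).2 (hfe i k)⟩) (fun i k => ⟨hgm i k, (hS _).2 (hge i k)⟩)
    (fun u hu h0 => hgt u hu.1 ((hS u).1 hu.2) h0) fun i k n => ?_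
  rw [Rep.inner_shift_apply (hgm k) (hgs k) (hfs i)]

theorem mk_inf_le (D D' : Decomposition π) (κ : TailClass A) :
    Cardinal.mk {i : D.InfIndex // i.1 = κ} ≤ Cardinal.mk {i : D'.InfIndex // i.1 = κ} := by
  obtain ⟨K, rfl⟩ := Quotient.exists_rep κ
  obtain ⟨f, hf, hfm, _⟩ := D.exists_inf_basis K
  obtain ⟨g, hg, hgm, hgt⟩ := D'.exists_inf_basis K
  exact mk_le_of_orthonormal_of_complete (π.isClosed_atom K.1) hf hg hfm hgm hgt

theorem exists_equiv_of_mk_le {α β : Type u} {γ : Type*} {f : α → γ} {g : β → γ}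
    (h1 : ∀ c, Cardinal.mk {a // f a = c} ≤ Cardinal.mk {b // g b = c})
    (h2 : ∀ c, Cardinal.mk {b // g b = c} ≤ Cardinal.mk {a // f a = c}) :
    ∃ e : α ≃ β, ∀ a, g (e a) = f a := by
  have e := fun c => Cardinal.eq.1 (le_antisymm (h1 c) (h2 c))
  exact ⟨Equiv.ofFiberEquiv fun c => (e c).some, Equiv.ofFiberEquiv_map _⟩

theorem equivalent (hN : 2 ≤ N) (D D' : Decomposition π) : D.Equivalent D' := by
  refine ⟨?_, ?_, ?_⟩
  · obtain ⟨e, he⟩ := exists_equiv_of_mk_le (f := fun i : D.CycIndex => (i.1, D.phase i))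
      (g := fun i : D'.CycIndex => (i.1, D'.phase i)) (fun c => mk_cyc_le hN D D' c.1 c.2)
      (fun c => mk_cyc_le hN D' D c.1 c.2)
    refine ⟨e, fun i => ?_⟩
    obtain ⟨h1, h2⟩ := Prod.mk.inj (he i)
    refine ⟨h1, h2, (D.isP_cyc i).equivalent ?_⟩
    have h3 : (D'.cyc (e i)).IsP (e i).1.1 (D'.phase (e i)) := D'.isP_cyc (e i)
    rw [h1, h2] at h3
    exact h3
  · obtain ⟨e, he⟩ := exists_equiv_of_mk_le (f := fun i : D.IntIndex => i.1)
      (g := fun i : D'.IntIndex => i.1) (mk_int_le hN D D') (mk_int_le hN D' D)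
    refine ⟨e, fun i => ⟨he i, ?_, fun t => (D.isP_fiber i t).equivalent ?_⟩⟩
    · obtain ⟨v, hv⟩ := (D.isDirectIntegral i).exists_isShift (D.isP_fiber i)
      obtain ⟨w, hw⟩ := (D'.isDirectIntegral (e i)).exists_isShift (D'.isP_fiber (e i))
      rw [he i] at hw
      exact hv.equivalent hw
    · have := D'.isP_fiber (e i) t
      rwa [he i] at this
  · obtain ⟨e, he⟩ := exists_equiv_of_mk_le (f := fun i : D.InfIndex => i.1)
      (g := fun i : D'.InfIndex => i.1) (mk_inf_le D D') (mk_inf_le D' D)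
    refine ⟨e, fun i => ⟨he i, (D.isP_inf i).equivalent ?_⟩⟩
    have := D'.isP_inf (e i)
    rwa [he i] at this

theorem isIrreducible (D : Decomposition π) : D.IsIrreducible :=
  ⟨fun i => (D.isP_cyc i).isIrreducible, fun i t => (D.isP_fiber i t).isIrreducible,
    fun i => (D.isP_inf i).isIrreducible⟩

end Decomposition

end CuntzKrieger

namespace CuntzKrieger

variable {N : ℕ} {A : Matrix (Fin N) (Fin N) ℕ}

namespace Decomposition

variable {π : Rep.{u} A}

/-! ## The multiplicities `ν_{J,p}` -/

open Cardinal

/-- The copies of the sums `⨁_{j=1}^p H_{J,p,j}`, for all `p`. -/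
abbrev CycCopies (D : Decomposition π) (J : PrimWord A) : Type u :=
  Σ p : ℕ+, (D.multCyc J p).out

theorem mk_cycCopies (D : Decomposition π) (J : PrimWord A) :
    #(D.CycCopies J) = Cardinal.sum (D.multCyc J) := by
  rw [Cardinal.mk_sigma]
  simp only [Cardinal.mk_out]

/-- The summands `P(J; e^{2πi/d})` correspond to the `p` which are divisible by `d`. -/
theorem mk_cycCopies_dvd (D : Decomposition π) (J : PrimWord A) {d : ℕ} (hd : 0 < d) :
    #{x : D.CycCopies J // d ∣ (x.1 : ℕ)} =
      #{i : D.CycIndex // (i.1, D.phase i) = (J, rootPhase d 0)} := by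
  -- The phase (j+1)/p equals 1/d exactly for j = p/d - 1, so each copy with d ∣ p contributes one
  -- summand.
  have hj : ∀ p : ℕ+, d ∣ (p : ℕ) → (p : ℕ) / d - 1 < p ∧ ((p : ℕ) / d - 1 + 1) * d = p := by
    rintro p ⟨k, hk⟩
    have hk0 : 0 < k := Nat.pos_of_ne_zero fun h => p.ne_zero (by rw [hk, h, mul_zero])
    rw [hk, Nat.mul_div_cancel_left _ hd, Nat.sub_add_cancel hk0]
    exact ⟨by nlinarith [Nat.sub_lt hk0 one_pos], mul_comm _ _⟩
  let G : {x : D.CycCopies J // d ∣ (x.1 : ℕ)} →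
      {i : D.CycIndex // (i.1, D.phase i) = (J, rootPhase d 0)} := fun x =>
    ⟨⟨J, x.1.1, x.1.2, ⟨(x.1.1 : ℕ) / d - 1, (hj _ x.2).1⟩⟩, by
      refine congrArg (Prod.mk J) ((rootPhase_eq_iff (hj _ x.2).1 hd).2 ?_)
      rw [(hj _ x.2).2]; simp⟩
  refine Cardinal.mk_congr (Equiv.ofBijective G ⟨?_, ?_⟩)
  · rintro ⟨⟨p, o⟩, hx⟩ ⟨⟨p', o'⟩, hx'⟩ h
    have h1 := eq_of_heq (Sigma.mk.inj (congrArg Subtype.val h)).2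
    obtain ⟨rfl, h2⟩ := Sigma.mk.inj h1
    obtain rfl := (Prod.mk.inj (eq_of_heq h2)).1
    rfl
  · rintro ⟨⟨J', p, o, j⟩, h⟩
    obtain ⟨h1, h2⟩ := Prod.mk.inj h
    obtain rfl : J' = J := h1
    have h3 : ((j : ℕ) + 1) * d = (0 + 1) * p := (rootPhase_eq_iff j.2 hd).1 h2
    rw [zero_add, one_mul] at h3
    have h4 : d ∣ (p : ℕ) := ⟨(j : ℕ) + 1, h3.symm.trans (mul_comm _ _)⟩
    refine ⟨⟨⟨p, o⟩, h4⟩, Subtype.ext ?_⟩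
    have h5 : (⟨(p : ℕ) / d - 1, (hj _ h4).1⟩ : Fin p) = j := Fin.ext (by
      change (p : ℕ) / d - 1 = j
      have := Nat.div_eq_of_eq_mul_left hd h3.symm
      omega)
    exact congrArg (fun x => (⟨J', p, o, x⟩ : D.CycIndex)) h5

theorem mk_cycCopies_eq (D : Decomposition π) (J : PrimWord A) (p : ℕ+) :
    #{x : D.CycCopies J // (x.1 : ℕ) = p} = D.multCyc J p := by
  rw [Cardinal.mk_congr (Equiv.subtypeEquivRight fun x => PNat.coe_inj),
    Cardinal.mk_congr (Equiv.sigmaSubtype p), Cardinal.mk_out]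

/-- For each d, the number of copies with d ∣ p is the multiplicity of P(J; e^{2πi/d}), which π
determines. The case d = 1 carries finiteness over to `D'`, after which the distribution of p is
recovered from these counts. -/
theorem sameFiniteMult (hN : 2 ≤ N) (D D' : Decomposition π) : D.SameFiniteMult D' := by
  intro J hJ
  have hdvd : ∀ d, 0 < d → #{x : D.CycCopies J // d ∣ (x.1 : ℕ)} =
      #{x : D'.CycCopies J // d ∣ (x.1 : ℕ)} := fun d hd => by
    rw [mk_cycCopies_dvd D J hd, mk_cycCopies_dvd D' J hd]
    exact le_antisymm (mk_cyc_le hN D D' J _) (mk_cyc_le hN D' D J _)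
  have hfin : #(D.CycCopies J) < ℵ₀ := by rwa [mk_cycCopies]
  have hfin' : #(D'.CycCopies J) < ℵ₀ := by
    have h1 := hdvd 1 one_pos
    simp only [one_dvd] at h1
    rw [Cardinal.mk_congr (Equiv.subtypeUnivEquiv fun _ => trivial),
      Cardinal.mk_congr (Equiv.subtypeUnivEquiv fun _ => trivial)] at h1
    rwa [← h1]
  have := Cardinal.lt_aleph0_iff_finite.1 hfin
  have := Fintype.ofFinite (D.CycCopies J)
  have := Cardinal.lt_aleph0_iff_finite.1 hfin'
  have := Fintype.ofFinite (D'.CycCopies J)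
  have hcard := card_filter_eq_of_card_filter_dvd (s := fun x : D.CycCopies J => (x.1 : ℕ))
    (t := fun x : D'.CycCopies J => (x.1 : ℕ)) (fun x => x.1.pos) (fun x => x.1.pos)
    fun d hd => by
      have := hdvd d hd
      rw [Cardinal.mk_fintype, Cardinal.mk_fintype, Nat.cast_inj] at this
      rwa [← Fintype.card_subtype, ← Fintype.card_subtype]
  funext p
  rw [← mk_cycCopies_eq, ← mk_cycCopies_eq, Cardinal.mk_fintype, Cardinal.mk_fintype,
    Fintype.card_subtype, Fintype.card_subtype, hcard]

end Decomposition

end CuntzKrieger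

theorem proposition5p7 {N : ℕ} (hN : 2 ≤ N) (A : Matrix (Fin N) (Fin N) ℕ)
    (hA : CuntzKrieger.IsAdmissible A) (π : CuntzKrieger.Rep.{u} A) (hπ : π.IsPermutative) :
    Nonempty (CuntzKrieger.Decomposition π) ∧
    (∀ D : CuntzKrieger.Decomposition π, D.IsIrreducible) ∧
    (∀ D D' : CuntzKrieger.Decomposition π, D.Equivalent D' ∧ D.SameFiniteMult D') :=
  ⟨hπ.nonempty_decomposition hA, fun D => D.isIrreducible,
    fun D D' => ⟨D.equivalent hN D', D.sameFiniteMult hN D'⟩⟩
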